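/- Let $\mathbb{K}$ be an algebraically closed field of characteristic zero, and let $p_1,\dots,p_4\in\mathbb{K}[t_1,t_2,t_3]$ be homogeneous of the same degree $n$ (some of the $p_i$ may be zero) with $\gcd(p_1,\dots,p_4)=1$. Assume that the Zariski closure $\mathscr{S}\subset\mathbb{P}^3(\mathbb{K})$ of the image of the rational map $\mathcal{P}=(p_1:p_2:p_3:p_4):\mathbb{P}^2(\mathbb{K})\dashrightarrow\mathbb{P}^3(\mathbb{K})$ is a surface, that is, has dimension two. Put $\deg(\mathcal{P})=n$, let $\deg(\mathscr{S})$ be the degree of the implicit equation of $\mathscr{S}$ (the form generating the ideal of $\mathscr{S}$), and let $\mathrm{degMap}(\mathcal{P})$ be the cardinality of the generic fibre of $\mathcal{P}$, that is, the number of points in $\mathcal P^{-1}(q)$ for all $q$ in a non-empty Zariski open subset of $\mathscr{S}$. Let $\mathscr{B}(\mathcal{P})=\{A\in\mathbb{P}^2(\mathbb{K}) : p_1(A)=\dots=p_4(A)=0\}$ be the set of base points. Let $x_1,\dots,x_4,y_1,\dots,y_4$ be new variables, let $\mathbb{F}$ be the algebraic closure of $\mathbb{K}(x_1,\dots,x_4,y_1,\dots,y_4)$,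 and put $W_1=\sum_{i=1}^4x_ip_i$, $W_2=\sum_{i=1}^4y_ip_i\in\mathbb{F}[t_1,t_2,t_3]$. The multiplicity of the base point locus is $$\mathrm{mult}(\mathscr{B}(\mathcal{P}))=\sum_{A\in\mathscr{B}(\mathcal{P})}\dim_{\mathbb{F}}\mathcal{O}_{\mathbb{P}^2(\mathbb{F}),A}/\langle\widetilde W_1,\widetilde W_2\rangle,$$ the sum of the intersection multiplicities at the base points of the plane curves $W_1=0$ and $W_2=0$ over $\mathbb{F}$, where $\widetilde W_i$ is a local equation of $W_i$ near $A$. Then $\mathscr{B}(\mathcal{P})$ is finite, these intersection multiplicities are finite, the implicit equation of $\mathscr{S}$ and the cardinality of the generic fibre exist, and $$\mathrm{mult}(\mathscr{B}(\mathcal{P}))=\deg(\mathcal{P})^2-\deg(\mathscr{S})\cdot\mathrm{degMap}(\mathcal{P}).$$ Moreover, $$\deg(\mathscr{S})\cdot\mathrm{degMap}(\mathcal{P})=\deg(\mathcal{P})^2-\sum_{A\in\mathscr{B}(\mathcal{P})}e(I_A,R_A),$$ where $R_A=\mathcal{O}_{\mathbb{P}^2(\mathbb{K}),A}$, $I_A\subset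 R_A$ is the ideal generated by local equations of $p_1,\dots,p_4$ near $A$, and $e(I_A,R_A)=\lim_{d\to\infty}2\dim_{\mathbb{K}}(R_A/I_A^{d+1})/d^2$ is the Hilbert–Samuel multiplicity. -/

import Mathlib

open MvPolynomial
open scoped LinearAlgebra.Projectivization

noncomputable section

/-! ### Projective algebraic sets -/

section ProjectiveSets

variable {K : Type*} [Field K] {m : ℕ}

/-- The ideal of all polynomials vanishing on a subset `T` of projective space, that is, vanishing
at every vector of homogeneous coordinates of every point of `T`. -/
def projVanishingIdeal (T : Set (ℙ K (Fin m → K))) : Ideal (MvPolynomial (Fin m) K) :=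
  MvPolynomial.vanishingIdeal K {v : Fin m → K | ∃ hv : v ≠ 0, Projectivization.mk K v hv ∈ T}

/-- The Zariski closure of a subset of projective space over an infinite field. -/
def projClosure (T : Set (ℙ K (Fin m → K))) : Set (ℙ K (Fin m → K)) :=
  {q | ∀ f ∈ projVanishingIdeal T, eval q.rep f = 0}

/-- Zariski closed subsets of projective space. -/
def IsProjClosed (T : Set (ℙ K (Fin m → K))) : Prop := projClosure T = T

/-- A projective surface: an irreducible Zariski closed set of dimension two, i.e. one whose
homogeneous coordinate ring is a domain of transcendence degree three. -/
def IsProjSurface (S : Set (ℙ K (Fin m → K))) : Prop :=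
  IsProjClosed S ∧ (projVanishingIdeal S).IsPrime ∧
    Algebra.trdeg K (MvPolynomial (Fin m) K ⧸ projVanishingIdeal S) = 3

/-- `G = 0` is the implicit equation of `S`: the form `G` generates the ideal of `S`. -/
def IsImplicitEquation (S : Set (ℙ K (Fin m → K))) (G : MvPolynomial (Fin m) K) : Prop :=
  G.IsHomogeneous G.totalDegree ∧ projVanishingIdeal S = Ideal.span {G}

/-- The degree of a surface in projective three-space: the degree of its implicit equation
(two such equations differ by a unit). -/
def surfaceDegree (S : Set (ℙ K (Fin 4 → K))) : ℕ :=
  sInf {d | ∃ G, IsImplicitEquation S G ∧ G.totalDegree = d}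

end ProjectiveSets

/-! ### Local rings of the projective plane -/

section LocalRings

variable {L : Type*} [Field L]

/-- The index of a non-vanishing coordinate of a point of the projective plane. -/
def chartIndex (A : ℙ L (Fin 3 → L)) : Fin 3 :=
  Classical.choose (Function.ne_iff.mp A.rep_nonzero)

/-- The coordinate with index `chartIndex A` is indeed non-zero at `A`. -/
theorem rep_chartIndex_ne_zero (A : ℙ L (Fin 3 → L)) : A.rep (chartIndex A) ≠ 0 :=
  Classical.choose_spec (Function.ne_iff.mp A.rep_nonzero)

/-- The affine coordinates of `A` in the chart where the coordinate `chartIndex A` equals `1`. -/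
def affineCoord (A : ℙ L (Fin 3 → L)) : Fin 2 → L :=
  fun k => A.rep ((chartIndex A).succAbove k) / A.rep (chartIndex A)

/-- The maximal ideal of a point of the affine plane. -/
def pointIdeal (a : Fin 2 → L) : Ideal (MvPolynomial (Fin 2) L) := RingHom.ker (eval a)

/-- The ideal of a point is prime. -/
instance pointIdeal_isPrime (a : Fin 2 → L) : (pointIdeal a).IsPrime :=
  RingHom.ker_isPrime (eval a)

/-- The local ring of the projective plane over `L` at `A`: the localization of the coordinate
ring of an affine chart at the maximal ideal of the point `A`. -/
abbrev PlaneLocalRing (A : ℙ L (Fin 3 → L)) : Type _ :=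
  Localization.AtPrime (pointIdeal (affineCoord A))

/-- The local equation near `A` of a form `f`: its dehomogenization in the chart at `A`, regarded
as an element of the local ring. -/
def localEquation (A : ℙ L (Fin 3 → L)) (f : MvPolynomial (Fin 3) L) : PlaneLocalRing A :=
  algebraMap (MvPolynomial (Fin 2) L) (PlaneLocalRing A)
    (aeval ((chartIndex A).insertNth (1 : MvPolynomial (Fin 2) L) X) f)

/-- The quotient of the local ring at `A` by local equations of `f` and `g`. -/
abbrev IntersectionRing (A : ℙ L (Fin 3 → L)) (f g : MvPolynomial (Fin 3) L) : Type _ :=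
  PlaneLocalRing A ⧸ Ideal.span {localEquation A f, localEquation A g}

/-- The multiplicity of intersection at `A` of the plane curves defined by `f` and `g`. -/
def intersectionMult (A : ℙ L (Fin 3 → L)) (f g : MvPolynomial (Fin 3) L) : ℕ :=
  Module.finrank L (IntersectionRing A f g)

/-- `e` is the Hilbert–Samuel multiplicity of an ideal `I` of a two-dimensional local ring `R`
with residue field `L`: the quotients `R / I ^ (d + 1)` have finite dimension over `L` and this
dimension is `(e / 2) * d ^ 2 + o(d ^ 2)`. -/
def IsHilbertSamuelMult (L : Type*) [Field L] {R : Type*} [CommRing R] [Algebra L R]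
    (I : Ideal R) (e : ℕ) : Prop :=
  (∀ d : ℕ, Module.Finite L (R ⧸ I ^ (d + 1))) ∧
    Filter.Tendsto
      (fun d : ℕ => 2 * (Module.finrank L (R ⧸ I ^ (d + 1)) : ℝ) / (d : ℝ) ^ 2)
      Filter.atTop (nhds (e : ℝ))

end LocalRings

/-! ### Rational maps from the plane to three-space -/

section Parametrization

variable {K : Type*} [Field K] (p : Fin 4 → MvPolynomial (Fin 3) K)

/-- The base points: the common zeros of the components. -/
def basePoints : Set (ℙ K (Fin 3 → K)) := {A | ∀ i, eval A.rep (p i) = 0}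

/-- The fibre over `q`: the points `A` at which `p` is defined, with `p(A) = q`. -/
def paramFiber (q : ℙ K (Fin 4 → K)) : Set (ℙ K (Fin 3 → K)) :=
  {A | ∃ h : (fun i => eval A.rep (p i)) ≠ 0,
    Projectivization.mk K (fun i => eval A.rep (p i)) h = q}

/-- The Zariski closure of the image of `p`. -/
def paramImage : Set (ℙ K (Fin 4 → K)) := projClosure {q | (paramFiber p q).Nonempty}

/-- The generic fibre of `p` has exactly `c` points: all fibres over a non-empty Zariski open
subset of the closure of the image do. -/
def IsGenericFiberCard (c : ℕ) : Prop :=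
  ∃ Z : Set (ℙ K (Fin 4 → K)), IsProjClosed Z ∧ ¬ paramImage p ⊆ Z ∧
    ∀ q ∈ paramImage p \ Z, (paramFiber p q).encard = c

/-- The degree of the rational map `p`: the cardinality of its generic fibre. -/
def degMap : ℕ := sInf {c | IsGenericFiberCard p c}

variable (K) in
/-- The algebraic closure of the field `K(x₁, …, x₄, y₁, …, y₄)`; the variable `xᵢ` has index
`(0, i)` and the variable `yᵢ` has index `(1, i)`. -/
abbrev GenericField : Type _ :=
  AlgebraicClosure (FractionRing (MvPolynomial (Fin 2 × Fin 4) K))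

variable (K) in
/-- The variables `xᵢ` (`k = 0`) and `yᵢ` (`k = 1`) as elements of `GenericField K`. -/
def genericCoeff (k : Fin 2) (i : Fin 4) : GenericField K :=
  algebraMap (FractionRing (MvPolynomial (Fin 2 × Fin 4) K)) (GenericField K)
    (algebraMap (MvPolynomial (Fin 2 × Fin 4) K) _ (X (k, i)))

/-- The generic linear combinations `W₁ = ∑ xᵢ pᵢ` (`k = 0`) and `W₂ = ∑ yᵢ pᵢ` (`k = 1`). -/
def genericCurve (k : Fin 2) : MvPolynomial (Fin 3) (GenericField K) :=
  ∑ i, C (genericCoeff K k i) * map (algebraMap K (GenericField K)) (p i)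

/-- A vector of homogeneous coordinates stays non-zero over `GenericField K`. -/
theorem algebraMap_rep_ne_zero (A : ℙ K (Fin 3 → K)) :
    (fun i => algebraMap K (GenericField K) (A.rep i)) ≠ 0 := by
  intro h
  apply A.rep_nonzero
  funext i
  exact (map_eq_zero (algebraMap K (GenericField K))).mp (congrFun h i)

/-- A point of the plane over `K`, regarded as a point of the plane over `GenericField K`. -/
def extendPoint (A : ℙ K (Fin 3 → K)) : ℙ (GenericField K) (Fin 3 → GenericField K) :=
  Projectivization.mk (GenericField K) (fun i => algebraMap K (GenericField K) (A.rep i))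
    (algebraMap_rep_ne_zero A)

/-- The multiplicity of the base point `A`: the intersection multiplicity of `W₁` and `W₂`. -/
def basePointMult (A : ℙ K (Fin 3 → K)) : ℕ :=
  intersectionMult (extendPoint A) (genericCurve p 0) (genericCurve p 1)

/-- The multiplicity of the base point locus. -/
def baseLocusMult : ℕ := ∑ᶠ A ∈ basePoints p, basePointMult p A

/-- The ideal generated by the local equations at `A` of the four components. -/
def localBaseIdeal (A : ℙ K (Fin 3 → K)) : Ideal (PlaneLocalRing A) :=
  Ideal.span (Set.range fun i => localEquation A (p i))

end Parametrization

end

open MvPolynomial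
open scoped LinearAlgebra.Projectivization

noncomputable section

/-! ### Bézout's theorem in the affine plane -/

section Bezout

/-! Since the `p i` have no common factor, there are finitely many base points, and some line misses
them all. With that line at infinity the `p i` become polynomials `q i` of degree at most `n` in two
variables, and two generic members `W₁`, `W₂` of their linear system do not meet at infinity.
Bézout's theorem (`finrank_quotient_span_pair_eq_sq`) makes their intersection a finite scheme of
length `n ^ 2`.

All genericity comes from `exists_algebraicIndependent_pair`: a point on two hyperplanes with
generic coefficients has two algebraically independent coordinates. Hence a common zero of `W₁` and
`W₂` is either a base point, defined over `K`, or a generic point of the plane, where a fixed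
non-zero `q j` cannot vanish. The Artinian coordinate ring of the intersection splits accordingly
(`finrank_quotient_eq_sum_add`) into the local rings at the base points, whose lengths add up to the
multiplicity of the base locus, and its localization away from `q j`.

The length of this localization may be computed over `k₀ = K(x, y)`. There the localization is the
function field of the variety of triples consisting of a point of the plane and two hyperplanes
through its image: the fraction field of a polynomial ring over `K(s, t)`. In the same way the
section of the surface by a generic line is the fraction field of a polynomial ring over the field
generated by the ratios `q i / q j`. The line section has dimension `deg G` over `k₀`, so the
localization has dimension `deg G` times the degree of `K(s, t)` over the field of ratios
(`finrank_away_linearSectionIdeal`). In characteristic zero a primitive element identifies this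
field degree with the number of points of a general fibre (`exists_encard_fiber_eq_finrank`).

For the Hilbert–Samuel version, let `I` be the ideal of the system in the local ring at a base point
over the large field, and `J` the ideal of `W₁`, `W₂`. These two form a regular sequence, so `J ^ d`
has colength `d (d + 1) / 2` times that of `J`. Moreover `J` is a reduction of `I`
(`exists_pow_le_pow_linearSectionIdeal`): a non-zero point of the fibre cone of `I` modulo `J` would
lie on two generic hyperplanes and have two algebraically independent ratios of coordinates, while
any three of the generators satisfy a non-trivial homogeneous relation over `K` in the fibre cone.
From `I ^ (d + r) ≤ J ^ d ≤ I ^ d` the two multiplicities agree in the limit. -/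

theorem homogeneousComponent_mul_of_totalDegree_le {σ R : Type*} [CommSemiring R]
    {f g : MvPolynomial σ R} {m n : ℕ} (hf : f.totalDegree ≤ m) (hg : g.totalDegree ≤ n) :
    homogeneousComponent (m + n) (f * g) =
      homogeneousComponent m f * homogeneousComponent n g := by
  classical
  ext d
  rw [coeff_homogeneousComponent, coeff_mul]
  split_ifs with hd
  · rw [coeff_mul]
    refine Finset.sum_congr rfl fun x hx => ?_
    rw [Finset.HasAntidiagonal.mem_antidiagonal] at hx
    rw [coeff_homogeneousComponent, coeff_homogeneousComponent]
    have hsum : x.1.degree + x.2.degree = m + n := by rw [← hd, ← hx, map_add]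
    by_cases h1 : x.1.degree = m
    · have h2 : x.2.degree = n := by omega
      simp [h1, h2]
    · rw [if_neg h1, zero_mul]
      rcases lt_or_gt_of_ne h1 with h | h
      · rw [coeff_eq_zero_of_totalDegree_lt (f := g), mul_zero]
        have : n < x.2.degree := by omega
        exact lt_of_le_of_lt hg this
      · rw [coeff_eq_zero_of_totalDegree_lt (f := f), zero_mul]
        exact lt_of_le_of_lt hf h
  · symm
    exact (((homogeneousComponent_isHomogeneous m f).mul
      (homogeneousComponent_isHomogeneous n g)).coeff_eq_zero hd)

theorem totalDegree_le_of_homogeneousComponent_eq_zero {σ R : Type*} [CommSemiring R]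
    {f : MvPolynomial σ R} {e : ℕ} (hf : f.totalDegree ≤ e + 1)
    (h : homogeneousComponent (e + 1) f = 0) : f.totalDegree ≤ e := by
  refine Finset.sup_le fun d hd => ?_
  have h1 : d.degree ≤ e + 1 := (le_totalDegree hd).trans hf
  have h2 : d.degree ≠ e + 1 := by
    intro h2
    have := congrArg (coeff d) h
    rw [coeff_homogeneousComponent, if_pos h2, coeff_zero] at this
    exact (mem_support_iff.mp hd) this
  have : d.degree ≤ e := by omega
  exact this

/-- The monomials are counted by rows, which gives a triangular number; the factor two avoids
division. -/
theorem two_mul_finrank_restrictTotalDegree (L : Type*) [Field L] (m : ℕ) :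
    2 * Module.finrank L (restrictTotalDegree (Fin 2) L m) = (m + 1) * (m + 2) := by
  have h1 : Module.finrank L (restrictTotalDegree (Fin 2) L m) =
      Nat.card {n : Fin 2 →₀ ℕ | n.degree ≤ m} :=
    Module.finrank_eq_nat_card_basis (basisRestrictSupport L {n : Fin 2 →₀ ℕ | n.degree ≤ m})
  have e : {n : Fin 2 →₀ ℕ | n.degree ≤ m} ≃ Σ i : Fin (m + 1), Fin (m + 1 - i) :=
    { toFun := fun n => ⟨⟨n.1 0, by
          have := n.2; simp [Finsupp.degree_eq_sum] at this; omega⟩, ⟨n.1 1, by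
          have := n.2; simp [Finsupp.degree_eq_sum] at this; simp; omega⟩⟩
      invFun := fun x => ⟨Finsupp.equivFunOnFinite.symm ![x.1, x.2], by
        have := x.2.2; have := x.1.2
        simp [Finsupp.degree_eq_sum]; omega⟩
      left_inv := fun n => by
        ext i; fin_cases i <;> simp
      right_inv := fun x => by simp }
  rw [h1, Nat.card_congr e, Nat.card_sigma]
  simp only [Nat.card_eq_fintype_card, Fintype.card_fin]
  rw [Fin.sum_univ_eq_sum_range (fun i => m + 1 - i) (m + 1)]
  have h2 : ∑ i ∈ Finset.range (m + 1), (m + 1 - i) = ∑ i ∈ Finset.range (m + 1), (i + 1) := by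
    rw [← Finset.sum_range_reflect]
    refine Finset.sum_congr rfl fun i hi => ?_
    rw [Finset.mem_range] at hi
    omega
  rw [h2, mul_comm]
  have h3 := Finset.sum_range_succ' (fun i => i) (m + 1)
  have h4 := Finset.sum_range_id_mul_two (m + 2)
  simp only [add_zero] at h3
  rw [← h3, h4]
  simp [mul_comm]

variable {L : Type*} [Field L] {n : ℕ} {f g : MvPolynomial (Fin 2) L}

/-- When the coefficients `a`, `b` have too large a degree, their leading forms are a syzygy of the
leading forms of `f` and `g`. By coprimality this is a multiple of the Koszul syzygy, and
subtracting that multiple of `(g, -f)` lowers the degree. -/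
theorem exists_totalDegree_le_of_mem_span_pair {σ : Type*} {f g : MvPolynomial σ L}
    (hf : f.totalDegree ≤ n) (hg : g.totalDegree ≤ n)
    (hg0 : homogeneousComponent n g ≠ 0)
    (hrel : IsRelPrime (homogeneousComponent n f) (homogeneousComponent n g))
    {m : ℕ} (e : ℕ) : ∀ a b : MvPolynomial σ L, a.totalDegree ≤ e → b.totalDegree ≤ e →
      (a * f + b * g).totalDegree ≤ m + n →
      ∃ a' b' : MvPolynomial σ L, a'.totalDegree ≤ m ∧ b'.totalDegree ≤ m ∧
        a' * f + b' * g = a * f + b * g := by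
  induction e with
  | zero => exact fun a b ha hb _ => ⟨a, b, ha.trans zero_le, hb.trans zero_le, rfl⟩
  | succ e ih =>
    intro a b ha hb hab
    by_cases hem : e + 1 ≤ m
    · exact ⟨a, b, ha.trans hem, hb.trans hem, rfl⟩
    have htop : homogeneousComponent (e + 1) a * homogeneousComponent n f +
        homogeneousComponent (e + 1) b * homogeneousComponent n g = 0 := by
      rw [← homogeneousComponent_mul_of_totalDegree_le ha hf,
        ← homogeneousComponent_mul_of_totalDegree_le hb hg, ← map_add]
      exact homogeneousComponent_eq_zero _ _ (by omega)
    have hdvd : homogeneousComponent n g ∣ homogeneousComponent (e + 1) a := by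
      refine hrel.symm.dvd_of_dvd_mul_right (z := homogeneousComponent n f) ?_
      exact ⟨-homogeneousComponent (e + 1) b, by linear_combination htop⟩
    obtain ⟨c, hc⟩ := hdvd
    have hc' : homogeneousComponent (e + 1) b = -(c * homogeneousComponent n f) := by
      refine mul_right_cancel₀ hg0 ?_
      rw [hc] at htop
      linear_combination htop
    by_cases hc0 : c = 0
    · subst hc0
      rw [mul_zero] at hc
      rw [zero_mul, neg_zero] at hc'
      exact ih a b (totalDegree_le_of_homogeneousComponent_eq_zero ha hc)
        (totalDegree_le_of_homogeneousComponent_eq_zero hb hc') hab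
    -- Homogeneity of `c` is not needed: only its degree enters, and the component of degree `e + 1`
    -- of a product with `c` sees only leading forms.
    have hdeg : n + c.totalDegree = e + 1 := by
      have h1 := congrArg MvPolynomial.totalDegree hc
      rw [totalDegree_mul_of_isDomain hg0 hc0,
        (homogeneousComponent_isHomogeneous _ _).totalDegree hg0,
        (homogeneousComponent_isHomogeneous _ _).totalDegree] at h1
      · exact h1.symm
      · rw [hc]; exact mul_ne_zero hg0 hc0
    have hg' : (homogeneousComponent n g).totalDegree ≤ n :=
      (homogeneousComponent_isHomogeneous _ _).totalDegree_le
    have hf' : (homogeneousComponent n f).totalDegree ≤ n :=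
      (homogeneousComponent_isHomogeneous _ _).totalDegree_le
    have key : ∀ h : MvPolynomial σ L, h.totalDegree ≤ n →
        homogeneousComponent (e + 1) (homogeneousComponent n h * c) =
        homogeneousComponent (e + 1) (h * c) := by
      intro h hh
      rw [← hdeg, homogeneousComponent_mul_of_totalDegree_le hh le_rfl,
        homogeneousComponent_mul_of_totalDegree_le
          (homogeneousComponent_isHomogeneous _ _).totalDegree_le le_rfl,
        homogeneousComponent_eq_self (homogeneousComponent_isHomogeneous n h)]
    have hself : ∀ h : MvPolynomial σ L, homogeneousComponent (e + 1)
        (homogeneousComponent (e + 1) h) = homogeneousComponent (e + 1) h := fun h =>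
      homogeneousComponent_eq_self (homogeneousComponent_isHomogeneous _ h)
    have hgc : (g * c).totalDegree ≤ e + 1 := by
      rw [← hdeg]; exact (totalDegree_mul _ _).trans (Nat.add_le_add_right hg _)
    have hfc : (f * c).totalDegree ≤ e + 1 := by
      rw [← hdeg]; exact (totalDegree_mul _ _).trans (Nat.add_le_add_right hf _)
    have ha1 : (a - g * c).totalDegree ≤ e := by
      refine totalDegree_le_of_homogeneousComponent_eq_zero
        ((totalDegree_sub _ _).trans (max_le ha hgc)) ?_
      rw [map_sub, ← key g hg, ← hc, hself, sub_self]
    have hb1 : (b + f * c).totalDegree ≤ e := by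
      refine totalDegree_le_of_homogeneousComponent_eq_zero
        ((totalDegree_add _ _).trans (max_le hb hfc)) ?_
      rw [map_add, ← key f hf, ← hself b, hc', map_neg, mul_comm c, neg_add_cancel]
    have heq : (a - g * c) * f + (b + f * c) * g = a * f + b * g := by ring
    obtain ⟨a', b', h1, h2, h3⟩ := ih _ _ ha1 hb1 (by rw [heq]; exact hab)
    exact ⟨a', b', h1, h2, h3.trans heq⟩

/-- The leading form of a common divisor divides both leading forms, so it is a unit; the divisor
then has degree zero and is a non-zero constant. -/
theorem isRelPrime_of_homogeneousComponent {σ : Type*} {f g : MvPolynomial σ L}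
    (hf : f.totalDegree ≤ n) (hg : g.totalDegree ≤ n)
    (hf0 : homogeneousComponent n f ≠ 0) (hg0 : homogeneousComponent n g ≠ 0)
    (hrel : IsRelPrime (homogeneousComponent n f) (homogeneousComponent n g)) :
    IsRelPrime f g := by
  have key : ∀ h d : MvPolynomial σ L, h.totalDegree ≤ n → homogeneousComponent n h ≠ 0 →
      d ∣ h → homogeneousComponent d.totalDegree d ∣ homogeneousComponent n h := by
    rintro h d hh hh0 ⟨c, rfl⟩
    have h0 : d * c ≠ 0 := by rintro h0; rw [h0, map_zero] at hh0; exact hh0 rfl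
    have hn : d.totalDegree + c.totalDegree = n := by
      refine le_antisymm ?_ ?_
      · rw [← totalDegree_mul_of_isDomain (left_ne_zero_of_mul h0) (right_ne_zero_of_mul h0)]
        exact hh
      · by_contra hlt
        exact hh0 (homogeneousComponent_eq_zero _ _
          (lt_of_le_of_lt (totalDegree_mul _ _) (not_le.mp hlt)))
    rw [← hn, homogeneousComponent_mul_of_totalDegree_le le_rfl le_rfl]
    exact dvd_mul_right _ _
  intro d hdf hdg
  have hu := hrel (key f d hf hf0 hdf) (key g d hg hg0 hdg)
  have hd0 : homogeneousComponent d.totalDegree d ≠ 0 := hu.ne_zero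
  have h1 : d.totalDegree = 0 := by
    obtain ⟨c, hc⟩ := hu.exists_right_inv
    have h2 := totalDegree_mul_of_isDomain hd0 (right_ne_zero_of_mul (hc ▸ one_ne_zero))
    rw [hc, totalDegree_one, (homogeneousComponent_isHomogeneous _ _).totalDegree hd0] at h2
    omega
  rw [totalDegree_eq_zero_iff_eq_C] at h1
  rw [h1]
  refine IsUnit.map C (isUnit_iff_ne_zero.mpr ?_)
  intro h0
  rw [h0, C_0] at h1
  rw [h1] at hd0
  simp at hd0

/-- **Bézout's theorem** in the affine plane, for two curves of degree `n` without common points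
at infinity. -/
theorem finrank_quotient_span_pair_eq_sq
    (hf : f.totalDegree ≤ n) (hg : g.totalDegree ≤ n)
    (hf0 : homogeneousComponent n f ≠ 0) (hg0 : homogeneousComponent n g ≠ 0)
    (hrel : IsRelPrime (homogeneousComponent n f) (homogeneousComponent n g)) :
    Module.Finite L (MvPolynomial (Fin 2) L ⧸ Ideal.span {f, g}) ∧
      Module.finrank L (MvPolynomial (Fin 2) L ⧸ Ideal.span {f, g}) = n ^ 2 := by
  set J : Ideal (MvPolynomial (Fin 2) L) := Ideal.span {f, g} with hJ
  set V : ℕ → Submodule L (MvPolynomial (Fin 2) L) := restrictTotalDegree (Fin 2) L with hV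
  have hVmem : ∀ m p, p ∈ V m ↔ p.totalDegree ≤ m := fun m p => mem_restrictTotalDegree _ _ _
  have hfg := isRelPrime_of_homogeneousComponent hf hg hf0 hg0 hrel
  have hg1 : g ≠ 0 := by rintro rfl; simp at hg0
  have hf1 : f ≠ 0 := by rintro rfl; simp at hf0
  have hgdeg : g.totalDegree = n := by
    refine le_antisymm hg ?_
    by_contra hlt
    exact hg0 (homogeneousComponent_eq_zero _ _ (not_le.mp hlt))
  have hVfin : ∀ m, Module.Finite L (V m) := fun m => by rw [hV]; infer_instance
  -- The right-hand map of the filtered Koszul complex `0 → V k → V (n + k) ^ 2 → V (n + k + n)`.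
  -- Its range is all of the ideal in that degree by the syzygy reduction above, and its kernel is
  -- `V k` by coprimality.
  let ψ : ∀ k, (V (n + k) × V (n + k)) →ₗ[L] MvPolynomial (Fin 2) L := fun k =>
    (LinearMap.mulRight L f ∘ₗ (V (n + k)).subtype).coprod
      (LinearMap.mulRight L g ∘ₗ (V (n + k)).subtype)
  have hψ : ∀ k x, ψ k x = x.1.1 * f + x.2.1 * g := fun k x => rfl
  have hrange : ∀ k, LinearMap.range (ψ k) = J.restrictScalars L ⊓ V (n + k + n) := by
    intro k
    ext p
    constructor
    · rintro ⟨⟨⟨a, ha⟩, ⟨b, hb⟩⟩, rfl⟩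
      rw [hVmem] at ha hb
      refine ⟨?_, ?_⟩
      · exact Ideal.mem_span_pair.mpr ⟨a, b, rfl⟩
      · show _ ∈ V _
        rw [hVmem, hψ]
        refine (totalDegree_add _ _).trans (max_le ?_ ?_)
        · exact (totalDegree_mul _ _).trans (add_le_add ha hf)
        · exact (totalDegree_mul _ _).trans (add_le_add hb hg)
    · rintro ⟨hpJ, hpV⟩
      obtain ⟨a, b, hab⟩ := Ideal.mem_span_pair.mp hpJ
      have hpV' : p.totalDegree ≤ n + k + n := (hVmem _ _).mp hpV
      obtain ⟨a', b', ha', hb', h⟩ := exists_totalDegree_le_of_mem_span_pair hf hg hg0 hrel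
        (max a.totalDegree b.totalDegree) a b (le_max_left _ _) (le_max_right _ _)
        (by rw [hab]; exact hpV')
      exact ⟨(⟨a', (hVmem _ _).mpr ha'⟩, ⟨b', (hVmem _ _).mpr hb'⟩), by rw [hψ]; exact h.trans hab⟩
  have hker : ∀ k, Module.finrank L (LinearMap.ker (ψ k)) = Module.finrank L (V k) := by
    intro k
    let χ₁ : V k →ₗ[L] V (n + k) :=
      LinearMap.codRestrict _ (LinearMap.mulRight L g ∘ₗ (V k).subtype) fun c => by
        rw [hVmem, add_comm]
        exact (totalDegree_mul _ _).trans (add_le_add ((hVmem _ _).mp c.2) hg)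
    let χ₂ : V k →ₗ[L] V (n + k) :=
      LinearMap.codRestrict _ (-(LinearMap.mulRight L f ∘ₗ (V k).subtype)) fun c => by
        rw [hVmem, add_comm, LinearMap.neg_apply, totalDegree_neg]
        exact (totalDegree_mul _ _).trans (add_le_add ((hVmem _ _).mp c.2) hf)
    let χ : V k →ₗ[L] LinearMap.ker (ψ k) :=
      LinearMap.codRestrict _ (χ₁.prod χ₂) fun c => by
        rw [LinearMap.mem_ker, hψ]
        show c.1 * g * f + -(c.1 * f) * g = 0
        ring
    refine (LinearEquiv.finrank_eq (LinearEquiv.ofBijective χ ⟨?_, ?_⟩)).symm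
    · intro x y hxy
      have h1 : x.1 * g = y.1 * g := congrArg (fun z => z.1.1.1) hxy
      exact Subtype.ext (mul_right_cancel₀ hg1 h1)
    · rintro ⟨⟨⟨a, ha⟩, ⟨b, hb⟩⟩, hab⟩
      rw [LinearMap.mem_ker, hψ] at hab
      simp only at hab
      obtain ⟨c, rfl⟩ : g ∣ a := hfg.symm.dvd_of_dvd_mul_right (z := f)
        ⟨-b, by linear_combination hab⟩
      have hbc : b = -(c * f) := by
        refine mul_right_cancel₀ hg1 ?_
        linear_combination hab
      have hck : c ∈ V k := by
        rw [hVmem] at ha ⊢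
        by_cases hc0 : c = 0
        · simp [hc0]
        rw [totalDegree_mul_of_isDomain hg1 hc0, hgdeg] at ha
        omega
      refine ⟨⟨c, hck⟩, ?_⟩
      ext1; ext1 <;> ext1
      · exact mul_comm _ _
      · exact hbc.symm
  let θ : ∀ k, V k →ₗ[L] (MvPolynomial (Fin 2) L ⧸ J) := fun k =>
    (Ideal.Quotient.mkₐ L J).toLinearMap ∘ₗ (V k).subtype
  have hkerθ : ∀ k, Module.finrank L (LinearMap.ker (θ (n + k + n))) =
      Module.finrank L (LinearMap.range (ψ k)) := by
    intro k
    rw [hrange]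
    have : (LinearMap.ker (θ (n + k + n))).map (V (n + k + n)).subtype =
        J.restrictScalars L ⊓ V (n + k + n) := by
      ext p
      simp only [Submodule.mem_map, LinearMap.mem_ker, Submodule.mem_inf,
        Submodule.restrictScalars_mem]
      constructor
      · rintro ⟨y, hy, rfl⟩
        exact ⟨Ideal.Quotient.eq_zero_iff_mem.mp hy, y.2⟩
      · rintro ⟨h1, h2⟩
        exact ⟨⟨p, h2⟩, Ideal.Quotient.eq_zero_iff_mem.mpr h1, rfl⟩
    rw [← this]
    exact (LinearEquiv.finrank_eq (Submodule.equivMapOfInjective _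
      (Submodule.subtype_injective _) _))
  -- The alternating sum of dimensions is a second difference, with step `n`, of triangular numbers,
  -- which equals `n ^ 2`.
  have hrangeθ : ∀ k, Module.finrank L (LinearMap.range (θ (n + k + n))) = n ^ 2 := by
    intro k
    have h1 := LinearMap.finrank_range_add_finrank_ker (θ (n + k + n))
    have h2 := LinearMap.finrank_range_add_finrank_ker (ψ k)
    rw [hkerθ] at h1
    rw [hker, Module.finrank_prod] at h2
    have t1 : 2 * Module.finrank L (V (n + k + n)) = ((n + k + n) + 1) * ((n + k + n) + 2) :=
      two_mul_finrank_restrictTotalDegree L (n + k + n)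
    have t2 : 2 * Module.finrank L (V (n + k)) = ((n + k) + 1) * ((n + k) + 2) :=
      two_mul_finrank_restrictTotalDegree L (n + k)
    have t3 : 2 * Module.finrank L (V k) = (k + 1) * (k + 2) :=
      two_mul_finrank_restrictTotalDegree L k
    zify at h1 h2 t1 t2 t3 ⊢
    linarith
  have hmono : ∀ i j, i ≤ j → LinearMap.range (θ i) ≤ LinearMap.range (θ j) := by
    rintro i j hij _ ⟨⟨x, hx⟩, rfl⟩
    exact ⟨⟨x, (hVmem _ _).mpr (((hVmem _ _).mp hx).trans hij)⟩, rfl⟩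
  -- An increasing chain of subspaces of the same finite dimension is constant, and these subspaces
  -- exhaust the quotient.
  have hconst : ∀ k, LinearMap.range (θ (n + k + n)) = LinearMap.range (θ (n + 0 + n)) := by
    intro k
    exact (Submodule.eq_of_le_of_finrank_eq (hmono _ _ (by omega))
      ((hrangeθ 0).trans (hrangeθ k).symm)).symm
  have htop : LinearMap.range (θ (n + 0 + n)) = ⊤ := by
    rw [eq_top_iff]
    rintro x -
    obtain ⟨p, rfl⟩ := Ideal.Quotient.mk_surjective x
    rw [← hconst p.totalDegree]
    exact ⟨⟨p, (hVmem _ _).mpr (by omega)⟩, rfl⟩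
  refine ⟨Module.Finite.of_surjective _ (LinearMap.range_eq_top.mp htop), ?_⟩
  rw [← hrangeθ 0, htop, finrank_top]

end Bezout

/-! ### Points on two generic hyperplanes -/

section Generic

/-- The coordinates of a point of a linear space of codimension two with generic equations
generate a field of transcendence degree at least two. -/
theorem exists_algebraicIndependent_pair {K F : Type*} [Field K] [Field F] [Algebra K F]
    {ι : Type*} [Fintype ι] {x : Fin 2 × ι → F} (hx : AlgebraicIndependent K x) (b : ι → F) {j : ι}
    (hj : b j = 1) (h : ∀ k, ∑ i, x (k, i) * b i = 0) :
    ∃ i k, AlgebraicIndependent K ![b i, b k] := by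
  classical
  -- Otherwise the `b i` have rank at most one in the algebraic matroid. The equations express each
  -- `x (k, j)` through the `b i` and the `x (k, i)` with `i ≠ j`, so the rank of all the `x` is at
  -- most one more than the number of these remaining ones, although two have been left out.
  by_contra! hcon
  set M := AlgebraicIndependent.matroid K F with hM
  have h1 : M.eRk (Set.range b) ≤ 1 := by
    obtain ⟨t, ht⟩ := M.exists_isBasis (Set.range b) (by simp [hM])
    rw [← ht.encard_eq_eRk]
    by_contra! hlt
    obtain ⟨c, d, hc, hd, hcd⟩ := Set.one_lt_encard_iff.mp hlt
    obtain ⟨i, rfl⟩ := ht.subset hc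
    obtain ⟨k, rfl⟩ := ht.subset hd
    have hind : M.Indep {b i, b k} := ht.indep.subset (by
      rintro z (rfl | rfl) <;> assumption)
    rw [hM, AlgebraicIndependent.matroid_indep_iff] at hind
    apply hcon i k
    have hinj : Function.Injective ![b i, b k] := by
      intro p q; fin_cases p <;> fin_cases q <;> simp [hcd, hcd.symm]
    refine .of_subtype_range hinj ?_
    have hr : Set.range ![b i, b k] = {b i, b k} := by simp [Set.pair_comm]
    rw [hr]
    exact hind
  set s : Set F := x '' {z | z.2 ≠ j} with hs
  have hscard : s.encard + 2 ≤ (Set.range x).encard := by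
    rw [hs, hx.injective.encard_image, ← Set.image_univ, hx.injective.encard_image]
    have : (Set.univ : Set (Fin 2 × ι)) = {z | z.2 ≠ j} ∪ {(0, j), (1, j)} := by
      ext ⟨k, i⟩
      by_cases hi : i = j <;> fin_cases k <;> simp [hi]
    rw [this, Set.encard_union_eq, Set.encard_pair (by simp)]
    rw [Set.disjoint_left]
    rintro ⟨k, i⟩ h1 h2
    simp at h1 h2
    tauto
  have hcl : Set.range x ⊆ M.closure (Set.range b ∪ s) := by
    rintro _ ⟨⟨k, i⟩, rfl⟩
    by_cases hi : i = j
    · subst hi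
      rw [hM, AlgebraicIndependent.matroid_closure_eq]
      have hmem : x (k, i) ∈ Algebra.adjoin K (Set.range b ∪ s) := by
        have h2 := h k
        rw [← Finset.add_sum_erase _ _ (Finset.mem_univ i), hj, mul_one] at h2
        rw [eq_neg_of_add_eq_zero_left h2]
        refine neg_mem (sum_mem fun l hl => mul_mem ?_ ?_)
        · exact Algebra.subset_adjoin (Or.inr ⟨(k, l), Finset.ne_of_mem_erase hl, rfl⟩)
        · exact Algebra.subset_adjoin (Or.inl ⟨l, rfl⟩)
      exact isAlgebraic_algebraMap
        (⟨_, hmem⟩ : Algebra.adjoin K (Set.range b ∪ s))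
    · exact M.mem_closure_of_mem (Or.inr ⟨_, hi, rfl⟩) (by simp [hM])
  have hind : M.Indep (Set.range x) := by
    rw [hM, AlgebraicIndependent.matroid_indep_iff]
    exact hx.to_subtype_range
  have h3 : (Set.range x).encard ≤ 1 + s.encard := by
    rw [← hind.eRk_eq_encard]
    refine (M.eRk_mono hcl).trans ?_
    rw [M.eRk_closure_eq]
    exact (M.eRk_union_le_eRk_add_eRk _ _).trans (add_le_add h1 (M.eRk_le_encard _))
  have h4 : s.encard ≠ ⊤ := (Set.toFinite s).encard_lt_top.ne
  have h5 := hscard.trans h3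
  rw [add_comm 1] at h5
  have h6 := (ENat.add_le_add_iff_left h4).mp h5
  norm_num at h6

end Generic

/-! ### Generic linear sections as function fields of incidence varieties -/

section GenericSection

variable {K : Type*} [Field K] {τ ι Q : Type*} [Fintype ι] [DecidableEq ι] [Field Q] [Algebra K Q]

/-- The field of rational functions in the coefficients of two linear forms. -/
local notation "k₀" => FractionRing (MvPolynomial (Fin 2 × ι) K)

/-- The ideal generated by `I` and two generic linear combinations of the polynomials `φ i`. -/
def genericSectionIdeal (I : Ideal (MvPolynomial τ K)) (φ : ι → MvPolynomial τ K) :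
    Ideal (MvPolynomial τ k₀) :=
  I.map (map (algebraMap K k₀)) ⊔ Ideal.span (Set.range fun k : Fin 2 =>
    ∑ i, C (algebraMap (MvPolynomial (Fin 2 × ι) K) k₀ (X (k, i))) * map (algebraMap K k₀) (φ i))

/-- The coefficients of the two generic hyperplanes through the point `b`, where `b j = 1`. -/
def hyperplaneCoeff {R : Type*} [CommRing R] (b : ι → R) (j : ι) (z : Fin 2 × ι) :
    MvPolynomial (Fin 2 × {i // i ≠ j}) R :=
  if h : z.2 ≠ j then X (z.1, ⟨z.2, h⟩) else -∑ i : {i // i ≠ j}, C (b i) * X (z.1, i)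

theorem map_hyperplaneCoeff {R R' : Type*} [CommRing R] [CommRing R'] (f : R →+* R') (b : ι → R)
    (j : ι) (z : Fin 2 × ι) :
    map f (hyperplaneCoeff b j z) = hyperplaneCoeff (fun i => f (b i)) j z := by
  unfold hyperplaneCoeff
  split_ifs <;> simp

theorem sum_mul_hyperplaneCoeff {R : Type*} [CommRing R] {b : ι → R} {j : ι} (hj : b j = 1)
    (k : Fin 2) : ∑ i, hyperplaneCoeff b j (k, i) * C (b i) = 0 := by
  rw [← Finset.add_sum_erase _ _ (Finset.mem_univ j), hj, C_1, mul_one]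
  have h1 : ∑ i ∈ Finset.univ.erase j, hyperplaneCoeff b j (k, i) * C (b i) =
      ∑ i : {i // i ≠ j}, C (b i) * X (k, i) := by
    rw [← Finset.sum_subtype (s := Finset.univ.erase j) (p := fun i => i ≠ j) (by simp)
      (f := fun i => hyperplaneCoeff b j (k, i) * C (b i)) |>.symm]
    refine Finset.sum_congr rfl fun i _ => ?_
    rw [hyperplaneCoeff, dif_pos i.2, mul_comm]
  rw [h1, hyperplaneCoeff, dif_neg (by simp), neg_add_cancel]

variable (I : Ideal (MvPolynomial τ K)) (φ : ι → MvPolynomial τ K) (j : ι)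
  (p : MvPolynomial τ K →ₐ[K] Q)

/-- The inclusion of `K[τ][x, y]` into `K(x, y)[τ]`. -/
def swapCoeff : MvPolynomial (Fin 2 × ι) (MvPolynomial τ K) →+* MvPolynomial τ k₀ :=
  eval₂Hom (map (algebraMap K k₀)) fun z =>
    C (algebraMap (MvPolynomial (Fin 2 × ι) K) k₀ (X z))

theorem swapCoeff_map (d : MvPolynomial (Fin 2 × ι) K) :
    swapCoeff (map (algebraMap K (MvPolynomial τ K)) d) = C (algebraMap _ k₀ d) := by
  have : (swapCoeff (τ := τ)).comp (map (algebraMap K (MvPolynomial τ K))) =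
      C.comp (algebraMap (MvPolynomial (Fin 2 × ι) K) k₀) := by
    apply MvPolynomial.ringHom_ext
    · intro c
      simp only [swapCoeff, MvPolynomial.algebraMap_eq, RingHom.comp_apply, map_C, coe_eval₂Hom,
        eval₂_C, IsScalarTower.algebraMap_apply K (MvPolynomial (Fin 2 × ι) K) k₀]
    · intro z; simp [swapCoeff]
  exact congrFun (congrArg DFunLike.coe this) d

/-- As `φ j` is `1` modulo `I`, the two hyperplane equations can be solved for the coefficients with
index `j`. Modulo the section ideal, `H` is therefore congruent to a polynomial in the other
coefficients only, and the hypothesis says that its coefficients lie in the kernel `I` of `p`. -/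
theorem swapCoeff_mem {I : Ideal (MvPolynomial τ K)} {p : MvPolynomial τ K →ₐ[K] Q}
    (hI : RingHom.ker p = I) (hj : p (φ j) = 1) (H : MvPolynomial (Fin 2 × ι) (MvPolynomial τ K))
    (hH : eval₂Hom (C.comp (p : MvPolynomial τ K →+* Q))
      (hyperplaneCoeff (fun i => p (φ i)) j) H = 0) :
    swapCoeff H ∈ genericSectionIdeal I φ := by
  set B := genericSectionIdeal I φ with hB
  let η : MvPolynomial (Fin 2 × ι) (MvPolynomial τ K) →+*
    MvPolynomial (Fin 2 × {i // i ≠ j}) (MvPolynomial τ K) := eval₂Hom C (hyperplaneCoeff φ j)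
  let r : MvPolynomial (Fin 2 × {i // i ≠ j}) (MvPolynomial τ K) →+*
    MvPolynomial (Fin 2 × ι) (MvPolynomial τ K) :=
      (rename (fun z : Fin 2 × {i // i ≠ j} => (z.1, (z.2 : ι)))).toRingHom
  have hIB : ∀ f ∈ I, map (algebraMap K k₀) f ∈ B := fun f hf =>
    Ideal.mem_sup_left (Ideal.mem_map_of_mem _ hf)
  have h1 : (Ideal.Quotient.mk B).comp swapCoeff =
      ((Ideal.Quotient.mk B).comp swapCoeff).comp (r.comp η) := by
    apply MvPolynomial.ringHom_ext
    · intro f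
      simp [η, r, swapCoeff]
    · rintro ⟨k, i⟩
      by_cases hi : i = j
      · subst hi
        have hmem : φ i - 1 ∈ I := by
          rw [← hI, RingHom.mem_ker, map_sub, map_one]
          exact sub_eq_zero.mpr hj
        have hW : ∑ l, C (algebraMap (MvPolynomial (Fin 2 × ι) K) k₀ (X (k, l))) *
            map (algebraMap K k₀) (φ l) ∈ B :=
          Ideal.mem_sup_right (Ideal.subset_span ⟨k, rfl⟩)
        rw [← Finset.add_sum_erase _ _ (Finset.mem_univ i),
          Finset.sum_subtype (p := fun l => l ≠ i) (F := inferInstance) _ (by simp)] at hW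
        simp only [RingHom.comp_apply]
        rw [Ideal.Quotient.mk_eq_mk_iff_sub_mem]
        have h2 := sub_mem hW (B.mul_mem_left
          (C (algebraMap (MvPolynomial (Fin 2 × ι) K) k₀ (X (k, i)))) (hIB _ hmem))
        convert h2 using 1
        simp [η, r, swapCoeff, hyperplaneCoeff, mul_comm]
        ring
      · simp [η, r, swapCoeff, hyperplaneCoeff, hi]
  have h2 : map (p : MvPolynomial τ K →+* Q) (η H) = 0 := by
    rw [← hH]
    refine congrFun (congrArg DFunLike.coe (?_ : (map (p : MvPolynomial τ K →+* Q)).comp η = _)) H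
    apply MvPolynomial.ringHom_ext
    · intro f; simp [η]
    · intro z
      simp only [RingHom.comp_apply, η, coe_eval₂Hom, eval₂_X]
      rw [map_hyperplaneCoeff]
      rfl
  have h3 : η H ∈ I.map C := by
    rw [← RingHom.mem_ker, MvPolynomial.ker_map] at h2
    rw [← hI]
    exact h2
  have h4 := congrFun (congrArg DFunLike.coe h1) H
  simp only [RingHom.comp_apply] at h4
  rw [← Ideal.Quotient.eq_zero_iff_mem, h4, Ideal.Quotient.eq_zero_iff_mem]
  have h5 : I.map C ≤ B.comap (swapCoeff.comp r) := by
    rw [Ideal.map_le_iff_le_comap]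
    intro f hf
    rw [Ideal.mem_comap, Ideal.mem_comap]
    simpa [r, swapCoeff] using hIB f hf
  exact h5 h3

/-- The coefficients of two generic hyperplanes through a generic point of the image. -/
def incidenceHom : MvPolynomial (Fin 2 × ι) K →ₐ[K] MvPolynomial (Fin 2 × {i // i ≠ j}) Q :=
  aeval (hyperplaneCoeff (fun i => p (φ i)) j)

/-- A polynomial in the hyperplane coefficients that vanishes on the incidence variety lies in the
section ideal as a constant; were it non-zero it would be a unit there. Thus a non-empty generic
section means that the incidence variety dominates the space of pairs of hyperplanes. -/
theorem incidenceHom_injective (hI : RingHom.ker p = I) (hj : p (φ j) = 1)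
    (hB : genericSectionIdeal I φ ≠ ⊤) : Function.Injective (incidenceHom φ j p) := by
  rw [injective_iff_map_eq_zero]
  intro d hd
  by_contra hd0
  have h1 := swapCoeff_mem φ j hI hj (map (algebraMap K _) d) (by
    rw [← hd, incidenceHom, coe_eval₂Hom, eval₂_map, aeval_def]
    congr 1
    ext z
    simp [MvPolynomial.algebraMap_eq]
    )
  rw [swapCoeff_map] at h1
  refine hB (Ideal.eq_top_of_isUnit_mem _ h1 (IsUnit.map C (isUnit_iff_ne_zero.mpr ?_)))
  simpa using hd0

theorem exists_C_mul_eq_swapCoeff (H : MvPolynomial τ k₀) :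
    ∃ d : MvPolynomial (Fin 2 × ι) K, d ≠ 0 ∧ ∃ H',
      C (algebraMap _ k₀ d) * H = swapCoeff (τ := τ) H' := by
  induction H using MvPolynomial.induction_on with
  | C c =>
    obtain ⟨a, d, hd, rfl⟩ := IsFractionRing.div_surjective (A := MvPolynomial (Fin 2 × ι) K) c
    refine ⟨d, nonZeroDivisors.ne_zero hd, map (algebraMap K _) a, ?_⟩
    have : algebraMap (MvPolynomial (Fin 2 × ι) K) k₀ d ≠ 0 := by
      simpa using nonZeroDivisors.ne_zero hd
    rw [swapCoeff_map, ← C_mul, mul_div_cancel₀ _ this]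
  | add f g hf hg =>
    obtain ⟨d, hd, f', hf'⟩ := hf
    obtain ⟨e, he, g', hg'⟩ := hg
    refine ⟨d * e, mul_ne_zero hd he, map (algebraMap K _) e * f' + map (algebraMap K _) d * g', ?_⟩
    simp only [map_add, map_mul, swapCoeff_map, ← hf', ← hg']
    ring
  | mul_X f t hf =>
    obtain ⟨d, hd, f', hf'⟩ := hf
    refine ⟨d, hd, f' * C (X t), ?_⟩
    rw [map_mul, ← hf', ← mul_assoc]
    simp [swapCoeff]

/-- After clearing denominators, `swapCoeff_mem` shows that the section ideal is the whole kernel of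
the evaluation `Ω` at the generic point of the incidence variety. The quotient is thus a domain, and
by finiteness a field; it contains `Q` and the free hyperplane coefficients, hence all of `E`. -/
theorem exists_quotient_genericSectionIdeal_equiv {E : Type*} [Field E]
    [Algebra (MvPolynomial (Fin 2 × {i // i ≠ j}) Q) E]
    [IsFractionRing (MvPolynomial (Fin 2 × {i // i ≠ j}) Q) E] (hI : RingHom.ker p = I) (hj : p (φ j) = 1)
    (hp : ∀ z : Q, ∃ a b, p b ≠ 0 ∧ z * p b = p a)
    (κ : k₀ →+* E)
    (hκ : ∀ d, κ (algebraMap _ _ d) = algebraMap _ _ (incidenceHom φ j p d))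
    (hfin : Module.Finite k₀ (MvPolynomial τ k₀ ⧸ genericSectionIdeal I φ)) :
    ∃ e : (MvPolynomial τ k₀ ⧸ genericSectionIdeal I φ) ≃+* E, ∀ c, e (algebraMap k₀ _ c) = κ c := by
  set B := genericSectionIdeal I φ with hB
  let Ω' : MvPolynomial (Fin 2 × ι) (MvPolynomial τ K) →+*
      MvPolynomial (Fin 2 × {i // i ≠ j}) Q :=
    eval₂Hom (C.comp (p : MvPolynomial τ K →+* Q)) (hyperplaneCoeff (fun i => p (φ i)) j)
  let Ω : MvPolynomial τ k₀ →+* E := eval₂Hom κ fun t =>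
    algebraMap (MvPolynomial (Fin 2 × {i // i ≠ j}) Q) E (C (p (X t)))
  have hκC : ∀ c : K, κ (algebraMap K k₀ c) = algebraMap (MvPolynomial (Fin 2 × {i // i ≠ j}) Q) E (C (algebraMap K Q c)) := by
    intro c
    rw [IsScalarTower.algebraMap_apply K (MvPolynomial (Fin 2 × ι) K) k₀, hκ,
      AlgHom.commutes, MvPolynomial.algebraMap_apply]
  have hΩmap : ∀ f : MvPolynomial τ K, Ω (map (algebraMap K k₀) f) = algebraMap (MvPolynomial (Fin 2 × {i // i ≠ j}) Q) E (C (p f)) := by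
    intro f
    have : Ω.comp (map (algebraMap K k₀)) =
        ((algebraMap (MvPolynomial (Fin 2 × {i // i ≠ j}) Q) E).comp C).comp (p : MvPolynomial τ K →+* Q) := by
      apply MvPolynomial.ringHom_ext
      · intro c
        have : p (C c) = algebraMap K Q c := p.commutes c
        simp [Ω, hκC, this]
      · intro t; simp [Ω]
    exact congrFun (congrArg DFunLike.coe this) f
  have hcomp : ∀ H, Ω (swapCoeff H) = algebraMap (MvPolynomial (Fin 2 × {i // i ≠ j}) Q) E (Ω' H) := by
    intro H
    have : Ω.comp swapCoeff = (algebraMap (MvPolynomial (Fin 2 × {i // i ≠ j}) Q) E).comp Ω' := by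
      apply MvPolynomial.ringHom_ext
      · intro f; simp [Ω', swapCoeff, hΩmap]
      · intro z; simp [Ω, Ω', swapCoeff, hκ, incidenceHom]
    exact congrFun (congrArg DFunLike.coe this) H
  have hBker : B ≤ RingHom.ker Ω := by
    refine sup_le ?_ ?_
    · rw [Ideal.map_le_iff_le_comap]
      intro f hf
      rw [← hI, RingHom.mem_ker] at hf
      rw [Ideal.mem_comap, RingHom.mem_ker, hΩmap, hf, C_0, map_zero]
    · rw [Ideal.span_le]
      rintro _ ⟨k, rfl⟩
      show Ω _ = 0
      rw [map_sum, ← map_zero (algebraMap (MvPolynomial (Fin 2 × {i // i ≠ j}) Q) E),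
        ← sum_mul_hyperplaneCoeff (b := fun i => p (φ i)) hj k, map_sum]
      refine Finset.sum_congr rfl fun i _ => ?_
      rw [map_mul, map_mul, hΩmap]
      congr 1
      simp [Ω, hκ, incidenceHom]
  have hker : RingHom.ker Ω = B := by
    refine le_antisymm ?_ hBker
    intro H hH
    rw [RingHom.mem_ker] at hH
    obtain ⟨d, hd, H', hH'⟩ := exists_C_mul_eq_swapCoeff H
    have h1 : Ω' H' = 0 := by
      have := hcomp H'
      rw [← hH', map_mul, hH, mul_zero] at this
      exact (map_eq_zero_iff _ (IsFractionRing.injective _ E)).mp this.symm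
    have h2 := swapCoeff_mem φ j hI hj H' h1
    rw [← hH'] at h2
    have hu : IsUnit (C (algebraMap _ k₀ d) : MvPolynomial τ k₀) :=
      IsUnit.map C (isUnit_iff_ne_zero.mpr (by simpa using hd))
    exact (Ideal.unit_mul_mem_iff_mem _ hu).mp h2
  let Ωq : (MvPolynomial τ k₀ ⧸ B) →+* E := Ideal.Quotient.lift B Ω fun a ha => hBker ha
  have hΩq : ∀ H, Ωq (Ideal.Quotient.mk B H) = Ω H := fun H => Ideal.Quotient.lift_mk _ _ _
  have hinj : Function.Injective Ωq := by
    rw [injective_iff_map_eq_zero]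
    intro x hx
    obtain ⟨H, rfl⟩ := Ideal.Quotient.mk_surjective x
    rw [hΩq, ← RingHom.mem_ker, hker] at hx
    exact Ideal.Quotient.eq_zero_iff_mem.mpr hx
  have hprime : B.IsPrime := hker ▸ RingHom.ker_isPrime Ω
  -- A finite-dimensional domain over a field is a field, so the range of `Ωq` is closed under
  -- inverses.
  have hart : IsArtinianRing (MvPolynomial τ k₀ ⧸ B) := IsArtinianRing.of_finite k₀ _
  have hfield := IsArtinianRing.isField_of_isDomain (MvPolynomial τ k₀ ⧸ B)
  have hinv : ∀ y ∈ Ωq.range, y⁻¹ ∈ Ωq.range := by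
    rintro _ ⟨x, rfl⟩
    by_cases hx : x = 0
    · exact ⟨0, by simp [hx]⟩
    · obtain ⟨y, hy⟩ := hfield.mul_inv_cancel hx
      refine ⟨y, eq_inv_of_mul_eq_one_right ?_⟩
      rw [← map_mul, hy, map_one]
  have hpr : ∀ f, algebraMap (MvPolynomial (Fin 2 × {i // i ≠ j}) Q) E (C (p f)) ∈ Ωq.range := fun f =>
    ⟨Ideal.Quotient.mk B (map (algebraMap K k₀) f), by rw [hΩq, hΩmap]⟩
  have hQ : ∀ z : Q, algebraMap (MvPolynomial (Fin 2 × {i // i ≠ j}) Q) E (C z) ∈ Ωq.range := by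
    intro z
    obtain ⟨a, b, hb, hab⟩ := hp z
    have hb' : algebraMap (MvPolynomial (Fin 2 × {i // i ≠ j}) Q) E (C (p b)) ≠ 0 := by
      rw [Ne, map_eq_zero_iff _ (IsFractionRing.injective _ E), C_eq_zero]
      exact hb
    have : algebraMap (MvPolynomial (Fin 2 × {i // i ≠ j}) Q) E (C z) = algebraMap (MvPolynomial (Fin 2 × {i // i ≠ j}) Q) E (C (p a)) * (algebraMap (MvPolynomial (Fin 2 × {i // i ≠ j}) Q) E (C (p b)))⁻¹ := by
      rw [eq_mul_inv_iff_mul_eq₀ hb', ← map_mul, ← C_mul, hab]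
    rw [this]
    exact mul_mem (hpr a) (hinv _ (hpr b))
  have hpoly : ∀ g, algebraMap (MvPolynomial (Fin 2 × {i // i ≠ j}) Q) E g ∈ Ωq.range := by
    intro g
    induction g using MvPolynomial.induction_on with
    | C z => exact hQ z
    | add f g hf hg => rw [map_add]; exact add_mem hf hg
    | mul_X f z hf =>
      rw [map_mul]
      refine mul_mem hf ⟨Ideal.Quotient.mk B (C (algebraMap (MvPolynomial (Fin 2 × ι) K) k₀
        (X (z.1, (z.2 : ι))))), ?_⟩
      rw [hΩq]
      simp [Ω, hκ, incidenceHom, hyperplaneCoeff, z.2.2]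
  have hsurj : Function.Surjective Ωq := by
    intro y
    obtain ⟨a, b, hb, rfl⟩ :=
      IsFractionRing.div_surjective (A := MvPolynomial (Fin 2 × {i // i ≠ j}) Q) y
    rw [div_eq_mul_inv]
    exact mul_mem (hpoly a) (hinv _ (hpoly b))
  refine ⟨RingEquiv.ofBijective Ωq ⟨hinj, hsurj⟩, fun c => ?_⟩
  show Ωq (Ideal.Quotient.mk B (C c)) = κ c
  rw [hΩq]
  simp [Ω]

end GenericSection

/-! ### The length of a generic line section of a surface -/

section LineSection

theorem aeval_mul_of_isHomogeneous {R A σ : Type*} [CommSemiring R] [CommSemiring A] [Algebra R A]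
    [Fintype σ] {G : MvPolynomial σ R} {D : ℕ} (hG : G.IsHomogeneous D) (c : A) (b : σ → A) :
    aeval (fun i => c * b i) G = c ^ D * aeval b G := by
  rw [aeval_def, aeval_def, eval₂_eq', eval₂_eq', Finset.mul_sum]
  refine Finset.sum_congr rfl fun d hd => ?_
  have hdeg : ∑ i, d i = D := by
    rw [← Finsupp.degree_eq_sum]
    by_contra h
    exact mem_support_iff.mp hd (hG.coeff_eq_zero h)
  simp only [mul_pow, Finset.prod_mul_distrib]
  rw [Finset.prod_pow_eq_pow_sum, hdeg]
  ring

theorem natDegree_coeff_prod_le {R ι : Type*} [CommSemiring R] (s : Finset ι)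
    (g : ι → Polynomial R) (n : ι → ℕ) (h : ∀ i, (g i).natDegree ≤ n i) :
    (∏ i ∈ s, g i).natDegree ≤ ∑ i ∈ s, n i ∧
      (∏ i ∈ s, g i).coeff (∑ i ∈ s, n i) = ∏ i ∈ s, (g i).coeff (n i) := by
  classical
  induction s using Finset.induction_on with
  | empty => simp
  | insert a s ha ih =>
    rw [Finset.prod_insert ha, Finset.sum_insert ha, Finset.prod_insert ha]
    refine ⟨Polynomial.natDegree_mul_le.trans (add_le_add (h a) ih.1), ?_⟩
    rw [Polynomial.coeff_mul_add_eq_of_natDegree_le (h a) ih.1, ih.2]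

/-- Each linear factor of a monomial contributes its own leading coefficient, so the top coefficient
on a line is the value of the form at the direction of the line. -/
theorem natDegree_coeff_aeval_line {L σ : Type*} [Field L] [Fintype σ] {G : MvPolynomial σ L}
    {D : ℕ} (hG : G.IsHomogeneous D) (a b : σ → L) :
    (aeval (fun i => Polynomial.C (a i) + Polynomial.C (b i) * Polynomial.X) G).natDegree ≤ D ∧
      (aeval (fun i => Polynomial.C (a i) + Polynomial.C (b i) * Polynomial.X) G).coeff D =
        eval b G := by
  have hl : ∀ i, (Polynomial.C (a i) + Polynomial.C (b i) * Polynomial.X).natDegree ≤ 1 ∧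
      (Polynomial.C (a i) + Polynomial.C (b i) * Polynomial.X).coeff 1 = b i := by
    intro i
    refine ⟨?_, by simp⟩
    refine (Polynomial.natDegree_add_le _ _).trans (max_le (by simp) ?_)
    simpa using Polynomial.natDegree_C_mul_X_pow_le (b i) 1
  have key : ∀ d ∈ G.support,
      (∏ i, (Polynomial.C (a i) + Polynomial.C (b i) * Polynomial.X) ^ d i).natDegree ≤ D ∧
      (∏ i, (Polynomial.C (a i) + Polynomial.C (b i) * Polynomial.X) ^ d i).coeff D =
        ∏ i, b i ^ d i := by
    intro d hd
    have hdeg : ∑ i, d i = D := by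
      rw [← Finsupp.degree_eq_sum]
      by_contra h
      exact mem_support_iff.mp hd (hG.coeff_eq_zero h)
    have := natDegree_coeff_prod_le Finset.univ
      (fun i => (Polynomial.C (a i) + Polynomial.C (b i) * Polynomial.X) ^ d i) d (fun i => by
        have := Polynomial.natDegree_pow_le_of_le (d i) (hl i).1
        simpa using this)
    rw [hdeg] at this
    refine ⟨this.1, this.2.trans (Finset.prod_congr rfl fun i _ => ?_)⟩
    have h2 := Polynomial.coeff_pow_of_natDegree_le (m := d i) (hl i).1
    rw [mul_one, (hl i).2] at h2
    exact h2
  rw [aeval_def, eval₂_eq', eval_eq']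
  refine ⟨Polynomial.natDegree_sum_le_of_forall_le _ _ fun d hd => ?_, ?_⟩
  · exact (Polynomial.natDegree_C_mul_le _ _).trans (key d hd).1
  · rw [Polynomial.finsetSum_coeff]
    refine Finset.sum_congr rfl fun d hd => ?_
    show (Polynomial.C _ * _ : Polynomial L).coeff D = _
    rw [Polynomial.coeff_C_mul, (key d hd).2]

/-- Modulo `N` all the variables become affine functions of `X c`, so `N` is the ideal of a line and
the quotient by it is a polynomial ring in one variable. There `G` has degree exactly `D`, because
it does not vanish at the direction `b`. -/
theorem finrank_quotient_of_aeval_line {L σ : Type*} [Field L] [Fintype σ] {G : MvPolynomial σ L}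
    {D : ℕ} (hG : G.IsHomogeneous D) {a b : σ → L} (hb : eval b G ≠ 0)
    {B N : Ideal (MvPolynomial σ L)} (hB : B = N ⊔ Ideal.span {G}) (c : σ)
    (hN : N ≤ RingHom.ker (aeval (R := L)
      (fun i => Polynomial.C (a i) + Polynomial.C (b i) * Polynomial.X)))
    (hc : a c = 0 ∧ b c = 1) (hX : ∀ i, X i - (C (a i) + C (b i) * X c) ∈ N) :
    Module.Finite L (MvPolynomial σ L ⧸ B) ∧ Module.finrank L (MvPolynomial σ L ⧸ B) = D := by
  set lam : MvPolynomial σ L →ₐ[L] Polynomial L :=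
    aeval (fun i => Polynomial.C (a i) + Polynomial.C (b i) * Polynomial.X) with hlam
  let sec : Polynomial L →ₐ[L] MvPolynomial σ L := Polynomial.aeval (X c)
  have h1 : ∀ H, H - sec (lam H) ∈ N := by
    intro H
    rw [← Ideal.Quotient.mk_eq_mk_iff_sub_mem]
    have : Ideal.Quotient.mkₐ L N = (Ideal.Quotient.mkₐ L N).comp (sec.comp lam) := by
      ext i
      simp only [AlgHom.comp_apply, Ideal.Quotient.mkₐ_eq_mk]
      rw [Ideal.Quotient.mk_eq_mk_iff_sub_mem]
      convert hX i using 2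
      simp [sec, lam]
    exact congrFun (congrArg DFunLike.coe this) H
  have h2 : ∀ r, lam (sec r) = r := by
    intro r
    have : lam.comp sec = AlgHom.id L _ := by
      ext
      simp [sec, lam, hc.1, hc.2]
    exact congrFun (congrArg DFunLike.coe this) r
  set g := lam G with hg
  have hgdeg : g.natDegree = D := by
    obtain ⟨h3, h4⟩ := natDegree_coeff_aeval_line hG a b
    exact Polynomial.natDegree_eq_of_le_of_coeff_ne_zero h3 (h4 ▸ hb)
  have hg0 : g ≠ 0 := by
    intro h0
    apply hb
    rw [← (natDegree_coeff_aeval_line hG a b).2, ← hlam, ← hg, h0, Polynomial.coeff_zero]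
  let μ : MvPolynomial σ L →ₐ[L] (Polynomial L ⧸ Ideal.span {g}) :=
    (Ideal.Quotient.mkₐ L _).comp lam
  have hμ : Function.Surjective μ := by
    intro y
    obtain ⟨r, rfl⟩ := Ideal.Quotient.mk_surjective y
    exact ⟨sec r, by simp [μ, h2]⟩
  have hker : RingHom.ker μ = B := by
    rw [hB]
    refine le_antisymm ?_ (sup_le ?_ ?_)
    · intro H hH
      have h3 : lam H ∈ Ideal.span {g} := Ideal.Quotient.eq_zero_iff_mem.mp hH
      obtain ⟨r, hr⟩ := Ideal.mem_span_singleton'.mp h3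
      have h4 : H = (H - sec (lam H)) + sec r * (sec (lam G) - G) + sec r * G := by
        rw [← hr, map_mul]; ring
      rw [h4]
      refine add_mem (add_mem (Ideal.mem_sup_left (h1 H)) (Ideal.mem_sup_left ?_))
        (Ideal.mem_sup_right (Ideal.mul_mem_left _ _ (Ideal.mem_span_singleton_self G)))
      refine N.mul_mem_left _ ?_
      rw [← neg_sub]
      exact neg_mem (h1 G)
    · intro H hH
      show Ideal.Quotient.mk _ (lam H) = 0
      rw [show lam H = 0 from hN hH, map_zero]
    · rw [Ideal.span_singleton_le_iff_mem]
      exact Ideal.Quotient.eq_zero_iff_mem.mpr (Ideal.mem_span_singleton_self g)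
  let e : (MvPolynomial σ L ⧸ B) ≃ₐ[L] (Polynomial L ⧸ Ideal.span {g}) :=
    (Ideal.quotientEquivAlgOfEq L hker.symm).trans (Ideal.quotientKerAlgEquivOfSurjective hμ)
  have hfin : Module.Finite L (Polynomial L ⧸ Ideal.span {g}) :=
    (AdjoinRoot.powerBasis hg0).finite
  refine ⟨Module.Finite.equiv e.symm.toLinearEquiv, ?_⟩
  rw [e.toLinearEquiv.finrank_eq, finrank_quotient_span_eq_natDegree, hgdeg]

theorem sum_fin_four_eq {M : Type*} [AddCommMonoid M] (f : Fin 4 → M) (j : Fin 4) :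
    ∑ i, f i = f j + f (j + 1) + f (j + 2) + f (j + 3) := by
  rw [← Equiv.sum_comp (Equiv.addLeft j), Fin.sum_univ_four]
  simp

theorem fin_four_add (j : Fin 4) : j + 1 ≠ j ∧ j + 2 ≠ j ∧ j + 3 ≠ j ∧ j + 2 ≠ j + 1 ∧
    j + 3 ≠ j + 1 ∧ j + 3 ≠ j + 2 ∧ ∀ i, i = j ∨ i = j + 1 ∨ i = j + 2 ∨ i = j + 3 := by
  revert j; decide

variable {K : Type*} [Field K]

local notation "k₀" => FractionRing (MvPolynomial (Fin 2 × Fin 4) K)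

theorem not_X_dvd_iff_aeval_update {G : MvPolynomial (Fin 4) K} {j : Fin 4} (h : ¬ X j ∣ G) :
    aeval (fun i => if i = j then (0 : MvPolynomial (Fin 4) K) else X i) G ≠ 0 := by
  intro h0
  apply h
  rw [← Ideal.mem_span_singleton, ← sub_zero G, ← h0]
  rw [← Ideal.Quotient.mk_eq_mk_iff_sub_mem]
  have : Ideal.Quotient.mkₐ K (Ideal.span {(X j : MvPolynomial (Fin 4) K)}) =
      (Ideal.Quotient.mkₐ K (Ideal.span {(X j : MvPolynomial (Fin 4) K)})).comp
        (aeval (fun i => if i = j then (0 : MvPolynomial (Fin 4) K) else X i)) := by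
    ext i
    by_cases hi : i = j
    · subst hi
      simp only [AlgHom.comp_apply, aeval_X, if_pos rfl, map_zero]
      exact Ideal.Quotient.eq_zero_iff_mem.mpr (Ideal.mem_span_singleton_self _)
    · simp [hi]
  exact congrFun (congrArg DFunLike.coe this) G

set_option maxHeartbeats 1000000 in
/-- A generic line meets the surface `G = 0` in a scheme of length `deg G`. -/
theorem finrank_quotient_genericSectionIdeal_surface {G : MvPolynomial (Fin 4) K} {D : ℕ}
    (hG : G.IsHomogeneous D) {j : Fin 4} (hj : ¬ X j ∣ G) :
    Module.Finite k₀ (MvPolynomial (Fin 4) k₀ ⧸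
        genericSectionIdeal (ι := Fin 4) (Ideal.span {X j - 1, G}) X) ∧
      Module.finrank k₀ (MvPolynomial (Fin 4) k₀ ⧸
        genericSectionIdeal (ι := Fin 4) (Ideal.span {X j - 1, G}) X) = D := by
  set x : Fin 4 → MvPolynomial (Fin 2 × Fin 4) K := fun i => X (0, i) with hx
  set y : Fin 4 → MvPolynomial (Fin 2 × Fin 4) K := fun i => X (1, i) with hy
  set am : MvPolynomial (Fin 2 × Fin 4) K →+* k₀ := algebraMap _ _ with ham
  have haminj : Function.Injective am := IsFractionRing.injective _ _
  obtain ⟨e1, e2, e3, e21, e31, e32, hcases⟩ := fin_four_add j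
  -- The direction of the line within `X j = 0`: the cross product of the two coefficient vectors
  -- without their entry `j`. The indices run cyclically from `j`.
  let v : Fin 4 → MvPolynomial (Fin 2 × Fin 4) K := fun i =>
    if i = j then 0 else if i = j + 1 then -x (j + 3) * y (j + 2) + y (j + 3) * x (j + 2)
    else if i = j + 2 then -y (j + 3) * x (j + 1) + x (j + 3) * y (j + 1)
    else x (j + 1) * y (j + 2) - x (j + 2) * y (j + 1)
  set δ : MvPolynomial (Fin 2 × Fin 4) K := x (j + 1) * y (j + 2) - x (j + 2) * y (j + 1) with hδ
  -- A specialization of the coefficients that sends `v i` to `X (j + 3) * X i` for `i ≠ j`. It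
  -- shows that `G` does not vanish at `v`, because `G` does not vanish identically on `X j = 0`.
  let s : Fin 2 × Fin 4 → MvPolynomial (Fin 4) K := fun z =>
    if z.1 = 0 then
      (if z.2 = j + 1 then X (j + 3) else if z.2 = j + 3 then -X (j + 1) else 0)
    else (if z.2 = j + 2 then X (j + 3) else if z.2 = j + 3 then -X (j + 2) else 0)
  have hv : aeval v G ≠ 0 := by
    intro h0
    have h1 := congrArg (aeval s) h0
    rw [map_zero, ← AlgHom.comp_apply, comp_aeval] at h1
    have h2 : (fun i => aeval s (v i)) = fun i => X (j + 3) *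
        (if i = j then (0 : MvPolynomial (Fin 4) K) else X i) := by
      funext i
      rcases hcases i with rfl | rfl | rfl | rfl
      · simp [v]
      · simp [v, s, x, y, e1, e21, e21.symm, e31, e32, e32.symm, mul_comm]
      · simp [v, s, x, y, e2, e21, e21.symm, e31, e32, e32.symm, mul_comm]
      · simp [v, s, x, y, e3, e21, e21.symm, e31, e31.symm, e32, e32.symm, mul_comm]
    rw [h2, aeval_mul_of_isHomogeneous hG] at h1
    exact mul_ne_zero (pow_ne_zero _ (X_ne_zero _)) (not_X_dvd_iff_aeval_update hj) h1
  have hδ0 : δ ≠ 0 := by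
    intro h0
    have h1 := congrArg (aeval s) h0
    simp [hδ, x, y, s, e21, e21.symm, e31, e32, e32.symm] at h1
  have hd0 : am δ ≠ 0 := fun h => hδ0 ((map_eq_zero_iff am haminj).mp h)
  obtain ⟨di, hdi⟩ : ∃ di, di = (am δ)⁻¹ := ⟨_, rfl⟩
  have hdd : di * am δ = 1 := by rw [hdi, inv_mul_cancel₀ hd0]
  have hdi0 : di ≠ 0 := left_ne_zero_of_mul (hdd ▸ one_ne_zero)
  -- The line is parametrized by its coordinate `j + 3`: `b` is the direction scaled to have that
  -- coordinate equal to `1`, and `a` is the point, found by Cramer's rule, where it equals `0`.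
  let b : Fin 4 → k₀ := fun i => di * am (v i)
  let a : Fin 4 → k₀ := fun i =>
    if i = j then 1 else if i = j + 1 then
      di * (-am (x j) * am (y (j + 2)) + am (y j) * am (x (j + 2)))
    else if i = j + 2 then
      di * (-am (y j) * am (x (j + 1)) + am (x j) * am (y (j + 1)))
    else 0
  have hGm : (map (algebraMap K k₀) G).IsHomogeneous D := hG.map _
  have hb : eval b (map (algebraMap K k₀) G) ≠ 0 := by
    rw [eval_map, ← aeval_def, aeval_mul_of_isHomogeneous hG]
    refine mul_ne_zero (pow_ne_zero _ (hdi0)) ?_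
    have h1 : aeval (fun i => am (v i)) G = am (aeval v G) :=
      (aeval_algebraMap_apply (B := k₀) v G)
    rw [h1]
    exact fun h => hv ((map_eq_zero_iff am haminj).mp h)
  have hvj : v j = 0 := by simp [v]
  have hv1 : v (j + 1) = -x (j + 3) * y (j + 2) + y (j + 3) * x (j + 2) := by simp [v, e1]
  have hv2 : v (j + 2) = -y (j + 3) * x (j + 1) + x (j + 3) * y (j + 1) := by simp [v, e2, e21]
  have hv3 : v (j + 3) = δ := by simp [v, e3, e31, e32, hδ]
  have haj : a j = 1 := by simp [a]
  have ha1 : a (j + 1) = di * (-am (x j) * am (y (j + 2)) + am (y j) * am (x (j + 2))) := by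
    simp [a, e1]
  have ha2 : a (j + 2) = di * (-am (y j) * am (x (j + 1)) + am (x j) * am (y (j + 1))) := by
    simp [a, e2, e21]
  have ha3 : a (j + 3) = 0 := by simp [a, e3, e31, e32]
  have hdel : am δ = am (x (j + 1)) * am (y (j + 2)) - am (x (j + 2)) * am (y (j + 1)) := by
    rw [hδ, map_sub, map_mul, map_mul]
  let W : Fin 2 → MvPolynomial (Fin 4) k₀ := fun k =>
    ∑ i, C (am (X (k, i))) * X i
  have hW0 : W 0 = C (am (x j)) * X j + C (am (x (j + 1))) * X (j + 1) +
      C (am (x (j + 2))) * X (j + 2) + C (am (x (j + 3))) * X (j + 3) := sum_fin_four_eq _ j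
  have hW1 : W 1 = C (am (y j)) * X j + C (am (y (j + 1))) * X (j + 1) +
      C (am (y (j + 2))) * X (j + 2) + C (am (y (j + 3))) * X (j + 3) := sum_fin_four_eq _ j
  have hCd : (C di : MvPolynomial (Fin 4) k₀) * C (am δ) = 1 := by
    rw [← C_mul, hdd, C_1]
  refine finrank_quotient_of_aeval_line (N := Ideal.span {X j - 1, W 0, W 1}) hGm hb ?_ (j + 3)
    ?_ ⟨ha3, ?_⟩ ?_
  · rw [genericSectionIdeal, Ideal.map_span, Set.image_pair, map_sub, map_one, map_X]
    have hr : (Set.range fun k : Fin 2 => ∑ i, C (algebraMap (MvPolynomial (Fin 2 × Fin 4) K) k₀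
        (X (k, i))) * map (algebraMap K k₀) (X i)) = {W 0, W 1} := by
      ext z
      simp only [Set.mem_range, Fin.exists_fin_two, map_X, Set.mem_insert_iff,
        Set.mem_singleton_iff]
      exact or_congr eq_comm eq_comm
    rw [hr, ← Ideal.span_union, ← Ideal.span_union]
    congr 1
    ext z
    simp only [Set.mem_union, Set.mem_insert_iff, Set.mem_singleton_iff]
    tauto
  · rw [Ideal.span_le]
    have hCi : Polynomial.C di * (Polynomial.C (am (x (j + 1))) * Polynomial.C (am (y (j + 2)))
        - Polynomial.C (am (x (j + 2))) * Polynomial.C (am (y (j + 1)))) = 1 := by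
      rw [← Polynomial.C_mul, ← Polynomial.C_mul, ← Polynomial.C_sub, ← hdel, ← Polynomial.C_mul,
        hdd, Polynomial.C_1]
    rintro z (rfl | rfl | rfl)
    · show aeval _ _ = 0
      simp [haj, b, hvj]
    · show aeval _ _ = 0
      rw [hW0]
      simp only [map_add, map_mul, aeval_X, b, hvj, hv1, hv2, hv3, haj, ha1, ha2, ha3,
        Polynomial.C_add, Polynomial.C_mul, map_neg, algHom_C, map_zero, Polynomial.C_0,
        Polynomial.C_1, mul_zero, Polynomial.algebraMap_eq, hdel, Polynomial.C_neg,
        Polynomial.C_sub, map_sub, map_one]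
      linear_combination (-Polynomial.C (am (x j))) * hCi
    · show aeval _ _ = 0
      rw [hW1]
      simp only [map_add, map_mul, aeval_X, b, hvj, hv1, hv2, hv3, haj, ha1, ha2, ha3,
        Polynomial.C_add, Polynomial.C_mul, map_neg, algHom_C, map_zero, Polynomial.C_0,
        Polynomial.C_1, mul_zero, Polynomial.algebraMap_eq, hdel, Polynomial.C_neg,
        Polynomial.C_sub, map_sub, map_one]
      linear_combination (-Polynomial.C (am (y j))) * hCi
  · simp only [b, hv3]
    exact hdd
  · have hm : ∀ z ∈ ({X j - 1, W 0, W 1} : Set (MvPolynomial (Fin 4) k₀)),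
      z ∈ Ideal.span {X j - 1, W 0, W 1} := fun z hz => Ideal.subset_span hz
    have hCd' := hCd
    rw [hdel, C_sub, C_mul, C_mul] at hCd'
    intro i
    rcases hcases i with rfl | rfl | rfl | rfl
    · simp only [b, hvj, haj, map_zero, mul_zero, zero_mul, add_zero, C_1]
      exact hm _ (by simp)
    · have : X (j + 1) - (C (a (j + 1)) + C (b (j + 1)) * X (j + 3)) =
          C di * C (am (y (j + 2))) * W 0 - C di * C (am (x (j + 2))) * W 1
          - C di * (C (am (x j)) * C (am (y (j + 2))) - C (am (y j)) * C (am (x (j + 2))))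
            * (X j - 1) := by
        rw [hW0, hW1, ha1]
        simp only [b, hv1, C_mul, C_add, map_add, map_mul, map_neg, C_neg]
        linear_combination (-X (j + 1)) * hCd'
      rw [this]
      exact sub_mem (sub_mem (Ideal.mul_mem_left _ _ (hm _ (by simp)))
        (Ideal.mul_mem_left _ _ (hm _ (by simp)))) (Ideal.mul_mem_left _ _ (hm _ (by simp)))
    · have : X (j + 2) - (C (a (j + 2)) + C (b (j + 2)) * X (j + 3)) =
          C di * C (am (x (j + 1))) * W 1 - C di * C (am (y (j + 1))) * W 0
          - C di * (C (am (y j)) * C (am (x (j + 1))) - C (am (x j)) * C (am (y (j + 1))))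
            * (X j - 1) := by
        rw [hW0, hW1, ha2]
        simp only [b, hv2, C_mul, C_add, map_add, map_mul, map_neg, C_neg]
        linear_combination (-X (j + 2)) * hCd'
      rw [this]
      exact sub_mem (sub_mem (Ideal.mul_mem_left _ _ (hm _ (by simp)))
        (Ideal.mul_mem_left _ _ (hm _ (by simp)))) (Ideal.mul_mem_left _ _ (hm _ (by simp)))
    · simp only [b, hv3, ha3, hdd, C_0, C_1, one_mul, zero_add, sub_self]
      exact zero_mem _

end LineSection

/-! ### Localizations as quotients of polynomial rings -/

section Rabinowitsch

variable {σ L : Type*} [Field L]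

/-- The ideal presenting the localization of the quotient by `I` away from `s`. -/
def rabinowitschIdeal (I : Ideal (MvPolynomial σ L)) (s : MvPolynomial σ L) :
    Ideal (MvPolynomial (Option σ) L) :=
  I.map (rename some : MvPolynomial σ L →ₐ[L] MvPolynomial (Option σ) L) ⊔
    Ideal.span {X none * rename some s - 1}

/-- Clearing denominators: each occurrence of the new variable is absorbed by one factor `s`. -/
theorem exists_pow_mul_sub_rename_mem (s : MvPolynomial σ L) (H : MvPolynomial (Option σ) L) :
    ∃ N h, rename some s ^ N * H - rename some h ∈
      Ideal.span {(X none * rename some s - 1 : MvPolynomial (Option σ) L)} := by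
  induction H using MvPolynomial.induction_on with
  | C c => exact ⟨0, C c, by simp⟩
  | add f g hf hg =>
    obtain ⟨N, f', hf⟩ := hf
    obtain ⟨M, g', hg⟩ := hg
    refine ⟨N + M, s ^ M * f' + s ^ N * g', ?_⟩
    have : rename some s ^ (N + M) * (f + g) - rename some (s ^ M * f' + s ^ N * g') =
        rename some s ^ M * (rename some s ^ N * f - rename some f') +
        rename some s ^ N * (rename some s ^ M * g - rename some g') := by
      simp only [map_add, map_mul, map_pow]; ring
    rw [this]
    exact add_mem (Ideal.mul_mem_left _ _ hf) (Ideal.mul_mem_left _ _ hg)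
  | mul_X f t hf =>
    obtain ⟨N, f', hf⟩ := hf
    cases t with
    | none =>
      refine ⟨N + 1, f', ?_⟩
      have : rename some s ^ (N + 1) * (f * X none) - rename some f' =
          (rename some s ^ N * f) * (X none * rename some s - 1) +
            (rename some s ^ N * f - rename some f') := by ring
      rw [this]
      exact add_mem (Ideal.mul_mem_left _ _ (Ideal.mem_span_singleton_self _)) hf
    | some i =>
      refine ⟨N, f' * X i, ?_⟩
      have : rename some s ^ N * (f * X (some i)) - rename some (f' * X i) =
          X (some i) * (rename some s ^ N * f - rename some f') := by
        rw [map_mul, rename_X]; ring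
      rw [this]
      exact Ideal.mul_mem_left _ _ hf

theorem mem_of_pow_mul_mem_rabinowitsch {s : MvPolynomial σ L}
    {B : Ideal (MvPolynomial (Option σ) L)} (hB : X none * rename some s - 1 ∈ B) {N : ℕ}
    {H : MvPolynomial (Option σ) L} (h : rename some s ^ N * H ∈ B) : H ∈ B := by
  have h1 : (X none * rename some s) ^ N * H ∈ B := by
    rw [mul_pow, mul_assoc]; exact B.mul_mem_left _ h
  rw [← Ideal.Quotient.eq_zero_iff_mem] at h1 hB ⊢
  rw [map_sub, map_one, sub_eq_zero] at hB
  rwa [map_mul, map_pow, hB, one_pow, one_mul] at h1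

/-- The new variable goes to the inverse of `s`. Presenting the localization as a quotient of a
polynomial ring makes base change and the results on generic sections applicable to it. -/
theorem exists_rabinowitsch_equiv (I : Ideal (MvPolynomial σ L)) (s : MvPolynomial σ L)
    (A : Type*) [CommRing A] [Algebra (MvPolynomial σ L ⧸ I) A] [Algebra L A]
    [IsScalarTower L (MvPolynomial σ L ⧸ I) A]
    [IsLocalization.Away (Ideal.Quotient.mk I s) A] :
    Nonempty ((MvPolynomial (Option σ) L ⧸ rabinowitschIdeal I s) ≃ₐ[L] A) := by
  set am := algebraMap (MvPolynomial σ L ⧸ I) A with ham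
  let ρ : MvPolynomial (Option σ) L →ₐ[L] A :=
    aeval fun o => o.elim (IsLocalization.Away.invSelf (Ideal.Quotient.mk I s))
      fun i => am (Ideal.Quotient.mk I (X i))
  have hρ : ∀ f, ρ (rename some f) = am (Ideal.Quotient.mk I f) := by
    intro f
    have : ρ.comp (rename some) =
        (IsScalarTower.toAlgHom L (MvPolynomial σ L ⧸ I) A).comp (Ideal.Quotient.mkₐ L I) := by
      ext i; simp [ρ, ham]
    exact congrFun (congrArg DFunLike.coe this) f
  have hz : ρ (X none) * am (Ideal.Quotient.mk I s) = 1 := by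
    rw [mul_comm]
    simp only [ρ, aeval_X, Option.elim]
    exact IsLocalization.Away.mul_invSelf _
  have ht : X none * rename some s - 1 ∈ rabinowitschIdeal I s :=
    Ideal.mem_sup_right (Ideal.mem_span_singleton_self _)
  have hle : rabinowitschIdeal I s ≤ RingHom.ker ρ := by
    refine sup_le ?_ ?_
    · rw [Ideal.map_le_iff_le_comap]
      intro f hf
      rw [Ideal.mem_comap, RingHom.mem_ker]
      exact (hρ f).trans (by rw [Ideal.Quotient.eq_zero_iff_mem.mpr hf, map_zero])
    · rw [Ideal.span_singleton_le_iff_mem, RingHom.mem_ker, map_sub, map_mul, hρ, hz, map_one,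
        sub_self]
  have hker : RingHom.ker ρ = rabinowitschIdeal I s := by
    refine le_antisymm ?_ hle
    intro H hH
    rw [RingHom.mem_ker] at hH
    obtain ⟨N, h, hN⟩ := exists_pow_mul_sub_rename_mem s H
    have hN' := Ideal.mem_sup_right (S := I.map (rename some : MvPolynomial σ L →ₐ[L] _)) hN
    have h1 : am (Ideal.Quotient.mk I h) = 0 := by
      have := hle hN'
      rw [RingHom.mem_ker, map_sub, map_mul, hH, mul_zero, zero_sub, neg_eq_zero, hρ] at this
      exact this
    obtain ⟨⟨_, M, rfl⟩, hM⟩ := (IsLocalization.map_eq_zero_iff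
      (Submonoid.powers (Ideal.Quotient.mk I s)) A _).mp h1
    simp only at hM
    rw [← map_pow, ← map_mul, Ideal.Quotient.eq_zero_iff_mem] at hM
    have h2 : rename some (s ^ M * h) ∈ rabinowitschIdeal I s :=
      Ideal.mem_sup_left (Ideal.mem_map_of_mem _ hM)
    refine mem_of_pow_mul_mem_rabinowitsch ht (N := M + N) ?_
    have h3 : rename some s ^ (M + N) * H =
        rename some s ^ M * (rename some s ^ N * H - rename some h) + rename some (s ^ M * h) := by
      simp only [map_mul, map_pow]; ring
    rw [h3]
    exact add_mem (Ideal.mul_mem_left _ _ hN') h2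
  have hsurj : Function.Surjective ρ := by
    intro y
    obtain ⟨N, a, ha⟩ := IsLocalization.Away.surj (Ideal.Quotient.mk I s) y
    obtain ⟨f, rfl⟩ := Ideal.Quotient.mk_surjective a
    refine ⟨X none ^ N * rename some f, ?_⟩
    rw [← ham] at ha
    rw [map_mul, map_pow, hρ, ← ha, mul_left_comm, ← mul_pow, hz, one_pow, mul_one]
  exact ⟨(Ideal.quotientEquivAlgOfEq L hker.symm).trans
    (Ideal.quotientKerAlgEquivOfSurjective hsurj)⟩

end Rabinowitsch

/-! ### Invariance of lengths under extension of the base field -/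

section BaseChange

attribute [local instance] MvPolynomial.algebraMvPolynomial

variable {k L σ : Type*} [Field k] [Field L] [Algebra k L]

theorem exists_quotient_map_equiv_tensorProduct (I : Ideal (MvPolynomial σ k)) :
    Nonempty ((MvPolynomial σ L ⧸ I.map (map (algebraMap k L))) ≃ₗ[L]
      TensorProduct k L (MvPolynomial σ k ⧸ I)) := by
  let e1 := Algebra.TensorProduct.quotIdealMapEquivTensorQuot (MvPolynomial σ L) I
  let e2 := Algebra.IsPushout.cancelBaseChange k L (MvPolynomial σ k) (MvPolynomial σ L)
    (MvPolynomial σ k ⧸ I)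
  exact ⟨(e1.toLinearEquiv.restrictScalars L).trans e2⟩

theorem finrank_quotient_map (I : Ideal (MvPolynomial σ k)) :
    Module.finrank L (MvPolynomial σ L ⧸ I.map (map (algebraMap k L))) =
      Module.finrank k (MvPolynomial σ k ⧸ I) := by
  obtain ⟨e⟩ := exists_quotient_map_equiv_tensorProduct (L := L) I
  rw [e.finrank_eq, Module.finrank_baseChange]

theorem finite_quotient_map_iff (I : Ideal (MvPolynomial σ k)) :
    Module.Finite L (MvPolynomial σ L ⧸ I.map (map (algebraMap k L))) ↔
      Module.Finite k (MvPolynomial σ k ⧸ I) := by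
  obtain ⟨e⟩ := exists_quotient_map_equiv_tensorProduct (L := L) I
  rw [Module.Finite.equiv_iff e]
  exact ⟨fun h => Module.Finite.of_finite_tensorProduct_of_faithfullyFlat L, fun h => inferInstance⟩

theorem map_rabinowitschIdeal (I : Ideal (MvPolynomial σ k)) (s : MvPolynomial σ k) :
    (rabinowitschIdeal I s).map (map (algebraMap k L)) =
      rabinowitschIdeal (I.map (map (algebraMap k L))) (map (algebraMap k L) s) := by
  unfold rabinowitschIdeal
  rw [Ideal.map_sup, Ideal.map_span, Set.image_singleton]
  congr 1
  · show (I.map (rename some : MvPolynomial σ k →ₐ[k] _).toRingHom).map _ =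
      (I.map _).map (rename some : MvPolynomial σ L →ₐ[L] _).toRingHom
    rw [Ideal.map_map, Ideal.map_map]
    congr 1
    apply MvPolynomial.ringHom_ext <;> intros <;> simp
  · simp [map_rename]

/-- The dimension of a localized quotient of a polynomial ring does not depend on the field. -/
theorem finrank_away_quotient_map (I : Ideal (MvPolynomial σ k)) (s : MvPolynomial σ k) :
    Module.finrank L (Localization.Away (Ideal.Quotient.mk (I.map (map (algebraMap k L)))
        (map (algebraMap k L) s))) =
      Module.finrank k (Localization.Away (Ideal.Quotient.mk I s)) ∧
    (Module.Finite L (Localization.Away (Ideal.Quotient.mk (I.map (map (algebraMap k L)))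
        (map (algebraMap k L) s))) ↔
      Module.Finite k (Localization.Away (Ideal.Quotient.mk I s))) := by
  obtain ⟨e1⟩ := exists_rabinowitsch_equiv I s (Localization.Away (Ideal.Quotient.mk I s))
  obtain ⟨e2⟩ := exists_rabinowitsch_equiv (I.map (map (algebraMap k L))) (map (algebraMap k L) s)
    (Localization.Away (Ideal.Quotient.mk (I.map (map (algebraMap k L))) (map (algebraMap k L) s)))
  rw [← e1.toLinearEquiv.finrank_eq, ← e2.toLinearEquiv.finrank_eq,
    ← Module.Finite.equiv_iff e1.toLinearEquiv, ← Module.Finite.equiv_iff e2.toLinearEquiv,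
    ← map_rabinowitschIdeal]
  exact ⟨finrank_quotient_map _, finite_quotient_map_iff _⟩

end BaseChange

/-! ### Generic curves as generic sections -/

section GenericCurves

variable {K L : Type*} [Field K] [Field L] [Algebra K L] {ι σ : Type*} [Fintype ι]

/-- The ideal of two linear combinations of the polynomials `q i`. -/
def linearSectionIdeal (x : Fin 2 × ι → L) (q : ι → MvPolynomial σ K) :
    Ideal (MvPolynomial σ L) :=
  Ideal.span (Set.range fun k : Fin 2 => ∑ i, C (x (k, i)) * map (algebraMap K L) (q i))

/-- The new variable is invertible modulo the ideal, so multiplying the generators by it changes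
nothing. For `s = q j` this normalizes the coordinates of the image point to have `j`-th coordinate
`1`, as the theory of generic sections requires. -/
theorem genericSectionIdeal_rabinowitsch (q : ι → MvPolynomial σ K) (s : MvPolynomial σ K) :
    genericSectionIdeal (ι := ι) (Ideal.span {X none * rename some s - 1})
      (fun i => X none * rename some (q i)) =
    rabinowitschIdeal (linearSectionIdeal (fun z => algebraMap (MvPolynomial (Fin 2 × ι) K)
      (FractionRing (MvPolynomial (Fin 2 × ι) K)) (X z)) q) (map (algebraMap K _) s) := by
  set k₀ := FractionRing (MvPolynomial (Fin 2 × ι) K)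
  set x : Fin 2 × ι → k₀ := fun z => algebraMap (MvPolynomial (Fin 2 × ι) K) k₀ (X z) with hx
  set W : Fin 2 → MvPolynomial σ k₀ := fun k => ∑ i, C (x (k, i)) * map (algebraMap K k₀) (q i)
    with hW
  set t : MvPolynomial (Option σ) k₀ := X none * rename some (map (algebraMap K k₀) s) - 1 with ht
  have h1 : ∀ k, ∑ i, C (x (k, i)) * map (algebraMap K k₀) (X none * rename some (q i)) =
      X none * rename some (W k) := by
    intro k
    rw [hW, map_sum, Finset.mul_sum]
    refine Finset.sum_congr rfl fun i _ => ?_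
    simp only [map_mul, map_X, map_rename, rename_C]
    ring
  have h2 : genericSectionIdeal (ι := ι) (Ideal.span {X none * rename some s - 1})
      (fun i => X none * rename some (q i)) = Ideal.span {t} ⊔
        Ideal.span (Set.range fun k => X none * rename some (W k)) := by
    rw [genericSectionIdeal, Ideal.map_span, Set.image_singleton]
    congr 2
    · rw [map_sub, map_mul, map_X, map_one, map_rename]
    · congr 1
      funext k
      exact h1 k
  have h3 : rabinowitschIdeal (linearSectionIdeal x q) (map (algebraMap K k₀) s) =
      Ideal.span (Set.range fun k => rename some (W k)) ⊔ Ideal.span {t} := by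
    rw [rabinowitschIdeal, linearSectionIdeal, Ideal.map_span, ← Set.range_comp]
    rfl
  rw [h2, h3]
  refine le_antisymm (sup_le le_sup_right ?_) (sup_le ?_ le_sup_left)
  · rw [Ideal.span_le]
    rintro _ ⟨k, rfl⟩
    exact Ideal.mul_mem_left _ _ (Ideal.mem_sup_left (Ideal.subset_span ⟨k, rfl⟩))
  · rw [Ideal.span_le]
    rintro _ ⟨k, rfl⟩
    have : rename some (W k) = rename some (map (algebraMap K k₀) s) * (X none * rename some (W k)) -
        rename some (W k) * t := by rw [ht]; ring
    simp only
    rw [this]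
    exact sub_mem (Ideal.mul_mem_left _ _ (Ideal.mem_sup_right (Ideal.subset_span ⟨k, rfl⟩)))
      (Ideal.mul_mem_left _ _ (Ideal.mem_sup_left (Ideal.mem_span_singleton_self _)))

end GenericCurves

/-! ### The field of ratios and comparison of generic sections -/

section ImageField

attribute [local instance] MvPolynomial.algebraMvPolynomial FractionRing.liftAlgebra

theorem finrank_eq_mul_finrank_of_equiv {k E₁ E₂ A₁ A₂ : Type*} [Field k] [Field E₁] [Field E₂]
    [CommRing A₁] [CommRing A₂] [Algebra k A₁] [Algebra k A₂] [Algebra E₁ E₂]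
    (κ : k →+* E₁) (e₁ : A₁ ≃+* E₁) (h₁ : ∀ c, e₁ (algebraMap k A₁ c) = κ c)
    (e₂ : A₂ ≃+* E₂) (h₂ : ∀ c, e₂ (algebraMap k A₂ c) = algebraMap E₁ E₂ (κ c))
    (hfin : Module.Finite k A₂) :
    Module.Finite E₁ E₂ ∧ Module.finrank k A₂ = Module.finrank k A₁ * Module.finrank E₁ E₂ := by
  letI : Algebra k E₁ := κ.toAlgebra
  letI : Algebra k E₂ := ((algebraMap E₁ E₂).comp κ).toAlgebra
  haveI : IsScalarTower k E₁ E₂ := IsScalarTower.of_algebraMap_eq fun _ => rfl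
  let f₁ : A₁ ≃ₐ[k] E₁ := AlgEquiv.ofRingEquiv (f := e₁) h₁
  let f₂ : A₂ ≃ₐ[k] E₂ := AlgEquiv.ofRingEquiv (f := e₂) h₂
  haveI : Module.Finite k E₂ := Module.Finite.equiv f₂.toLinearEquiv
  refine ⟨Module.Finite.of_restrictScalars_finite k E₁ E₂, ?_⟩
  rw [f₁.toLinearEquiv.finrank_eq, f₂.toLinearEquiv.finrank_eq, Module.finrank_mul_finrank]

/-- A relation over the polynomial ring `k[T]` satisfied by a constant `z` holds coefficientwise in
the variables `T`. Any monomial that occurs in one of its coefficients yields a non-trivial relation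
over `k`. -/
theorem isAlgebraic_of_isAlgebraic_fractionRing_mvPolynomial {k Q T : Type*} [Field k] [Field Q]
    [Algebra k Q]
    (h : Algebra.IsAlgebraic (FractionRing (MvPolynomial T k)) (FractionRing (MvPolynomial T Q))) :
    Algebra.IsAlgebraic k Q := by
  refine ⟨fun z => ?_⟩
  set E := FractionRing (MvPolynomial T Q)
  have h1 : IsAlgebraic (MvPolynomial T k) (algebraMap (MvPolynomial T Q) E (C z)) :=
    (IsFractionRing.isAlgebraic_iff (MvPolynomial T k) (FractionRing (MvPolynomial T k)) E).mpr
      (h.isAlgebraic _)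
  obtain ⟨P, hP, hPz⟩ := h1
  have h2 : ∑ i ∈ Finset.range (P.natDegree + 1), map (algebraMap k Q) (P.coeff i) * C z ^ i =
      0 := by
    apply IsFractionRing.injective (MvPolynomial T Q) E
    rw [map_zero, map_sum, ← hPz, Polynomial.aeval_eq_sum_range]
    refine Finset.sum_congr rfl fun i _ => ?_
    rw [map_mul, map_pow, Algebra.smul_def]
    rfl
  obtain ⟨i₀, hi₀⟩ : ∃ i, P.coeff i ≠ 0 := by
    by_contra! hcon
    exact hP (Polynomial.ext fun i => by simp [hcon i])
  obtain ⟨m, hm⟩ := MvPolynomial.ne_zero_iff.mp hi₀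
  refine ⟨∑ i ∈ Finset.range (P.natDegree + 1), Polynomial.monomial i (coeff m (P.coeff i)),
    ?_, ?_⟩
  · intro h0
    have h3 := congrArg (fun R => Polynomial.coeff R i₀) h0
    simp only [Polynomial.finsetSum_coeff, Polynomial.coeff_monomial, Polynomial.coeff_zero,
      Finset.sum_ite_eq', Finset.mem_range] at h3
    rw [if_pos (Nat.lt_succ_of_le (Polynomial.le_natDegree_of_ne_zero hi₀))] at h3
    exact hm h3
  · have h3 := congrArg (coeff m) h2
    rw [coeff_sum, coeff_zero] at h3
    rw [map_sum, ← h3]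
    refine Finset.sum_congr rfl fun i _ => ?_
    rw [Polynomial.aeval_monomial, ← C_pow, mul_comm (map _ _), coeff_C_mul, coeff_map, mul_comm]

/-- Adjoining the same variables to both fields does not change the degree of an algebraic
extension; algebraicity is itself deduced from the finiteness of the larger section. The rest is the
tower law. -/
theorem finrank_eq_mul_finrank_of_equiv_fractionRing {k₀ k Q T A₁ A₂ : Type*} [Field k₀] [Field k]
    [Field Q] [Algebra k Q] [CommRing A₁] [CommRing A₂] [Algebra k₀ A₁] [Algebra k₀ A₂]
    (κ : k₀ →+* FractionRing (MvPolynomial T k)) (e₁ : A₁ ≃+* FractionRing (MvPolynomial T k))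
    (h₁ : ∀ c, e₁ (algebraMap k₀ A₁ c) = κ c)
    (κ' : k₀ →+* FractionRing (MvPolynomial T Q)) (e₂ : A₂ ≃+* FractionRing (MvPolynomial T Q))
    (h₂ : ∀ c, e₂ (algebraMap k₀ A₂ c) = κ' c)
    (hκ : ∀ c, κ' c = algebraMap (FractionRing (MvPolynomial T k))
      (FractionRing (MvPolynomial T Q)) (κ c))
    (hfin : Module.Finite k₀ A₂) :
    Module.Finite k Q ∧ Module.finrank k₀ A₂ = Module.finrank k₀ A₁ * Module.finrank k Q := by
  obtain ⟨hfinE, hdim⟩ := finrank_eq_mul_finrank_of_equiv κ e₁ h₁ e₂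
    (fun c => (h₂ c).trans (hκ c)) hfin
  have halg : Algebra.IsAlgebraic k Q :=
    isAlgebraic_of_isAlgebraic_fractionRing_mvPolynomial (T := T) (Algebra.IsAlgebraic.of_finite _ _)
  have hrank := Algebra.IsAlgebraic.rank_fractionRing_mvPolynomial (R := k) (S := Q) T
  refine ⟨?_, ?_⟩
  · rw [← Module.rank_lt_aleph0_iff, ← Cardinal.lift_lt_aleph0, ← hrank]
    haveI : Module.Free (FractionRing (MvPolynomial T k)) (FractionRing (MvPolynomial T Q)) :=
      Module.Free.of_divisionRing _ _
    exact Module.rank_lt_aleph0_iff.mpr hfinE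
  · rw [hdim]
    congr 1
    have := congrArg Cardinal.toNat hrank
    rwa [Cardinal.toNat_lift] at this

variable {K : Type*} [Field K] {σ : Type*}

/-- The quotient of `q i` by `q j` as a rational function. -/
def ratioFun (q : Fin 4 → MvPolynomial σ K) (j i : Fin 4) : FractionRing (MvPolynomial σ K) :=
  algebraMap _ _ (q i) / algebraMap _ _ (q j)

/-- The field generated by the ratios of the `q i`. -/
def ratioField (q : Fin 4 → MvPolynomial σ K) (j : Fin 4) :
    IntermediateField K (FractionRing (MvPolynomial σ K)) :=
  IntermediateField.adjoin K (Set.range (ratioFun q j))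

variable {q : Fin 4 → MvPolynomial σ K} {j : Fin 4}

theorem ratioFun_self (hj : q j ≠ 0) : ratioFun q j j = 1 :=
  div_self (by simpa using hj)

theorem aeval_algebraMap_eq_mul_aeval_ratioFun (hj : q j ≠ 0) {H : MvPolynomial (Fin 4) K} {N : ℕ}
    (hH : H.IsHomogeneous N) :
    algebraMap (MvPolynomial σ K) (FractionRing (MvPolynomial σ K)) (aeval q H) =
      algebraMap _ _ (q j) ^ N * aeval (ratioFun q j) H := by
  have hj' : algebraMap (MvPolynomial σ K) (FractionRing (MvPolynomial σ K)) (q j) ≠ 0 := by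
    simpa using hj
  rw [← aeval_mul_of_isHomogeneous hH, ← aeval_algebraMap_apply]
  congr 2
  funext i
  exact (mul_div_cancel₀ _ hj').symm

/-- `H` made homogeneous of degree `N` by multiplication with powers of `X j`. -/
def homogenizeAt {R : Type*} [CommSemiring R] (j : Fin 4) (N : ℕ) (H : MvPolynomial (Fin 4) R) :
    MvPolynomial (Fin 4) R :=
  ∑ k ∈ Finset.range (N + 1), X j ^ (N - k) * homogeneousComponent k H

theorem homogenizeAt_isHomogeneous {R : Type*} [CommSemiring R] (j : Fin 4) (N : ℕ)
    (H : MvPolynomial (Fin 4) R) : (homogenizeAt j N H).IsHomogeneous N := by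
  refine IsHomogeneous.sum _ _ _ fun k hk => ?_
  have hk' : k ≤ N := Nat.lt_succ_iff.mp (Finset.mem_range.mp hk)
  have h1 := (isHomogeneous_X_pow (R := R) j (N - k)).mul (homogeneousComponent_isHomogeneous k H)
  rwa [Nat.sub_add_cancel hk'] at h1

theorem aeval_homogenizeAt {R A : Type*} [CommSemiring R] [CommSemiring A] [Algebra R A]
    {j : Fin 4} {N : ℕ} {H : MvPolynomial (Fin 4) R} (hN : H.totalDegree ≤ N) {b : Fin 4 → A}
    (hb : b j = 1) : aeval b (homogenizeAt j N H) = aeval b H := by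
  conv_rhs => rw [← sum_homogeneousComponent H]
  rw [homogenizeAt, map_sum, map_sum]
  rw [← Finset.sum_subset (Finset.range_mono (Nat.succ_le_succ hN))]
  · exact Finset.sum_congr rfl fun k _ => by simp [hb]
  · intro k _ hk
    rw [homogeneousComponent_eq_zero _ _ (by simpa [Nat.lt_succ_iff] using hk), mul_zero, map_zero]

theorem sub_homogenizeAt_mem {R : Type*} [CommRing R] {j : Fin 4} {N : ℕ}
    {H : MvPolynomial (Fin 4) R} (hN : H.totalDegree ≤ N) :
    H - homogenizeAt j N H ∈ Ideal.span {(X j - 1 : MvPolynomial (Fin 4) R)} := by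
  rw [← Ideal.Quotient.mk_eq_mk_iff_sub_mem]
  set I := Ideal.span {(X j - 1 : MvPolynomial (Fin 4) R)}
  have h1 : Ideal.Quotient.mkₐ R I = aeval (fun i => Ideal.Quotient.mk I (X i)) := by
    ext i; simp
  have h2 : (fun i => Ideal.Quotient.mk I (X i)) j = 1 := by
    show Ideal.Quotient.mk I (X j) = 1
    rw [← map_one (Ideal.Quotient.mk I), Ideal.Quotient.mk_eq_mk_iff_sub_mem]
    exact Ideal.mem_span_singleton_self _
  have h3 := aeval_homogenizeAt (A := MvPolynomial (Fin 4) R ⧸ I)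
    (b := fun i => Ideal.Quotient.mk I (X i)) hN h2
  rw [← h1] at h3
  exact h3.symm

/-- Modulo `X j - 1` every polynomial can be replaced by a form, and a form vanishes at the ratios
exactly when it vanishes at `q`. -/
theorem ker_aeval_ratioFun (hj : q j ≠ 0) {G : MvPolynomial (Fin 4) K} {D : ℕ}
    (hG : G.IsHomogeneous D)
    (hGq : ∀ N H, H.IsHomogeneous N → (aeval q H = 0 ↔ G ∣ H)) :
    RingHom.ker (aeval (R := K) (ratioFun q j)) = Ideal.span {X j - 1, G} := by
  refine le_antisymm ?_ ?_
  · intro H hH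
    rw [RingHom.mem_ker] at hH
    rw [← sub_add_cancel H (homogenizeAt j H.totalDegree H)]
    refine add_mem (Ideal.span_mono (by simp) (sub_homogenizeAt_mem le_rfl)) ?_
    have h1 : aeval q (homogenizeAt j H.totalDegree H) = 0 := by
      apply IsFractionRing.injective (MvPolynomial σ K) (FractionRing (MvPolynomial σ K))
      rw [aeval_algebraMap_eq_mul_aeval_ratioFun hj (homogenizeAt_isHomogeneous _ _ _),
        aeval_homogenizeAt le_rfl (ratioFun_self hj), hH, mul_zero, map_zero]
    rw [hGq _ _ (homogenizeAt_isHomogeneous _ _ _)] at h1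
    exact Ideal.mem_of_dvd _ h1 (Ideal.subset_span (by simp))
  · rw [Ideal.span_le]
    have hj' : algebraMap (MvPolynomial σ K) (FractionRing (MvPolynomial σ K)) (q j) ≠ 0 := by
      simpa using hj
    rintro _ (rfl | rfl)
    · show aeval _ _ = 0
      rw [map_sub, map_one, aeval_X, ratioFun_self hj, sub_self]
    · show aeval _ _ = 0
      have h1 := aeval_algebraMap_eq_mul_aeval_ratioFun hj hG
      rw [(hGq _ _ hG).mpr dvd_rfl, map_zero] at h1
      exact (mul_eq_zero.mp h1.symm).resolve_left (pow_ne_zero _ hj')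

theorem map_incidenceHom {τ ι Q Q' : Type*} [Fintype ι] [DecidableEq ι] [Field Q] [Field Q']
    [Algebra K Q] [Algebra K Q'] {τ' : Type*} (f : Q →ₐ[K] Q') (j : ι)
    (φ : ι → MvPolynomial τ K) (p : MvPolynomial τ K →ₐ[K] Q) (φ' : ι → MvPolynomial τ' K)
    (p' : MvPolynomial τ' K →ₐ[K] Q') (h : ∀ i, f (p (φ i)) = p' (φ' i))
    (d : MvPolynomial (Fin 2 × ι) K) :
    map (f : Q →+* Q') (incidenceHom φ j p d) = incidenceHom φ' j p' d := by
  have : (mapAlgHom f).comp (incidenceHom φ j p) = incidenceHom φ' j p' := by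
    ext1 z
    simp only [AlgHom.comp_apply, incidenceHom, aeval_X]
    show map (f : Q →+* Q') _ = _
    rw [map_hyperplaneCoeff]
    congr 1
    funext i
    exact h i
  exact congrFun (congrArg DFunLike.coe this) d

-- Both sections live over the same field of hyperplane coefficients, and each is the function field
-- of its incidence variety. The embedding for `Q` is the one for `k` followed by inclusion, so the
-- two lengths differ by the degree of `Q` over `k`.
set_option maxHeartbeats 1000000 in
theorem finite_and_finrank_genericSectionIdeal {τ₁ τ₂ ι k Q : Type*} [Fintype ι]
    [DecidableEq ι] [Field k] [Field Q] [Algebra K k] [Algebra K Q] [Algebra k Q]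
    [IsScalarTower K k Q] (j : ι)
    (I₁ : Ideal (MvPolynomial τ₁ K)) (φ₁ : ι → MvPolynomial τ₁ K) (p₁ : MvPolynomial τ₁ K →ₐ[K] k)
    (I₂ : Ideal (MvPolynomial τ₂ K)) (φ₂ : ι → MvPolynomial τ₂ K) (p₂ : MvPolynomial τ₂ K →ₐ[K] Q)
    (hφ : ∀ i, algebraMap k Q (p₁ (φ₁ i)) = p₂ (φ₂ i))
    (hker₁ : RingHom.ker p₁ = I₁) (hone₁ : p₁ (φ₁ j) = 1)
    (hfrac₁ : ∀ z : k, ∃ r s, p₁ s ≠ 0 ∧ z * p₁ s = p₁ r)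
    (hker₂ : RingHom.ker p₂ = I₂) (hone₂ : p₂ (φ₂ j) = 1)
    (hfrac₂ : ∀ z : Q, ∃ r s, p₂ s ≠ 0 ∧ z * p₂ s = p₂ r)
    (hB : genericSectionIdeal I₁ φ₁ ≠ ⊤)
    (hfin₁ : Module.Finite (FractionRing (MvPolynomial (Fin 2 × ι) K))
      (MvPolynomial τ₁ _ ⧸ genericSectionIdeal I₁ φ₁))
    (hfin₂ : Module.Finite (FractionRing (MvPolynomial (Fin 2 × ι) K))
      (MvPolynomial τ₂ _ ⧸ genericSectionIdeal I₂ φ₂)) :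
    Module.Finite k Q ∧
    Module.finrank (FractionRing (MvPolynomial (Fin 2 × ι) K))
      (MvPolynomial τ₂ _ ⧸ genericSectionIdeal I₂ φ₂) =
    Module.finrank (FractionRing (MvPolynomial (Fin 2 × ι) K))
      (MvPolynomial τ₁ _ ⧸ genericSectionIdeal I₁ φ₁) * Module.finrank k Q := by
  have hinj := incidenceHom_injective _ φ₁ j p₁ hker₁ hone₁ hB
  let T := Fin 2 × {i : ι // i ≠ j}
  let E₁ := FractionRing (MvPolynomial T k)
  let E₂ := FractionRing (MvPolynomial T Q)
  let κ : FractionRing (MvPolynomial (Fin 2 × ι) K) →+* E₁ := IsFractionRing.lift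
    (g := (algebraMap (MvPolynomial T k) E₁).comp (incidenceHom φ₁ j p₁).toRingHom)
    ((IsFractionRing.injective (MvPolynomial T k) E₁).comp hinj)
  have hκ : ∀ d, κ (algebraMap _ _ d) = algebraMap (MvPolynomial T k) E₁
      (incidenceHom φ₁ j p₁ d) := fun d => IsFractionRing.lift_algebraMap _ _
  obtain ⟨e₁, he₁⟩ := exists_quotient_genericSectionIdeal_equiv _ φ₁ j p₁ hker₁ hone₁ hfrac₁ κ hκ
    hfin₁
  let κ₂ : FractionRing (MvPolynomial (Fin 2 × ι) K) →+* E₂ := (algebraMap E₁ E₂).comp κ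
  have hκ₂ : ∀ d, κ₂ (algebraMap _ _ d) =
      algebraMap (MvPolynomial T Q) E₂ (incidenceHom φ₂ j p₂ d) := by
    intro d
    show algebraMap E₁ E₂ (κ _) = _
    rw [hκ, ← IsScalarTower.algebraMap_apply (MvPolynomial T k) E₁ E₂,
      IsScalarTower.algebraMap_apply (MvPolynomial T k) (MvPolynomial T Q) E₂,
      ← map_incidenceHom (IsScalarTower.toAlgHom K k Q) j φ₁ p₁ φ₂ p₂ hφ]
    rfl
  obtain ⟨e₂, he₂⟩ := exists_quotient_genericSectionIdeal_equiv _ φ₂ j p₂ hker₂ hone₂ hfrac₂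
    κ₂ hκ₂ hfin₂
  exact finrank_eq_mul_finrank_of_equiv_fractionRing
    (k₀ := FractionRing (MvPolynomial (Fin 2 × ι) K))
    (A₁ := MvPolynomial τ₁ (FractionRing (MvPolynomial (Fin 2 × ι) K)) ⧸ genericSectionIdeal I₁ φ₁)
    (A₂ := MvPolynomial τ₂ (FractionRing (MvPolynomial (Fin 2 × ι) K)) ⧸ genericSectionIdeal I₂ φ₂)
    κ e₁ he₁ κ₂ e₂ he₂ (fun _ => rfl) hfin₂

end ImageField

/-! ### Variable intersections of two generic curves -/

section ImageField

variable {K : Type*} [Field K] {σ : Type*} {q : Fin 4 → MvPolynomial σ K} {j : Fin 4}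

set_option maxHeartbeats 1000000 in
/-- Away from the base points, two generic curves of the linear system meet in a scheme whose length
is the product of the degree of the image surface and the degree of the function field
extension. -/
theorem finrank_away_linearSectionIdeal (hj : q j ≠ 0) {G : MvPolynomial (Fin 4) K} {D : ℕ}
    (hG : G.IsHomogeneous D) (hirr : Irreducible G)
    (hGq : ∀ N H, H.IsHomogeneous N → (aeval q H = 0 ↔ G ∣ H))
    (hfin : Module.Finite (FractionRing (MvPolynomial (Fin 2 × Fin 4) K))
      (Localization.Away (Ideal.Quotient.mk (linearSectionIdeal (fun z =>
        algebraMap (MvPolynomial (Fin 2 × Fin 4) K)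
          (FractionRing (MvPolynomial (Fin 2 × Fin 4) K)) (X z)) q)
        (map (algebraMap K _) (q j))))) :
    Module.Finite (ratioField q j) (FractionRing (MvPolynomial σ K)) ∧
    Module.finrank (FractionRing (MvPolynomial (Fin 2 × Fin 4) K))
      (Localization.Away (Ideal.Quotient.mk (linearSectionIdeal (fun z =>
        algebraMap (MvPolynomial (Fin 2 × Fin 4) K)
          (FractionRing (MvPolynomial (Fin 2 × Fin 4) K)) (X z)) q)
        (map (algebraMap K _) (q j)))) =
      D * Module.finrank (ratioField q j) (FractionRing (MvPolynomial σ K)) := by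
  set k₀ := FractionRing (MvPolynomial (Fin 2 × Fin 4) K) with hk₀
  set x : Fin 2 × Fin 4 → k₀ := fun z => algebraMap (MvPolynomial (Fin 2 × Fin 4) K) k₀ (X z)
    with hx
  set Q := FractionRing (MvPolynomial σ K) with hQ
  set k₁ := ratioField q j with hk₁
  have hj' : algebraMap (MvPolynomial σ K) Q (q j) ≠ 0 := by simpa [hQ] using hj
  -- the surface
  let b : Fin 4 → k₁ := fun i => ⟨ratioFun q j i, IntermediateField.subset_adjoin _ _ ⟨i, rfl⟩⟩
  let p₁ : MvPolynomial (Fin 4) K →ₐ[K] k₁ := aeval b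
  have hp₁ : ∀ H, algebraMap k₁ Q (p₁ H) = aeval (ratioFun q j) H := by
    intro H
    have : k₁.val.comp p₁ = aeval (ratioFun q j) := by ext i; simp [p₁, b]
    exact congrFun (congrArg DFunLike.coe this) H
  have hker₁ : RingHom.ker p₁ = Ideal.span {X j - 1, G} := by
    rw [← ker_aeval_ratioFun hj hG hGq]
    ext H
    rw [RingHom.mem_ker, RingHom.mem_ker, ← hp₁, map_eq_zero_iff _ (algebraMap k₁ Q).injective]
  have hone₁ : p₁ (X j) = 1 := by
    apply (algebraMap k₁ Q).injective
    rw [hp₁, aeval_X, ratioFun_self hj, map_one]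
  -- The surface is not the plane `X j = 0`, since `q j` is not zero.
  have hX : ¬ X j ∣ G := by
    intro hd
    have h1 : Associated (X j) G := (X_prime (R := K) (i := j)).irreducible.associated_of_dvd hirr hd
    have h2 := (hGq 1 (X j) (isHomogeneous_X K j)).mpr h1.symm.dvd
    rw [aeval_X] at h2
    exact hj h2
  have hD : D ≠ 0 := by
    rintro rfl
    obtain ⟨c, rfl⟩ : ∃ c, G = C c := ⟨_, totalDegree_eq_zero_iff_eq_C.mp
      (Nat.le_zero.mp hG.totalDegree_le)⟩
    have hc : c ≠ 0 := fun h => hirr.ne_zero (by rw [h, map_zero])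
    exact hirr.not_isUnit ((isUnit_iff_ne_zero.mpr hc).map C)
  obtain ⟨hfin₁, hdim₁⟩ := finrank_quotient_genericSectionIdeal_surface hG hX
  have hfrac₁ : ∀ z : k₁, ∃ r s, p₁ s ≠ 0 ∧ z * p₁ s = p₁ r := by
    rintro ⟨z, hz⟩
    obtain ⟨r, s, hrs⟩ := (IntermediateField.mem_adjoin_range_iff K (ratioFun q j) z).mp hz
    -- Membership in the generated field allows a vanishing denominator; the element is then `0` by
    -- the convention for division.
    by_cases hs : aeval (ratioFun q j) s = 0
    · refine ⟨0, 1, by simp, ?_⟩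
      rw [hs, div_zero] at hrs
      subst hrs
      rw [map_one, map_zero, mul_one]
      rfl
    · refine ⟨r, s, ?_, ?_⟩
      · intro h0
        rw [← hp₁, h0, map_zero] at hs
        exact hs rfl
      · apply (algebraMap k₁ Q).injective
        rw [map_mul, hp₁, hp₁]
        show z * _ = _
        rw [hrs, div_mul_cancel₀ _ hs]
  have hB₁ : genericSectionIdeal (ι := Fin 4) (Ideal.span {X j - 1, G}) X ≠ ⊤ := by
    intro htop
    rw [htop] at hdim₁
    have : Subsingleton (MvPolynomial (Fin 4) k₀ ⧸ (⊤ : Ideal (MvPolynomial (Fin 4) k₀))) :=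
      Ideal.Quotient.subsingleton_iff.mpr rfl
    rw [Module.finrank_zero_of_subsingleton] at hdim₁
    exact hD hdim₁.symm
  -- the plane
  let p₂ : MvPolynomial (Option σ) K →ₐ[K] Q := aeval fun o => o.elim (algebraMap _ Q (q j))⁻¹
    fun i => algebraMap (MvPolynomial σ K) Q (X i)
  have hp₂ : ∀ f, p₂ (rename some f) = algebraMap _ Q f := by
    intro f
    have : p₂.comp (rename some) = IsScalarTower.toAlgHom K (MvPolynomial σ K) Q := by
      ext i; simp [p₂]
    exact congrFun (congrArg DFunLike.coe this) f
  have hp₂z : p₂ (X none) = (algebraMap _ Q (q j))⁻¹ := by simp [p₂]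
  have hker₂ : RingHom.ker p₂ =
      Ideal.span {(X none * rename some (q j) - 1 : MvPolynomial (Option σ) K)} := by
    refine le_antisymm ?_ ?_
    · intro H hH
      rw [RingHom.mem_ker] at hH
      obtain ⟨N, h, hN⟩ := exists_pow_mul_sub_rename_mem (q j) H
      have hle : Ideal.span {(X none * rename some (q j) - 1 : MvPolynomial (Option σ) K)} ≤
          RingHom.ker p₂ := by
        rw [Ideal.span_singleton_le_iff_mem, RingHom.mem_ker, map_sub, map_mul, hp₂, hp₂z,
          inv_mul_cancel₀ hj', map_one, sub_self]
      have h1 := hle hN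
      rw [RingHom.mem_ker, map_sub, map_mul, hH, mul_zero, zero_sub, neg_eq_zero, hp₂] at h1
      have h2 : h = 0 := (map_eq_zero_iff _ (IsFractionRing.injective _ Q)).mp h1
      rw [h2, map_zero, sub_zero] at hN
      exact mem_of_pow_mul_mem_rabinowitsch (Ideal.mem_span_singleton_self _) hN
    · rw [Ideal.span_singleton_le_iff_mem, RingHom.mem_ker, map_sub, map_mul, hp₂, hp₂z,
        inv_mul_cancel₀ hj', map_one, sub_self]
  let φ₂ : Fin 4 → MvPolynomial (Option σ) K := fun i => X none * rename some (q i)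
  have hφ₂ : ∀ i, p₂ (φ₂ i) = ratioFun q j i := by
    intro i
    simp only [φ₂]
    rw [map_mul, hp₂, hp₂z, ratioFun, div_eq_mul_inv, mul_comm]
  have hone₂ : p₂ (φ₂ j) = 1 := by rw [hφ₂, ratioFun_self hj]
  have hfrac₂ : ∀ z : Q, ∃ r s, p₂ s ≠ 0 ∧ z * p₂ s = p₂ r := by
    intro z
    obtain ⟨r, s, hs, rfl⟩ := IsFractionRing.div_surjective (A := MvPolynomial σ K) z
    have hs' : algebraMap (MvPolynomial σ K) Q s ≠ 0 := by
      simpa [hQ] using nonZeroDivisors.ne_zero hs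
    exact ⟨rename some r, rename some s, by rwa [hp₂], by rw [hp₂, hp₂, div_mul_cancel₀ _ hs']⟩
  have hB₂ : genericSectionIdeal (ι := Fin 4)
      (Ideal.span {(X none * rename some (q j) - 1 : MvPolynomial (Option σ) K)}) φ₂ =
      rabinowitschIdeal (linearSectionIdeal x q) (map (algebraMap K k₀) (q j)) :=
    genericSectionIdeal_rabinowitsch q (q j)
  obtain ⟨e₃⟩ := exists_rabinowitsch_equiv (linearSectionIdeal x q) (map (algebraMap K k₀) (q j))
    (Localization.Away (Ideal.Quotient.mk (linearSectionIdeal x q) (map (algebraMap K k₀) (q j))))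
  have hfin₂ : Module.Finite k₀ (MvPolynomial (Option σ) k₀ ⧸ genericSectionIdeal (ι := Fin 4)
      (Ideal.span {(X none * rename some (q j) - 1 : MvPolynomial (Option σ) K)}) φ₂) := by
    rw [hB₂]
    exact Module.Finite.equiv e₃.symm.toLinearEquiv
  obtain ⟨hfinQ, hdim⟩ := finite_and_finrank_genericSectionIdeal j _ X p₁ _ φ₂ p₂
    (fun i => by rw [hφ₂, hp₁, aeval_X]) hker₁ hone₁ hfrac₁ hker₂ hone₂ hfrac₂ hB₁ hfin₁ hfin₂
  refine ⟨hfinQ, ?_⟩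
  rw [hdim₁, hB₂, e₃.toLinearEquiv.finrank_eq] at hdim
  exact hdim

end ImageField

/-! ### Common zeros of two generic members of a linear system -/

section GenericZeros

/-- If as many algebraically independent elements as there are `z i` lie in the field generated by
the `z i`, then these are algebraically independent. -/
theorem algebraicIndependent_of_mem_adjoin {K F ι : Type*} [Field K] [Field F] [Algebra K F]
    [Finite ι] {b z : ι → F} (hb : AlgebraicIndependent K b)
    (h : ∀ i, b i ∈ IntermediateField.adjoin K (Set.range z)) : AlgebraicIndependent K z := by
  set M := AlgebraicIndependent.matroid K F with hM
  -- Each `b i` is rational in the `z i`, so the `z i` have at least the rank of the `b i`. A family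
  -- indexed by `ι` with this full rank is injective and independent.
  have hcl : Set.range b ⊆ M.closure (Set.range z) := by
    rintro _ ⟨i, rfl⟩
    rw [hM, AlgebraicIndependent.matroid_closure_eq]
    obtain ⟨r, s, hrs⟩ := (IntermediateField.mem_adjoin_range_iff K z (b i)).mp (h i)
    have hmem : ∀ r : MvPolynomial ι K, IsAlgebraic (Algebra.adjoin K (Set.range z)) (aeval z r) :=
      fun r => isAlgebraic_algebraMap (⟨_, by
        rw [Algebra.adjoin_range_eq_range_aeval]; exact ⟨r, rfl⟩⟩ : Algebra.adjoin K (Set.range z))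
    show IsAlgebraic _ _
    rw [hrs, div_eq_mul_inv]
    exact (hmem r).mul (hmem s).inv
  have hind : M.Indep (Set.range b) := by
    rw [hM, AlgebraicIndependent.matroid_indep_iff]
    exact hb.to_subtype_range
  have h1 : (Set.range b).encard ≤ M.eRk (Set.range z) := by
    rw [← hind.eRk_eq_encard, ← M.eRk_closure_eq (Set.range z)]
    exact M.eRk_mono hcl
  rw [← Set.image_univ, hb.injective.encard_image] at h1
  have hfin : (Set.range z).Finite := Set.finite_range z
  have h2 : M.Indep (Set.range z) := by
    rw [Matroid.indep_iff_eRk_eq_encard_of_finite hfin]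
    refine le_antisymm (M.eRk_le_encard _) (le_trans ?_ h1)
    rw [← Set.image_univ]
    exact Set.encard_image_le _ _
  have hinj : Function.Injective z := by
    rw [← Set.injOn_univ]
    refine (Set.finite_univ (α := ι)).injOn_of_encard_image_eq (le_antisymm ?_ ?_)
    · exact Set.encard_image_le _ _
    · rw [Set.image_univ]
      exact h1.trans (M.eRk_le_encard _)
  rw [hM, AlgebraicIndependent.matroid_indep_iff] at h2
  exact .of_subtype_range hinj h2

variable {K F : Type*} [Field K] [Field F] [Algebra K F] {ι σ : Type*} [Fintype ι]

/-- The linear combinations of the polynomials `q i` with coefficients `x (k, i)`. -/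
def linearSection (x : Fin 2 × ι → F) (q : ι → MvPolynomial σ K) (k : Fin 2) :
    MvPolynomial σ F := ∑ i, C (x (k, i)) * map (algebraMap K F) (q i)

theorem linearSectionIdeal_eq (x : Fin 2 × ι → F) (q : ι → MvPolynomial σ K) :
    linearSectionIdeal x q = Ideal.span {linearSection x q 0, linearSection x q 1} := by
  rw [linearSectionIdeal]
  congr 1
  ext f
  simp [linearSection, eq_comm]

theorem eval_linearSection (x : Fin 2 × ι → F) (q : ι → MvPolynomial σ K) (k : Fin 2)
    (τ : σ → F) : eval τ (linearSection x q k) = ∑ i, x (k, i) * aeval τ (q i) := by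
  rw [linearSection, map_sum]
  refine Finset.sum_congr rfl fun i _ => ?_
  rw [map_mul, eval_C, eval_map, aeval_def]

theorem homogeneousComponent_linearSection (x : Fin 2 × ι → F) (q : ι → MvPolynomial σ K)
    (k : Fin 2) (n : ℕ) : homogeneousComponent n (linearSection x q k) =
      linearSection x (fun i => homogeneousComponent n (q i)) k := by
  ext m
  simp only [linearSection, coeff_homogeneousComponent, coeff_sum, coeff_C_mul, coeff_map]
  split_ifs <;> simp

theorem totalDegree_linearSection_le {x : Fin 2 × ι → F} {q : ι → MvPolynomial σ K}
    {n : ℕ} (hq : ∀ i, (q i).totalDegree ≤ n) (k : Fin 2) :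
    (linearSection x q k).totalDegree ≤ n := by
  refine totalDegree_finsetSum_le fun i _ => (totalDegree_mul _ _).trans ?_
  rw [totalDegree_C, zero_add]
  exact (Finset.sup_mono (support_map_subset _ _)).trans (hq i)

variable {x : Fin 2 × ι → F} (hx : AlgebraicIndependent K x)
include hx

/-- Algebraically independent coefficients are linearly independent over `K`, so no coefficient of a
`q i` can cancel. -/
theorem linearSection_ne_zero {q : ι → MvPolynomial σ K} (hq : ∃ i, q i ≠ 0) (k : Fin 2) :
    linearSection x q k ≠ 0 := by
  obtain ⟨i, hi⟩ := hq
  obtain ⟨m, hm⟩ := MvPolynomial.ne_zero_iff.mp hi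
  intro h
  have h1 := congrArg (coeff m) h
  simp only [linearSection, coeff_sum, coeff_C_mul, coeff_map, coeff_zero] at h1
  have h2 := hx.linearIndependent.comp (fun i => (k, i)) (Prod.mk_right_injective k)
  rw [Fintype.linearIndependent_iff] at h2
  refine hm (h2 (fun i => coeff m (q i)) ?_ i)
  rw [← h1]
  refine Finset.sum_congr rfl fun i _ => ?_
  rw [Algebra.smul_def, mul_comm]
  rfl

/-- A point of the plane common to two generic curves of a linear system is generic, unless it is
a base point. -/
theorem algebraicIndependent_of_mem_linearSection {f : ι → MvPolynomial (Fin 2) K} {τ : Fin 2 → F}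
    (h : ∀ k, eval τ (linearSection x f k) = 0) {j : ι} (hj : aeval τ (f j) ≠ 0) :
    AlgebraicIndependent K τ := by
  -- The image of `τ`, scaled to have `j`-th coordinate `1`, lies on two generic hyperplanes. Two of
  -- its coordinates are algebraically independent, and they are rational functions of the two
  -- coordinates of `τ`.
  obtain ⟨i, k, hik⟩ := exists_algebraicIndependent_pair hx
    (fun i => aeval τ (f i) / aeval τ (f j)) (div_self hj) fun k => by
      have h1 := h k
      rw [eval_linearSection] at h1
      simp only [mul_div_assoc', ← Finset.sum_div, h1, zero_div]
  refine algebraicIndependent_of_mem_adjoin hik fun l => ?_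
  have h1 : ∀ r, aeval τ r ∈ IntermediateField.adjoin K (Set.range τ) := fun r =>
    IntermediateField.algebra_adjoin_le_adjoin _ _ (by
      rw [Algebra.adjoin_range_eq_range_aeval]; exact ⟨r, rfl⟩)
  fin_cases l
  · exact div_mem (h1 _) (h1 _)
  · exact div_mem (h1 _) (h1 _)

end GenericZeros

/-! ### Binary forms without common zeros -/

section Homogeneous

theorem exists_X_pow_mem_span {K σ ι : Type*} [Field K] [IsAlgClosed K] [Finite σ]
    {f : ι → MvPolynomial σ K} (h : ∀ τ : σ → K, (∀ i, eval τ (f i) = 0) → τ = 0) (l : σ) :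
    ∃ N, X l ^ N ∈ Ideal.span (Set.range f) := by
  have h1 : (X l : MvPolynomial σ K) ∈ (Ideal.span (Set.range f)).radical := by
    rw [← vanishingIdeal_zeroLocus_eq_radical (K := K)]
    intro τ hτ
    rw [h τ fun i => hτ _ (Ideal.subset_span ⟨i, rfl⟩)]
    simp
  exact h1

theorem isRelPrime_X_pow {K σ : Type*} [Field K] {i j : σ} (hij : i ≠ j) (m n : ℕ) :
    IsRelPrime (X i ^ m : MvPolynomial σ K) (X j ^ n) := by
  refine IsRelPrime.pow ?_
  rw [(X_prime (R := K) (i := i)).irreducible.isRelPrime_iff_not_dvd, X_dvd_X]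
  exact hij

/-- By the Nullstellensatz powers of both variables lie in the ideal of `f` and `g`, and a common
divisor divides these coprime powers. -/
theorem isRelPrime_of_no_common_zero {K : Type*} [Field K] [IsAlgClosed K]
    {f g : MvPolynomial (Fin 2) K}
    (h : ∀ τ : Fin 2 → K, eval τ f = 0 → eval τ g = 0 → τ = 0) : IsRelPrime f g := by
  have h1 : ∀ l, ∃ N, X l ^ N ∈ Ideal.span (Set.range ![f, g]) :=
    exists_X_pow_mem_span fun τ hτ => h τ (hτ 0) (hτ 1)
  obtain ⟨N, hN⟩ := h1 0
  obtain ⟨M, hM⟩ := h1 1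
  intro d hf hg
  have h2 : Ideal.span (Set.range ![f, g]) ≤ Ideal.span {d} := by
    rw [Ideal.span_le]
    rintro _ ⟨k, rfl⟩
    fin_cases k
    · exact Ideal.mem_span_singleton.mpr hf
    · exact Ideal.mem_span_singleton.mpr hg
  exact isRelPrime_X_pow (by decide) N M (Ideal.mem_span_singleton.mp (h2 hN))
    (Ideal.mem_span_singleton.mp (h2 hM))

variable {K F : Type*} [Field K] [IsAlgClosed K] [Field F] [Algebra K F] {ι : Type*} [Fintype ι]

/-- The membership of powers of the variables, certified by the Nullstellensatz over `K`, persists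
over every extension field. -/
theorem exists_aeval_ne_zero {σ : Type*} [Finite σ] {f : ι → MvPolynomial σ K}
    (h : ∀ τ : σ → K, (∀ i, eval τ (f i) = 0) → τ = 0) {τ : σ → F} (hτ : τ ≠ 0) :
    ∃ i, aeval τ (f i) ≠ 0 := by
  by_contra! hcon
  apply hτ
  funext l
  obtain ⟨N, hN⟩ := exists_X_pow_mem_span h l
  have h1 : Ideal.span (Set.range f) ≤ RingHom.ker (aeval (R := K) τ) := by
    rw [Ideal.span_le]
    rintro _ ⟨i, rfl⟩
    exact hcon i
  have h2 := h1 hN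
  rw [RingHom.mem_ker, map_pow, aeval_X] at h2
  exact eq_zero_of_pow_eq_zero h2

/-- A non-zero common zero could be scaled to have some coordinate equal to `1`. It is not a zero of
the whole system, so its coordinates would be algebraically independent, although `1` is algebraic.
-/
theorem eq_zero_of_eval_linearSection {x : Fin 2 × ι → F} (hx : AlgebraicIndependent K x)
    {n : ℕ} {f : ι → MvPolynomial (Fin 2) K} (hf : ∀ i, (f i).IsHomogeneous n)
    (h : ∀ τ : Fin 2 → K, (∀ i, eval τ (f i) = 0) → τ = 0) (τ : Fin 2 → F)
    (hτ : ∀ k, eval τ (linearSection x f k) = 0) : τ = 0 := by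
  by_contra h0
  obtain ⟨l, hl⟩ := Function.ne_iff.mp h0
  have hl' : τ l ≠ 0 := hl
  set τ' : Fin 2 → F := fun i => (τ l)⁻¹ * τ i with hτ'
  have hτl : τ' l = 1 := inv_mul_cancel₀ hl'
  have h1 : ∀ i, aeval τ' (f i) = (τ l)⁻¹ ^ n * aeval τ (f i) := fun i =>
    aeval_mul_of_isHomogeneous (hf i) _ _
  obtain ⟨j, hj⟩ := exists_aeval_ne_zero (F := F) h (τ := τ') (by
    intro h2
    rw [h2] at hτl
    exact zero_ne_one hτl)
  have h2 : AlgebraicIndependent K τ' := by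
    refine algebraicIndependent_of_mem_linearSection hx (fun k => ?_) hj
    have h3 := hτ k
    rw [eval_linearSection] at h3 ⊢
    simp only [h1, mul_left_comm _ ((τ l)⁻¹ ^ n), ← Finset.mul_sum, h3, mul_zero]
  exact (h2.transcendental l) (hτl ▸ isAlgebraic_one)

end Homogeneous

/-! ### Linear systems without base points at infinity -/

section AffineSystem

theorem totalDegree_pow_le_and_homogeneousComponent_pow {σ R : Type*} [CommSemiring R]
    {f : MvPolynomial σ R} {n : ℕ} (hf : f.totalDegree ≤ n) (d : ℕ) :
    (f ^ d).totalDegree ≤ n * d ∧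
      homogeneousComponent (n * d) (f ^ d) = homogeneousComponent n f ^ d := by
  induction d with
  | zero =>
    refine ⟨by simp, ?_⟩
    rw [pow_zero, pow_zero, mul_zero, homogeneousComponent_zero, coeff_zero_one, map_one]
  | succ d ih =>
    refine ⟨(totalDegree_pow _ _).trans (by rw [mul_comm]; gcongr), ?_⟩
    rw [mul_add, mul_one, pow_succ, homogeneousComponent_mul_of_totalDegree_le ih.1 hf, ih.2,
      pow_succ]

/-- The polynomials `q i` in two variables define a linear system of plane curves of degree `n`
without base points on the line at infinity. -/
structure IsAffineSystem {K ι : Type*} [Field K] (q : ι → MvPolynomial (Fin 2) K) (n : ℕ) :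
    Prop where
  totalDegree_le : ∀ i, (q i).totalDegree ≤ n
  eq_zero : ∀ τ : Fin 2 → K, (∀ i, eval τ (homogeneousComponent n (q i)) = 0) → τ = 0

namespace IsAffineSystem

variable {K F : Type*} [Field K] [IsAlgClosed K] [Field F] [IsAlgClosed F] [Algebra K F]
  {ι : Type*} [Fintype ι] {x : Fin 2 × ι → F} {n : ℕ} {q : ι → MvPolynomial (Fin 2) K}

omit [IsAlgClosed K] [Fintype ι] in
theorem exists_homogeneousComponent_ne_zero (hq : IsAffineSystem q n) :
    ∃ i, homogeneousComponent n (q i) ≠ 0 := by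
  by_contra! hcon
  have h1 := hq.eq_zero 1 fun i => by rw [hcon i, map_zero]
  exact one_ne_zero h1

variable (hq : IsAffineSystem q n) (hx : AlgebraicIndependent K x)
include hq hx

omit [IsAlgClosed K] [IsAlgClosed F] in
theorem homogeneousComponent_linearSection_ne_zero (k : Fin 2) :
    homogeneousComponent n (linearSection x q k) ≠ 0 := by
  rw [homogeneousComponent_linearSection]
  exact linearSection_ne_zero hx hq.exists_homogeneousComponent_ne_zero k

theorem isRelPrime_homogeneousComponent :
    IsRelPrime (homogeneousComponent n (linearSection x q 0))
      (homogeneousComponent n (linearSection x q 1)) := by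
  rw [homogeneousComponent_linearSection, homogeneousComponent_linearSection]
  refine isRelPrime_of_no_common_zero fun τ h0 h1 =>
    eq_zero_of_eval_linearSection hx (fun i => homogeneousComponent_isHomogeneous n (q i))
      hq.eq_zero τ fun k => ?_
  fin_cases k
  · exact h0
  · exact h1

theorem isRelPrime : IsRelPrime (linearSection x q 0) (linearSection x q 1) :=
  isRelPrime_of_homogeneousComponent (totalDegree_linearSection_le hq.totalDegree_le 0)
    (totalDegree_linearSection_le hq.totalDegree_le 1)
    (hq.homogeneousComponent_linearSection_ne_zero hx 0)
    (hq.homogeneousComponent_linearSection_ne_zero hx 1) (hq.isRelPrime_homogeneousComponent hx)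

/-- Powers of coprime leading forms stay coprime, so Bézout's theorem applies to powers too; the
higher powers give finiteness for the powers of the ideal of the system. -/
theorem finrank_quotient_span_pow (d : ℕ) :
    Module.Finite F (MvPolynomial (Fin 2) F ⧸
      Ideal.span {linearSection x q 0 ^ d, linearSection x q 1 ^ d}) ∧
    Module.finrank F (MvPolynomial (Fin 2) F ⧸
      Ideal.span {linearSection x q 0 ^ d, linearSection x q 1 ^ d}) = (n * d) ^ 2 := by
  have h := fun k => totalDegree_pow_le_and_homogeneousComponent_pow
    (totalDegree_linearSection_le (x := x) hq.totalDegree_le k) d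
  refine finrank_quotient_span_pair_eq_sq (h 0).1 (h 1).1 ?_ ?_ ?_
  · rw [(h 0).2]
    exact pow_ne_zero _ (hq.homogeneousComponent_linearSection_ne_zero hx 0)
  · rw [(h 1).2]
    exact pow_ne_zero _ (hq.homogeneousComponent_linearSection_ne_zero hx 1)
  · rw [(h 0).2, (h 1).2]
    exact (hq.isRelPrime_homogeneousComponent hx).pow

theorem finrank_quotient_linearSectionIdeal :
    Module.Finite F (MvPolynomial (Fin 2) F ⧸ linearSectionIdeal x q) ∧
    Module.finrank F (MvPolynomial (Fin 2) F ⧸ linearSectionIdeal x q) = n ^ 2 := by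
  have h := hq.finrank_quotient_span_pow hx 1
  rw [pow_one, pow_one, mul_one] at h
  rwa [linearSectionIdeal_eq]

omit [IsAlgClosed K] [IsAlgClosed F] hq hx in
theorem linearSection_mem (k : Fin 2) :
    linearSection x q k ∈ (Ideal.span (Set.range q)).map (map (algebraMap K F)) := by
  rw [linearSection]
  exact sum_mem fun i _ => Ideal.mul_mem_left _ _
    (Ideal.mem_map_of_mem _ (Ideal.subset_span ⟨i, rfl⟩))

/-- After base change the `d`-th power of the ideal contains the `d`-th powers of two generic
members, and finiteness descends to `K`. -/
theorem finite_quotient_span (d : ℕ) :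
    Module.Finite K (MvPolynomial (Fin 2) K ⧸ Ideal.span (Set.range q) ^ d) := by
  rw [← finite_quotient_map_iff (L := F)]
  have h1 : Ideal.span {linearSection x q 0 ^ d, linearSection x q 1 ^ d} ≤
      (Ideal.span (Set.range q) ^ d).map (map (algebraMap K F)) := by
    rw [Ideal.map_pow, Ideal.span_le]
    rintro _ (rfl | rfl)
    · exact Ideal.pow_mem_pow (linearSection_mem 0) d
    · exact Ideal.pow_mem_pow (linearSection_mem 1) d
  haveI := (hq.finrank_quotient_span_pow hx d).1
  exact Module.Finite.of_surjective (Ideal.Quotient.factorₐ F h1).toLinearMap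
    (Ideal.Quotient.factor_surjective h1)

-- The coordinates of `τ` are images of elements of a finite algebra, hence algebraic over the
-- algebraically closed field `K`. This is why base points over `F` come from `K`.
omit [IsAlgClosed F] hq hx in
theorem exists_eq_algebraMap {I : Ideal (MvPolynomial (Fin 2) K)}
    (hI : Module.Finite K (MvPolynomial (Fin 2) K ⧸ I)) {τ : Fin 2 → F}
    (hτ : ∀ f ∈ I, aeval τ f = 0) : ∃ a : Fin 2 → K, τ = fun i => algebraMap K F (a i) := by
  have h1 : ∀ i, ∃ c, algebraMap K F c = τ i := by
    intro i
    let φ : (MvPolynomial (Fin 2) K ⧸ I) →ₐ[K] F := Ideal.Quotient.liftₐ I (aeval τ) hτ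
    have h2 : IsAlgebraic K (φ (Ideal.Quotient.mk I (X i))) :=
      (Algebra.IsAlgebraic.isAlgebraic (R := K) (Ideal.Quotient.mk I (X i))).algHom φ
    have h3 : φ (Ideal.Quotient.mk I (X i)) = τ i := by
      exact (Ideal.Quotient.lift_mk I _ _).trans (aeval_X τ i)
    rw [h3] at h2
    haveI := IntermediateField.isAlgebraic_adjoin_simple h2.isIntegral
    rw [← Set.mem_range, ← IntermediateField.mem_bot,
      ← IntermediateField.eq_bot_of_isAlgClosed_of_isAlgebraic (IntermediateField.adjoin K {τ i})]
    exact IntermediateField.mem_adjoin_simple_self K _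
  choose a ha using h1
  exact ⟨a, funext fun i => (ha i).symm⟩

-- Each coordinate of a zero is a root of the minimal polynomial of the corresponding coordinate
-- function.
omit [IsAlgClosed K] [IsAlgClosed F] hq hx in
theorem finite_zeroLocus {I : Ideal (MvPolynomial (Fin 2) K)}
    (hI : Module.Finite K (MvPolynomial (Fin 2) K ⧸ I)) : (zeroLocus K I).Finite := by
  refine (Set.Finite.pi fun i =>
    (minpoly K (Ideal.Quotient.mk I (X i))).rootSet_finite K).subset fun a ha i _ => ?_
  rw [Polynomial.mem_rootSet]
  refine ⟨minpoly.ne_zero (Algebra.IsIntegral.isIntegral _), ?_⟩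
  have h1 : Polynomial.aeval (X i) (minpoly K (Ideal.Quotient.mk I (X i))) ∈ I := by
    rw [← Ideal.Quotient.eq_zero_iff_mem, ← minpoly.aeval K (Ideal.Quotient.mk I (X i))]
    exact (Polynomial.aeval_algHom_apply (Ideal.Quotient.mkₐ K I) _ _).symm
  have h2 := ha _ h1
  rwa [← Polynomial.aeval_algHom_apply, aeval_X] at h2

theorem finite_zeros : {a : Fin 2 → K | ∀ i, eval a (q i) = 0}.Finite := by
  have h1 := hq.finite_quotient_span hx 1
  rw [pow_one] at h1
  refine (finite_zeroLocus h1).subset fun a ha f hf => ?_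
  have h2 : Ideal.span (Set.range q) ≤ RingHom.ker (aeval (R := K) a) := by
    rw [Ideal.span_le]
    rintro _ ⟨i, rfl⟩
    exact ha i
  exact h2 hf

end IsAffineSystem

end AffineSystem

/-! ### Splitting finite algebras into localizations -/

section ArtinianSplitting

variable {F A : Type*} [Field F] [CommRing A] [Algebra F A] [Module.Finite F A]

theorem localization_surjective_of_finite (F : Type*) [Field F] [Algebra F A] [Module.Finite F A]
    (M : Submonoid A) : Function.Surjective (algebraMap A (Localization M)) := by
  haveI : IsArtinianRing A := IsArtinianRing.of_finite F A
  exact IsArtinianRing.localization_surjective M _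

theorem finite_localization_of_finite (M : Submonoid A) : Module.Finite F (Localization M) :=
  Module.Finite.of_surjective (IsScalarTower.toAlgHom F A (Localization M)).toLinearMap
    (localization_surjective_of_finite F M)

theorem mem_ker_algebraMap_localization {A : Type*} [CommRing A] (M : Submonoid A) (z : A) :
    z ∈ RingHom.ker (algebraMap A (Localization M)) ↔ ∃ m ∈ M, m * z = 0 := by
  rw [RingHom.mem_ker, IsLocalization.map_eq_zero_iff M]
  exact ⟨fun ⟨m, hm⟩ => ⟨m, m.2, hm⟩, fun ⟨m, hm, h⟩ => ⟨⟨m, hm⟩, h⟩⟩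

/-- The annihilator of `z` is disjoint from `M`, so it extends to a prime ideal disjoint from `M`.
-/
theorem exists_isPrime_of_not_mem_ker {A : Type*} [CommRing A] {M : Submonoid A} {z : A}
    (hz : z ∉ RingHom.ker (algebraMap A (Localization M))) :
    ∃ P : Ideal A, P.IsPrime ∧ Disjoint (M : Set A) P ∧ ∀ a, a * z = 0 → a ∈ P := by
  have h1 : Disjoint ((LinearMap.ker (LinearMap.toSpanSingleton A A z) : Ideal A) : Set A) M := by
    rw [Set.disjoint_left]
    intro a ha ham
    exact hz ((mem_ker_algebraMap_localization M z).mpr ⟨a, ham, by simpa using ha⟩)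
  obtain ⟨P, hP, hle, hd⟩ := Ideal.exists_le_prime_disjoint _ M h1
  exact ⟨P, hP, hd.symm, fun a ha => hle (by simpa using ha)⟩

/-- Over a finite algebra localization maps are surjective, so a localization is determined by its
kernel; the kernel depends only on which primes avoid the multiplicative set. -/
theorem finrank_localization_congr {M N : Submonoid A}
    (h : ∀ P : Ideal A, P.IsPrime → (Disjoint (M : Set A) P ↔ Disjoint (N : Set A) P)) :
    Module.finrank F (Localization M) = Module.finrank F (Localization N) := by
  have hle : ∀ M N : Submonoid A,
      (∀ P : Ideal A, P.IsPrime → (Disjoint (N : Set A) P → Disjoint (M : Set A) P)) →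
      RingHom.ker (algebraMap A (Localization M)) ≤ RingHom.ker (algebraMap A (Localization N)) := by
    intro M N h z hz
    by_contra hcon
    obtain ⟨P, hP, hd, hann⟩ := exists_isPrime_of_not_mem_ker hcon
    obtain ⟨m, hm, hmz⟩ := (mem_ker_algebraMap_localization M z).mp hz
    exact Set.disjoint_left.mp (h P hP hd) hm (hann m hmz)
  have hker := le_antisymm (hle M N fun P hP => (h P hP).mpr) (hle N M fun P hP => (h P hP).mp)
  have e : ∀ M : Submonoid A,
      (A ⧸ RingHom.ker (IsScalarTower.toAlgHom F A (Localization M))) ≃ₐ[F] Localization M :=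
    fun M => Ideal.quotientKerAlgEquivOfSurjective (localization_surjective_of_finite F M)
  rw [← (e M).toLinearEquiv.finrank_eq, ← (e N).toLinearEquiv.finrank_eq]
  exact (Ideal.quotientEquivAlgOfEq F hker).toLinearEquiv.finrank_eq

/-- Chinese remainder theorem for the kernels of the localization maps. A prime containing such a
kernel avoids the corresponding multiplicative set, so uniqueness in `h` makes the kernels pairwise
coprime, while existence makes their intersection zero. -/
theorem finrank_eq_sum_localization {ι : Type*} [Fintype ι] (M : ι → Submonoid A)
    (h : ∀ P : Ideal A, P.IsPrime → ∃! i, Disjoint (M i : Set A) P) :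
    Module.finrank F A = ∑ i, Module.finrank F (Localization (M i)) := by
  have hsurj := fun i => localization_surjective_of_finite F (M i)
  set I : ι → Ideal A := fun i => RingHom.ker (algebraMap A (Localization (M i))) with hI
  have hdisj : ∀ i (P : Ideal A), P.IsPrime → I i ≤ P → Disjoint (M i : Set A) P := by
    intro i P hP hle
    rw [Set.disjoint_left]
    intro m hm hmP
    obtain ⟨u, hu⟩ := IsLocalization.map_units (Localization (M i)) ⟨m, hm⟩
    obtain ⟨a, ha⟩ := hsurj i (↑u⁻¹)
    have h1 : 1 - a * m ∈ I i := by
      rw [hI, RingHom.mem_ker, map_sub, map_mul, ha, map_one, ← hu, Units.inv_mul, sub_self]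
    apply hP.ne_top
    rw [Ideal.eq_top_iff_one, ← sub_add_cancel 1 (a * m)]
    exact add_mem (hle h1) (P.mul_mem_left a hmP)
  have hcop : Pairwise fun i j => IsCoprime (I i) (I j) := by
    intro i j hij
    rw [Ideal.isCoprime_iff_sup_eq]
    by_contra htop
    obtain ⟨P, hP, hle⟩ := Ideal.exists_le_maximal _ htop
    exact hij ((h P hP.isPrime).unique (hdisj i P hP.isPrime (le_sup_left.trans hle))
      (hdisj j P hP.isPrime (le_sup_right.trans hle)))
  let f : A →ₐ[F] ∀ i, Localization (M i) :=
    Pi.algHom F _ fun i => IsScalarTower.toAlgHom F A (Localization (M i))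
  have hf : Function.Bijective f := by
    constructor
    · rw [injective_iff_map_eq_zero]
      intro z hz
      by_contra hz0
      have h1 : z ∉ RingHom.ker (algebraMap A (Localization (⊥ : Submonoid A))) := by
        rw [mem_ker_algebraMap_localization]
        rintro ⟨m, hm, hmz⟩
        rw [Submonoid.mem_bot.mp hm, one_mul] at hmz
        exact hz0 hmz
      obtain ⟨P, hP, -, hann⟩ := exists_isPrime_of_not_mem_ker h1
      obtain ⟨i, hi, -⟩ := h P hP
      obtain ⟨m, hm, hmz⟩ := (mem_ker_algebraMap_localization (M i) z).mp (congrFun hz i)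
      exact Set.disjoint_left.mp hi hm (hann m hmz)
    · intro y
      choose z hz using fun i => hsurj i (y i)
      obtain ⟨w, hw⟩ := Ideal.pi_quotient_surjective hcop fun i => Ideal.Quotient.mk (I i) (z i)
      refine ⟨w, funext fun i => ?_⟩
      have h1 := hw i
      rw [Ideal.Quotient.mk_eq_mk_iff_sub_mem, hI, RingHom.mem_ker, map_sub, sub_eq_zero, hz] at h1
      exact h1
  haveI := fun i => finite_localization_of_finite (F := F) (M i)
  rw [(LinearEquiv.ofBijective f.toLinearMap hf).finrank_eq, Module.finrank_pi_fintype]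

end ArtinianSplitting

/-! ### Local rings of finite plane schemes -/

section PlaneSplitting

variable {F : Type*} [Field F]

theorem finrank_localization_map_primeCompl (J : Ideal (MvPolynomial (Fin 2) F)) (a : Fin 2 → F) :
    Nonempty (Localization (Algebra.algebraMapSubmonoid (MvPolynomial (Fin 2) F ⧸ J)
      (pointIdeal a).primeCompl) ≃ₐ[F] (Localization.AtPrime (pointIdeal a) ⧸
        J.map (algebraMap (MvPolynomial (Fin 2) F) (Localization.AtPrime (pointIdeal a))))) := by
  haveI : IsScalarTower F (MvPolynomial (Fin 2) F ⧸ J) (Localization.AtPrime (pointIdeal a) ⧸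
        J.map (algebraMap (MvPolynomial (Fin 2) F) (Localization.AtPrime (pointIdeal a)))) :=
    IsScalarTower.of_algebraMap_eq (R := F) (S := MvPolynomial (Fin 2) F ⧸ J) fun _ => rfl
  let e := IsLocalization.algEquiv (Algebra.algebraMapSubmonoid (MvPolynomial (Fin 2) F ⧸ J)
    (pointIdeal a).primeCompl) (Localization (Algebra.algebraMapSubmonoid
      (MvPolynomial (Fin 2) F ⧸ J) (pointIdeal a).primeCompl))
    (Localization.AtPrime (pointIdeal a) ⧸
        J.map (algebraMap (MvPolynomial (Fin 2) F) (Localization.AtPrime (pointIdeal a))))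
  exact ⟨e.restrictScalars F⟩

variable [IsAlgClosed F] {J : Ideal (MvPolynomial (Fin 2) F)}
  (hJ : Module.Finite F (MvPolynomial (Fin 2) F ⧸ J))
include hJ

/-- Primes of a finite algebra are maximal, and the Nullstellensatz makes them points. -/
theorem exists_comap_eq_pointIdeal (P : Ideal (MvPolynomial (Fin 2) F ⧸ J)) (hP : P.IsPrime) :
    ∃ τ ∈ zeroLocus F J, P.comap (Ideal.Quotient.mk J) = pointIdeal τ := by
  haveI : IsArtinianRing (MvPolynomial (Fin 2) F ⧸ J) := IsArtinianRing.of_finite F _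
  haveI : P.IsMaximal := hP.isMaximal'
  have h1 : (P.comap (Ideal.Quotient.mk J)).IsMaximal :=
    Ideal.comap_isMaximal_of_surjective _ Ideal.Quotient.mk_surjective
  obtain ⟨τ, hτ⟩ := isMaximal_iff_eq_vanishingIdeal_singleton.mp h1
  have h2 : P.comap (Ideal.Quotient.mk J) = pointIdeal τ := by
    rw [hτ]
    ext f
    rw [mem_vanishingIdeal_singleton_iff]
    rfl
  refine ⟨τ, fun f hf => ?_, h2⟩
  have h3 : f ∈ P.comap (Ideal.Quotient.mk J) := by
    rw [Ideal.mem_comap, Ideal.Quotient.eq_zero_iff_mem.mpr hf]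
    exact zero_mem _
  rw [h2] at h3
  exact h3

omit [IsAlgClosed F] hJ in
theorem disjoint_algebraMapSubmonoid_iff {P : Ideal (MvPolynomial (Fin 2) F ⧸ J)} {τ : Fin 2 → F}
    (h : P.comap (Ideal.Quotient.mk J) = pointIdeal τ) (a : Fin 2 → F) :
    Disjoint (Algebra.algebraMapSubmonoid (MvPolynomial (Fin 2) F ⧸ J)
      (pointIdeal a).primeCompl : Set (MvPolynomial (Fin 2) F ⧸ J)) P ↔ τ = a := by
  have hmem : ∀ f, Ideal.Quotient.mk J f ∈ P ↔ eval τ f = 0 := fun f => by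
    rw [← Ideal.mem_comap, h]
    rfl
  rw [Set.disjoint_left]
  constructor
  · intro hd
    by_contra hne
    obtain ⟨i, hi⟩ := Function.ne_iff.mp hne
    have h1 : (X i - C (τ i) : MvPolynomial (Fin 2) F) ∈ (pointIdeal a).primeCompl := by
      show ¬ eval a _ = 0
      rw [map_sub, eval_X, eval_C, sub_eq_zero]
      exact Ne.symm hi
    refine hd ⟨_, h1, rfl⟩ ((hmem _).mpr ?_)
    rw [map_sub, eval_X, eval_C, sub_self]
  · rintro rfl _ ⟨f, hf, rfl⟩ hfP
    exact hf ((hmem f).mp hfP)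

omit [IsAlgClosed F] hJ in
theorem disjoint_powers_iff {P : Ideal (MvPolynomial (Fin 2) F ⧸ J)} (hP : P.IsPrime)
    {τ : Fin 2 → F} (h : P.comap (Ideal.Quotient.mk J) = pointIdeal τ)
    (s : MvPolynomial (Fin 2) F) :
    Disjoint (Submonoid.powers (Ideal.Quotient.mk J s) : Set (MvPolynomial (Fin 2) F ⧸ J)) P ↔
      eval τ s ≠ 0 := by
  have hmem : Ideal.Quotient.mk J s ∈ P ↔ eval τ s = 0 := by
    rw [← Ideal.mem_comap, h]
    rfl
  rw [ne_eq, ← hmem, Set.disjoint_left]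
  constructor
  · exact fun hd => hd (Submonoid.mem_powers _)
  · rintro hs _ ⟨N, rfl⟩ hN
    exact hs (hP.mem_of_pow_mem N hN)

/-- The length of a finite plane scheme is the sum of the lengths of its local rings at some points
and the length of its part away from these points. -/
theorem finrank_quotient_eq_sum_add {ι : Type*} [Fintype ι] {a : ι → Fin 2 → F}
    (ha : Function.Injective a) {s : MvPolynomial (Fin 2) F} (has : ∀ i, eval (a i) s = 0)
    (hs : ∀ τ ∈ zeroLocus F J, eval τ s ≠ 0 ∨ ∃ i, τ = a i) :
    Module.finrank F (MvPolynomial (Fin 2) F ⧸ J) =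
      (∑ i, Module.finrank F (Localization.AtPrime (pointIdeal (a i)) ⧸
        J.map (algebraMap (MvPolynomial (Fin 2) F) (Localization.AtPrime (pointIdeal (a i)))))) +
      Module.finrank F (Localization.Away (Ideal.Quotient.mk J s)) := by
  let M : Option ι → Submonoid (MvPolynomial (Fin 2) F ⧸ J) := fun o =>
    o.elim (Submonoid.powers (Ideal.Quotient.mk J s)) fun i =>
      Algebra.algebraMapSubmonoid (MvPolynomial (Fin 2) F ⧸ J) (pointIdeal (a i)).primeCompl
  rw [finrank_eq_sum_localization M, Fintype.sum_option, add_comm]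
  · congr 1
    refine Finset.sum_congr rfl fun i _ => ?_
    obtain ⟨e⟩ := finrank_localization_map_primeCompl J (a i)
    exact e.toLinearEquiv.finrank_eq
  · intro P hP
    obtain ⟨τ, hτ, hPτ⟩ := exists_comap_eq_pointIdeal hJ P hP
    have h1 : ∀ i, Disjoint (M (some i) : Set (MvPolynomial (Fin 2) F ⧸ J)) P ↔ τ = a i :=
      fun i => disjoint_algebraMapSubmonoid_iff hPτ (a i)
    have h2 : Disjoint (M none : Set (MvPolynomial (Fin 2) F ⧸ J)) P ↔ eval τ s ≠ 0 :=
      disjoint_powers_iff hP hPτ s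
    rcases hs τ hτ with h3 | ⟨i, rfl⟩
    · refine ⟨none, h2.mpr h3, ?_⟩
      rintro (_ | i) hi
      · rfl
      · exact absurd ((h1 i).mp hi ▸ has i) h3
    · refine ⟨some i, (h1 i).mpr rfl, ?_⟩
      rintro (_ | k) hk
      · exact absurd (has i) (h2.mp hk)
      · rw [ha ((h1 k).mp hk)]

/-- Inverting a function that vanishes at every other point of the scheme isolates the local ring at
`a`. Unlike localization at a prime, this description is compatible with base change. -/
theorem finrank_away_eq_finrank_localization {a : Fin 2 → F} {s : MvPolynomial (Fin 2) F}
    (has : eval a s ≠ 0) (hs : ∀ τ ∈ zeroLocus F J, eval τ s = 0 ∨ τ = a) :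
    Module.finrank F (Localization.Away (Ideal.Quotient.mk J s)) =
      Module.finrank F (Localization.AtPrime (pointIdeal a) ⧸
        J.map (algebraMap (MvPolynomial (Fin 2) F) (Localization.AtPrime (pointIdeal a)))) := by
  obtain ⟨e⟩ := finrank_localization_map_primeCompl J a
  rw [← e.toLinearEquiv.finrank_eq]
  refine finrank_localization_congr fun P hP => ?_
  obtain ⟨τ, hτ, hPτ⟩ := exists_comap_eq_pointIdeal hJ P hP
  rw [disjoint_algebraMapSubmonoid_iff hPτ, disjoint_powers_iff hP hPτ]
  constructor
  · exact fun h => (hs τ hτ).resolve_left h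
  · rintro rfl
    exact has

theorem finite_localization_quotient_map (a : Fin 2 → F) :
    Module.Finite F (Localization.AtPrime (pointIdeal a) ⧸
      J.map (algebraMap (MvPolynomial (Fin 2) F) (Localization.AtPrime (pointIdeal a)))) := by
  obtain ⟨e⟩ := finrank_localization_map_primeCompl J a
  haveI := finite_localization_of_finite (F := F) (Algebra.algebraMapSubmonoid
    (MvPolynomial (Fin 2) F ⧸ J) (pointIdeal a).primeCompl)
  exact Module.Finite.equiv e.toLinearEquiv

end PlaneSplitting

/-! ### The degree formula in the affine chart -/

section AffineDegreeFormula

variable {K : Type*} [Field K]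

variable (K) in
theorem algebraicIndependent_genericCoeff :
    AlgebraicIndependent K fun z : Fin 2 × Fin 4 => genericCoeff K z.1 z.2 := by
  have h1 := (algebraicIndependent_X (Fin 2 × Fin 4) K).map'
    (f := IsScalarTower.toAlgHom K (MvPolynomial (Fin 2 × Fin 4) K)
      (FractionRing (MvPolynomial (Fin 2 × Fin 4) K))) (IsFractionRing.injective _ _)
  exact h1.map' (f := IsScalarTower.toAlgHom K (FractionRing (MvPolynomial (Fin 2 × Fin 4) K))
      (GenericField K)) (algebraMap
    (FractionRing (MvPolynomial (Fin 2 × Fin 4) K)) (GenericField K)).injective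

theorem map_linearSectionIdeal {k L ι σ : Type*} [Field k] [Field L] [Algebra K k] [Algebra K L]
    [Algebra k L] [IsScalarTower K k L] [Fintype ι] (x : Fin 2 × ι → k)
    (q : ι → MvPolynomial σ K) : (linearSectionIdeal x q).map (map (algebraMap k L)) =
      linearSectionIdeal (fun z => algebraMap k L (x z)) q := by
  rw [linearSectionIdeal, linearSectionIdeal, Ideal.map_span, ← Set.range_comp]
  congr 2
  funext k
  simp only [Function.comp_apply, map_sum, map_mul, map_C, map_map,
    ← IsScalarTower.algebraMap_eq]

theorem aeval_algebraMap_comp {F σ : Type*} [Field F] [Algebra K F] (a : σ → K)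
    (f : MvPolynomial σ K) :
    aeval (fun i => algebraMap K F (a i)) f = algebraMap K F (eval a f) := by
  rw [← coe_aeval_eq_eval]
  exact aeval_algebraMap_apply F a f

theorem eval_map_algebraMap_comp {F σ : Type*} [Field F] [Algebra K F] (a : σ → K)
    (f : MvPolynomial σ K) :
    eval (fun i => algebraMap K F (a i)) (map (algebraMap K F) f) = algebraMap K F (eval a f) := by
  rw [eval_map, ← aeval_def, aeval_algebraMap_comp]

variable [IsAlgClosed K] {n : ℕ}

/-- The dichotomy for a common zero of two generic members: if some `q i` is non-zero there, the
point is generic and `q j` is non-zero too; otherwise it is a base point and is defined over `K`. -/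
theorem IsAffineSystem.sq_eq_finsum_add_finrank_away {F ι : Type*} [Field F] [IsAlgClosed F]
    [Algebra K F] [Fintype ι] {x : Fin 2 × ι → F} (hx : AlgebraicIndependent K x)
    {q : ι → MvPolynomial (Fin 2) K} (hq : IsAffineSystem q n) {j : ι} (hj : q j ≠ 0) :
    n ^ 2 = (∑ᶠ a ∈ {a : Fin 2 → K | ∀ i, eval a (q i) = 0}, Module.finrank F
      (Localization.AtPrime (pointIdeal fun i => algebraMap K F (a i)) ⧸
        (linearSectionIdeal x q).map (algebraMap (MvPolynomial (Fin 2) F)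
          (Localization.AtPrime (pointIdeal fun i => algebraMap K F (a i)))))) +
      Module.finrank F (Localization.Away (Ideal.Quotient.mk (linearSectionIdeal x q)
        (map (algebraMap K F) (q j)))) := by
  obtain ⟨hfin, hrank⟩ := hq.finrank_quotient_linearSectionIdeal hx
  rw [← hrank]
  set V := {a : Fin 2 → K | ∀ i, eval a (q i) = 0} with hV
  haveI : Fintype V := (hq.finite_zeros hx).fintype
  rw [← finsum_set_coe_eq_finsum_mem, finsum_eq_sum_of_fintype]
  refine finrank_quotient_eq_sum_add hfin (a := fun a : V => fun i => algebraMap K F (a.1 i))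
    ?_ ?_ ?_
  · intro a b hab
    exact Subtype.ext (funext fun i => (algebraMap K F).injective (congrFun hab i))
  · intro a
    rw [eval_map_algebraMap_comp, a.2 j, map_zero]
  · intro τ hτ
    by_cases hb : ∃ i, aeval τ (q i) ≠ 0
    · left
      obtain ⟨i, hi⟩ := hb
      have h1 : AlgebraicIndependent K τ := algebraicIndependent_of_mem_linearSection hx (fun k =>
        hτ _ (Ideal.subset_span ⟨k, rfl⟩)) hi
      rw [eval_map, ← aeval_def]
      exact fun h0 => hj ((algebraicIndependent_iff.mp h1) _ h0)
    · right
      push Not at hb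
      have h1 := hq.finite_quotient_span hx 1
      rw [pow_one] at h1
      obtain ⟨a, rfl⟩ := IsAffineSystem.exists_eq_algebraMap h1 (τ := τ) fun f hf => by
        have h2 : Ideal.span (Set.range q) ≤ RingHom.ker (aeval (R := K) τ) := by
          rw [Ideal.span_le]
          rintro _ ⟨i, rfl⟩
          exact hb i
        exact h2 hf
      refine ⟨⟨a, fun i => ?_⟩, rfl⟩
      have h2 := hb i
      rwa [aeval_algebraMap_comp, map_eq_zero] at h2

variable {q : Fin 4 → MvPolynomial (Fin 2) K}

/-- The square of the degree of a linear system is the sum of the multiplicities of its base points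
and of the number of variable intersections. -/
theorem IsAffineSystem.sq_eq_finsum_add (hq : IsAffineSystem q n) {j : Fin 4} (hj : q j ≠ 0)
    {G : MvPolynomial (Fin 4) K} {D : ℕ} (hG : G.IsHomogeneous D) (hirr : Irreducible G)
    (hGq : ∀ N H, H.IsHomogeneous N → (aeval q H = 0 ↔ G ∣ H)) :
    Module.Finite (ratioField q j) (FractionRing (MvPolynomial (Fin 2) K)) ∧
    n ^ 2 = (∑ᶠ a ∈ {a : Fin 2 → K | ∀ i, eval a (q i) = 0}, Module.finrank (GenericField K)
      (Localization.AtPrime (pointIdeal fun i => algebraMap K (GenericField K) (a i)) ⧸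
        (linearSectionIdeal (fun z => genericCoeff K z.1 z.2) q).map
          (algebraMap (MvPolynomial (Fin 2) (GenericField K)) (Localization.AtPrime
            (pointIdeal fun i => algebraMap K (GenericField K) (a i)))))) +
      D * Module.finrank (ratioField q j) (FractionRing (MvPolynomial (Fin 2) K)) := by
  have hx := algebraicIndependent_genericCoeff K
  -- The part away from the base points is computed over the rational function field, where it is a
  -- field, while Bézout's theorem was applied over the algebraic closure.
  have haway := finrank_away_quotient_map (L := GenericField K)
    (linearSectionIdeal (fun z => algebraMap (MvPolynomial (Fin 2 × Fin 4) K)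
          (FractionRing (MvPolynomial (Fin 2 × Fin 4) K)) (X z)) q) (map (algebraMap K _) (q j))
  rw [map_linearSectionIdeal, map_map, ← IsScalarTower.algebraMap_eq] at haway
  have hfin := (hq.finrank_quotient_linearSectionIdeal hx).1
  obtain ⟨hfinQ, hD⟩ := finrank_away_linearSectionIdeal hj hG hirr hGq
    (haway.2.mp (@finite_localization_of_finite _ _ _ _ _ hfin _))
  refine ⟨hfinQ, ?_⟩
  rw [← hD, ← haway.1]
  exact hq.sq_eq_finsum_add_finrank_away hx hj

end AffineDegreeFormula

/-! ### Colengths of powers of an ideal generated by a regular sequence -/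

section RegularPair

variable {L R : Type*} [Field L] [CommRing R] [Algebra L R]

/-- Multiplication by `w` gives a short exact sequence `0 → R ⧸ 𝔞 → R ⧸ 𝔟 → R ⧸ (𝔟 ⊔ (w)) → 0`, as
`𝔞` is the colon ideal of `𝔟` by `w`. -/
theorem finrank_quotient_of_colon {𝔞 𝔟 : Ideal R} {w : R} (h : ∀ y, w * y ∈ 𝔟 ↔ y ∈ 𝔞)
    (h𝔞 : Module.Finite L (R ⧸ 𝔞)) (hw : Module.Finite L (R ⧸ 𝔟 ⊔ Ideal.span {w})) :
    Module.Finite L (R ⧸ 𝔟) ∧ Module.finrank L (R ⧸ 𝔟) =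
      Module.finrank L (R ⧸ 𝔞) + Module.finrank L (R ⧸ 𝔟 ⊔ Ideal.span {w}) := by
  let f : (R ⧸ 𝔞) →ₗ[R] (R ⧸ 𝔟) := Submodule.mapQ 𝔞 𝔟 (LinearMap.mulLeft R w) fun y hy => (h y).mpr hy
  let g : (R ⧸ 𝔟) →ₗ[R] (R ⧸ 𝔟 ⊔ Ideal.span {w}) := Submodule.factor le_sup_left
  have hf : Function.Injective f := by
    rw [← LinearMap.ker_eq_bot, LinearMap.ker_eq_bot']
    intro y hy
    obtain ⟨y, rfl⟩ := Ideal.Quotient.mk_surjective y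
    exact Ideal.Quotient.eq_zero_iff_mem.mpr
      ((h y).mp (Ideal.Quotient.eq_zero_iff_mem.mp hy))
  have hg : Function.Surjective g := Ideal.Quotient.factor_surjective le_sup_left
  have hex : LinearMap.ker g = LinearMap.range f := by
    ext y
    obtain ⟨y, rfl⟩ := Ideal.Quotient.mk_surjective y
    rw [LinearMap.mem_ker, LinearMap.mem_range]
    constructor
    · intro hy
      have hy' : y ∈ 𝔟 ⊔ Ideal.span {w} := Ideal.Quotient.eq_zero_iff_mem.mp hy
      obtain ⟨b, hb, c, hc, rfl⟩ := Submodule.mem_sup.mp hy'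
      obtain ⟨z, rfl⟩ := Ideal.mem_span_singleton.mp hc
      refine ⟨Ideal.Quotient.mk 𝔞 z, ?_⟩
      show Ideal.Quotient.mk 𝔟 (w * z) = _
      rw [Ideal.Quotient.mk_eq_mk_iff_sub_mem]
      simpa using hb
    · rintro ⟨z, hz⟩
      obtain ⟨z, rfl⟩ := Ideal.Quotient.mk_surjective z
      rw [← hz]
      exact Ideal.Quotient.eq_zero_iff_mem.mpr
        (Ideal.mem_sup_right (Ideal.mul_mem_right _ _ (Ideal.mem_span_singleton_self w)))
  let f' := f.restrictScalars L
  let g' := g.restrictScalars L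
  have hex' : LinearMap.ker g' = LinearMap.range f' := by
    ext y
    exact SetLike.ext_iff.mp hex y
  haveI : Module.Finite L (LinearMap.ker g') := by
    rw [hex']
    infer_instance
  haveI : Module.Finite L (LinearMap.range g') := inferInstance
  haveI : Module.Finite L ((R ⧸ 𝔟) ⧸ LinearMap.ker g') :=
    Module.Finite.equiv g'.quotKerEquivRange.symm
  haveI hfin : Module.Finite L (R ⧸ 𝔟) := Module.Finite.of_submodule_quotient (LinearMap.ker g')
  refine ⟨hfin, ?_⟩
  rw [← LinearMap.finrank_range_add_finrank_ker g', hex',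
    LinearMap.finrank_range_of_inj (f := f') hf, (LinearMap.range_eq_top.mpr hg : LinearMap.range g' = ⊤), finrank_top, add_comm]

theorem span_pair_pow_succ (w₀ w₁ : R) (d : ℕ) :
    Ideal.span {w₀, w₁} ^ (d + 1) =
      Ideal.span {w₀} * Ideal.span {w₀, w₁} ^ d ⊔ Ideal.span {w₁ ^ (d + 1)} := by
  induction d with
  | zero => rw [zero_add, pow_one, pow_one, pow_zero, mul_one, ← Ideal.span_insert]
  | succ d ih =>
    refine le_antisymm ?_ (sup_le ?_ ?_)
    · conv_lhs => rw [pow_succ', Ideal.span_insert, Ideal.sup_mul, ← Ideal.span_insert]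
      refine sup_le le_sup_left ?_
      rw [ih, Ideal.mul_sup, Ideal.span_singleton_mul_span_singleton, ← pow_succ', ← ih]
      refine sup_le ?_ le_sup_right
      refine le_trans ?_ le_sup_left
      rw [mul_left_comm]
      refine Ideal.mul_mono_right ?_
      rw [pow_succ']
      exact Ideal.mul_mono_left (Ideal.span_mono (by simp))
    · rw [pow_succ' _ (d + 1)]
      exact Ideal.mul_mono_left (Ideal.span_mono (by simp))
    · rw [Ideal.span_singleton_le_iff_mem]
      exact Ideal.pow_mem_pow (Ideal.subset_span (by simp)) _

variable {w₀ w₁ : R} (h₀ : ∀ y, w₀ * y = 0 → y = 0) (h₁ : ∀ y, w₀ ∣ w₁ * y → w₀ ∣ y)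
  (hfin : Module.Finite L (R ⧸ Ideal.span {w₀, w₁}))
include h₁ hfin

/-- By regularity the colon ideal of `(w₀, w₁ ^ (d + 1))` by `w₁` is `(w₀, w₁ ^ d)`, so each step
adds the colength of `(w₀, w₁)`. -/
theorem finrank_quotient_span_pow_right (d : ℕ) :
    Module.Finite L (R ⧸ Ideal.span {w₀, w₁ ^ d}) ∧
      Module.finrank L (R ⧸ Ideal.span {w₀, w₁ ^ d}) =
        d * Module.finrank L (R ⧸ Ideal.span {w₀, w₁}) := by
  induction d with
  | zero =>
    have h : Ideal.span {w₀, w₁ ^ 0} = ⊤ := by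
      rw [Ideal.eq_top_iff_one]
      exact Ideal.subset_span (by simp)
    haveI : Subsingleton (R ⧸ Ideal.span {w₀, w₁ ^ 0}) := Ideal.Quotient.subsingleton_iff.mpr h
    exact ⟨inferInstance, by rw [Module.finrank_zero_of_subsingleton, zero_mul]⟩
  | succ d ih =>
    have hsup : Ideal.span {w₀, w₁ ^ (d + 1)} ⊔ Ideal.span {w₁} = Ideal.span {w₀, w₁} := by
      rw [Ideal.span_insert, Ideal.span_insert, sup_assoc]
      congr 1
      exact sup_eq_right.mpr (Ideal.span_singleton_le_span_singleton.mpr (dvd_pow_self _ (by simp)))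
    have := finrank_quotient_of_colon (L := L) (𝔞 := Ideal.span {w₀, w₁ ^ d})
      (𝔟 := Ideal.span {w₀, w₁ ^ (d + 1)}) (w := w₁) (fun y => ?_) ih.1 (by rwa [hsup])
    · refine ⟨this.1, ?_⟩
      rw [this.2, hsup, ih.2, add_mul, one_mul]
    · rw [Ideal.mem_span_pair, Ideal.mem_span_pair]
      constructor
      · rintro ⟨a, b, hab⟩
        obtain ⟨c, hc⟩ := h₁ (y - b * w₁ ^ d) ⟨a, by linear_combination -hab⟩
        exact ⟨c, b, by linear_combination -hc⟩
      · rintro ⟨a, b, rfl⟩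
        exact ⟨w₁ * a, b, by ring⟩

include h₀

/-- Colengths of the powers of an ideal generated by a regular sequence of length two. -/
theorem finrank_quotient_span_pair_pow (d : ℕ) :
    Module.Finite L (R ⧸ Ideal.span {w₀, w₁} ^ d) ∧
      2 * Module.finrank L (R ⧸ Ideal.span {w₀, w₁} ^ d) =
        d * (d + 1) * Module.finrank L (R ⧸ Ideal.span {w₀, w₁}) := by
  induction d with
  | zero =>
    haveI : Subsingleton (R ⧸ Ideal.span {w₀, w₁} ^ 0) :=
      Ideal.Quotient.subsingleton_iff.mpr (by rw [pow_zero, Ideal.one_eq_top])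
    exact ⟨inferInstance, by rw [Module.finrank_zero_of_subsingleton]; ring⟩
  | succ d ih =>
    have hw : w₁ ^ (d + 1) ∈ Ideal.span {w₀, w₁} ^ d :=
      Ideal.pow_le_pow_right d.le_succ (Ideal.pow_mem_pow (Ideal.subset_span (by simp)) _)
    have hsup : Ideal.span {w₀, w₁} ^ (d + 1) ⊔ Ideal.span {w₀} =
        Ideal.span {w₀, w₁ ^ (d + 1)} := by
      rw [span_pair_pow_succ, Ideal.span_insert w₀ {w₁ ^ (d + 1)}, sup_right_comm,
        sup_eq_right.mpr (Ideal.mul_le_left : Ideal.span {w₀} * _ ≤ _), ← Ideal.span_insert]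
    have h2 := finrank_quotient_span_pow_right h₁ hfin (d + 1)
    -- The colon ideal of the power `d + 1` by `w₀` is the power `d`, and adding `w₀` to the power
    -- `d + 1` leaves `(w₀, w₁ ^ (d + 1))`, of colength `d + 1` times that of the pair.
    have := finrank_quotient_of_colon (L := L) (𝔞 := Ideal.span {w₀, w₁} ^ d)
      (𝔟 := Ideal.span {w₀, w₁} ^ (d + 1)) (w := w₀) (fun y => ?_) ih.1 (by rw [hsup]; exact h2.1)
    · refine ⟨this.1, ?_⟩
      rw [this.2, hsup, h2.2, mul_add, ih.2]
      ring
    · constructor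
      · intro hy
        rw [span_pair_pow_succ, Submodule.mem_sup] at hy
        obtain ⟨b, hb, c, hc, hbc⟩ := hy
        obtain ⟨z, hz, rfl⟩ := Ideal.mem_span_singleton_mul.mp hb
        obtain ⟨v, rfl⟩ := Ideal.mem_span_singleton.mp hc
        have h3 : ∀ m v, w₀ ∣ w₁ ^ m * v → w₀ ∣ v := by
          intro m
          induction m with
          | zero => simp
          | succ m ihm => exact fun v hv => ihm v (h₁ _ (by rwa [pow_succ', mul_assoc] at hv))
        -- From `w₀ * y = w₀ * z + w₁ ^ (d + 1) * v` regularity gives `w₀ ∣ v`; then `w₀` can be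
        -- cancelled.
        obtain ⟨v', rfl⟩ := h3 (d + 1) v ⟨y - z, by linear_combination hbc⟩
        have h4 : y = z + w₁ ^ (d + 1) * v' := by
          rw [← sub_eq_zero]
          exact h₀ _ (by linear_combination -hbc)
        rw [h4]
        exact add_mem hz (Ideal.mul_mem_right _ _ hw)
      · intro hy
        rw [pow_succ']
        exact Ideal.mul_mem_mul (Ideal.subset_span (by simp)) hy

end RegularPair

/-! ### Limits of quadratically bounded functions -/

section Squeeze

/-- Bounded shifts of the argument do not affect the leading term. Both bounds are compared with
squares of `d ± (r + 3)`, where `r + 3` is large enough for the shift `r` and the linear terms. -/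
theorem tendsto_of_quadratic_bounds {h : ℕ → ℕ} {e r : ℕ} (hle : ∀ d, 2 * h d ≤ d * (d + 1) * e)
    (hge : ∀ d, d * (d + 1) * e ≤ 2 * h (d + r)) :
    Filter.Tendsto (fun d : ℕ => 2 * (h (d + 1) : ℝ) / (d : ℝ) ^ 2) Filter.atTop
      (nhds (e : ℝ)) := by
  have h1 : Filter.Tendsto (fun d : ℕ => (r + 3 : ℝ) / (d : ℝ)) Filter.atTop (nhds 0) :=
    tendsto_const_div_atTop_nhds_zero_nat _
  have h2 : Filter.Tendsto (fun d : ℕ => (1 - (r + 3 : ℝ) / (d : ℝ)) ^ 2 * e) Filter.atTop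
      (nhds (e : ℝ)) := by
    have := ((h1.const_sub 1).pow 2).mul_const (e : ℝ)
    simpa using this
  have h3 : Filter.Tendsto (fun d : ℕ => (1 + (r + 3 : ℝ) / (d : ℝ)) ^ 2 * e) Filter.atTop
      (nhds (e : ℝ)) := by
    have := ((h1.const_add 1).pow 2).mul_const (e : ℝ)
    simpa using this
  refine tendsto_of_tendsto_of_tendsto_of_le_of_le' h2 h3 ?_ ?_
  · filter_upwards [Filter.eventually_ge_atTop (r + 3)] with d hd
    obtain ⟨m, rfl⟩ := Nat.exists_eq_add_of_le hd
    have h4 : ((m + 4 : ℕ) : ℝ) * ((m + 4 : ℕ) + 1) * e ≤ 2 * h (r + 3 + m + 1) := by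
      have := hge (m + 4)
      rw [show m + 4 + r = r + 3 + m + 1 by ring] at this
      exact_mod_cast this
    have h5 : (0 : ℝ) < ((r + 3 + m : ℕ) : ℝ) := by positivity
    rw [le_div_iff₀ (by positivity)]
    have h6 : (1 - (r + 3 : ℝ) / ((r + 3 + m : ℕ) : ℝ)) ^ 2 * e * ((r + 3 + m : ℕ) : ℝ) ^ 2 =
        (m : ℝ) ^ 2 * e := by
      field_simp
      push_cast
      ring
    rw [h6]
    refine le_trans ?_ h4
    push_cast
    gcongr
    nlinarith [(Nat.cast_nonneg m : (0 : ℝ) ≤ m)]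
  · filter_upwards [Filter.eventually_ge_atTop 1] with d hd
    have h4 : 2 * (h (d + 1) : ℝ) ≤ ((d + 1 : ℕ) : ℝ) * ((d + 1 : ℕ) + 1) * e := by
      exact_mod_cast hle (d + 1)
    have h5 : (0 : ℝ) < (d : ℝ) := by exact_mod_cast hd
    rw [div_le_iff₀ (by positivity)]
    have h6 : (1 + (r + 3 : ℝ) / (d : ℝ)) ^ 2 * e * (d : ℝ) ^ 2 = ((d : ℝ) + r + 3) ^ 2 * e := by
      field_simp
      ring
    rw [h6]
    refine h4.trans ?_
    push_cast
    gcongr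
    nlinarith [(Nat.cast_nonneg r : (0 : ℝ) ≤ r)]

end Squeeze

/-! ### Homogeneous relations from transcendence degree -/

section AlgebraicRelation

variable {K : Type*} [Field K]

theorem aeval_mem_span_pow {R A ι : Type*} [CommRing R] [CommRing A] [Algebra R A] [Fintype ι]
    {c : MvPolynomial ι R} {r : ℕ} (hc : c.IsHomogeneous r) (f : ι → A) :
    aeval f c ∈ Ideal.span (Set.range f) ^ r := by
  rw [aeval_def, eval₂_eq']
  refine sum_mem fun d hd => Ideal.mul_mem_left _ _ ?_
  have h1 : d.degree = r := by
    rw [Finsupp.degree_eq_weight_one]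
    exact hc (mem_support_iff.mp hd)
  rw [← h1, Finsupp.degree_eq_sum]
  have h2 : ∀ s : Finset ι, ∏ i ∈ s, f i ^ d i ∈ Ideal.span (Set.range f) ^ ∑ i ∈ s, d i := by
    classical
    intro s
    induction s using Finset.induction_on with
    | empty => simp
    | insert i s hi ih =>
      rw [Finset.prod_insert hi, Finset.sum_insert hi, pow_add]
      exact Ideal.mul_mem_mul (Ideal.pow_mem_pow (Ideal.subset_span (Set.mem_range_self i)) _) ih
  exact h2 _

theorem coeff_aeval_X_mul_C {R A ι : Type*} [CommRing R] [CommRing A] [Algebra R A] [Fintype ι]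
    (f : ι → A) (g : MvPolynomial ι R) (r : ℕ) :
    (aeval (fun i => Polynomial.X * Polynomial.C (f i)) g).coeff r =
      aeval f (homogeneousComponent r g) := by
  have h1 : ∀ h : MvPolynomial ι R, aeval (fun i => Polynomial.C (f i)) h =
      Polynomial.C (aeval f h) := fun h => aeval_algebraMap_apply (Polynomial A) f h
  conv_lhs => rw [← sum_homogeneousComponent g]
  rw [map_sum, Polynomial.finsetSum_coeff]
  simp only [aeval_mul_of_isHomogeneous (homogeneousComponent_isHomogeneous _ g), h1,
    mul_comm (Polynomial.X ^ _), Polynomial.coeff_C_mul_X_pow]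
  rw [Finset.sum_ite_eq]
  split_ifs with h
  · rfl
  · rw [homogeneousComponent_eq_zero _ _ (by simpa [Nat.lt_succ_iff] using h), map_zero]

/-- A relation in a graded polynomial ring, divided by a power of the variable. -/
theorem exists_isHomogeneous_of_eval₂_eq_zero {R A ι : Type*} [CommRing R] [CommRing A] [IsDomain A]
    [Algebra R A] [Fintype ι] {f : ι → A} {u : A} (hu : u ≠ 0) {r : ℕ}
    (P : Polynomial (MvPolynomial ι R)) (hP : P ≠ 0) (hr : ∀ s, (P.coeff s).IsHomogeneous r)
    (h0 : P.eval₂ (aeval f : MvPolynomial ι R →ₐ[R] A) u = 0) :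
    ∃ c : MvPolynomial ι R, c ≠ 0 ∧ c.IsHomogeneous r ∧
      ∃ e ∈ Ideal.span (Set.range f) ^ r, aeval f c = u * e := by
  induction hN : P.natDegree using Nat.strong_induction_on generalizing P with
  | _ N ih =>
    have h1 := Polynomial.divX_mul_X_add P
    have h2 := congrArg (Polynomial.eval₂ (aeval f : MvPolynomial ι R →ₐ[R] A).toRingHom u) h1
    rw [Polynomial.eval₂_add, Polynomial.eval₂_mul, Polynomial.eval₂_X, Polynomial.eval₂_C] at h2
    have h0' : P.eval₂ (aeval f : MvPolynomial ι R →ₐ[R] A).toRingHom u = 0 := h0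
    rw [h0'] at h2
    -- A vanishing constant coefficient lets one factor `u` be cancelled; otherwise the constant
    -- coefficient is the required form, the remaining terms being divisible by `u`.
    by_cases hc : P.coeff 0 = 0
    · rw [hc, map_zero, add_zero] at h1 h2
      have hd : P.divX ≠ 0 := by
        intro h
        rw [h, zero_mul] at h1
        exact hP h1.symm
      refine ih P.divX.natDegree ?_ P.divX hd (fun s => ?_) ?_ rfl
      · have : P.natDegree ≠ 0 := by
          intro h
          rw [Polynomial.eq_C_of_natDegree_eq_zero h, hc, map_zero] at hP
          exact hP rfl
        rw [Polynomial.natDegree_divX_eq_natDegree_tsub_one]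
        omega
      · rw [Polynomial.coeff_divX]
        exact hr _
      · exact (mul_eq_zero.mp h2).resolve_right hu
    · refine ⟨P.coeff 0, hc, hr 0, -(P.divX.eval₂ (aeval f : MvPolynomial ι R →ₐ[R] A).toRingHom u),
        neg_mem ?_, ?_⟩
      · rw [Polynomial.eval₂_eq_sum_range]
        refine sum_mem fun s _ => Ideal.mul_mem_right _ _ (aeval_mem_span_pow ?_ f)
        rw [Polynomial.coeff_divX]
        exact hr _
      · have h3 : aeval f (P.coeff 0) = (aeval f : MvPolynomial ι R →ₐ[R] A).toRingHom (P.coeff 0) :=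
          rfl
        rw [h3]
        linear_combination h2

/-- The four elements `u` and `X * f i` lie in a polynomial ring in three variables over `K`, so
they are algebraically dependent. Grading by `X` makes the relation homogeneous in the `f i`. If `u`
vanishes at a point, then `c` is a relation in the fibre cone there, so three generators never have
independent images. -/
theorem exists_isHomogeneous_aeval_eq_mul (f : Fin 3 → MvPolynomial (Fin 2) K)
    {u : MvPolynomial (Fin 2) K} (hu : u ≠ 0) :
    ∃ r, ∃ c : MvPolynomial (Fin 3) K, c ≠ 0 ∧ c.IsHomogeneous r ∧
      ∃ e ∈ Ideal.span (Set.range f) ^ r, aeval f c = u * e := by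
  let z : Option (Fin 3) → Polynomial (MvPolynomial (Fin 2) K) :=
    fun o => o.elim (Polynomial.C u) fun i => Polynomial.X * Polynomial.C (f i)
  have hz : ¬ AlgebraicIndependent K z := by
    intro hz
    have h1 := (hz.map' (f := (optionEquivLeft K (Fin 2)).symm.toAlgHom)
      (optionEquivLeft K (Fin 2)).symm.injective).lift_cardinalMk_le_trdeg
    rw [MvPolynomial.trdeg_of_isDomain] at h1
    simp at h1
    norm_cast at h1
  rw [algebraicIndependent_iff] at hz
  push Not at hz
  obtain ⟨Ψ, hΨ, hΨ0⟩ := hz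
  set P := optionEquivLeft K (Fin 3) Ψ with hP
  have hP0 : P ≠ 0 := by simpa [hP] using hΨ0
  have h1 : P.eval₂ (aeval fun i => Polynomial.X * Polynomial.C (f i) :
      MvPolynomial (Fin 3) K →ₐ[K] Polynomial (MvPolynomial (Fin 2) K)).toRingHom
      (Polynomial.C u) = 0 := by
    have h2 : ((Polynomial.eval₂RingHom (aeval fun i => Polynomial.X * Polynomial.C (f i) :
        MvPolynomial (Fin 3) K →ₐ[K] Polynomial (MvPolynomial (Fin 2) K)).toRingHom
        (Polynomial.C u)).comp (optionEquivLeft K (Fin 3)).toRingHom) = (aeval z).toRingHom := by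
      apply MvPolynomial.ringHom_ext
      · intro c
        simp [MvPolynomial.algebraMap_eq]
      · rintro (_ | i) <;> simp [z]
    exact (congrFun (congrArg DFunLike.coe h2) Ψ).trans hΨ
  obtain ⟨s, hs⟩ : ∃ s, P.coeff s ≠ 0 := by
    by_contra! hcon
    exact hP0 (Polynomial.ext fun s => by simp [hcon s])
  obtain ⟨r, hr⟩ : ∃ r, homogeneousComponent r (P.coeff s) ≠ 0 := by
    by_contra! hcon
    apply hs
    rw [← sum_homogeneousComponent (P.coeff s)]
    exact Finset.sum_eq_zero fun r _ => hcon r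
  -- The part of the relation of degree `r` in the `f i`; evaluated at `f` and `u` it is the
  -- coefficient of `X ^ r`, so it is a relation by itself.
  let P' : Polynomial (MvPolynomial (Fin 3) K) := ∑ s ∈ Finset.range (P.natDegree + 1),
    Polynomial.monomial s (homogeneousComponent r (P.coeff s))
  have hP' : ∀ s, P'.coeff s = homogeneousComponent r (P.coeff s) := by
    intro s
    simp only [P', Polynomial.finsetSum_coeff, Polynomial.coeff_monomial, Finset.sum_ite_eq']
    split_ifs with h
    · rfl
    · rw [Polynomial.coeff_eq_zero_of_natDegree_lt (by simpa [Nat.lt_succ_iff] using h), map_zero]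
  refine ⟨r, exists_isHomogeneous_of_eval₂_eq_zero hu P' (fun h => ?_) (fun s => ?_) ?_⟩
  · have := hP' s
    rw [h, Polynomial.coeff_zero] at this
    exact hr this.symm
  · rw [hP']
    exact homogeneousComponent_isHomogeneous _ _
  · have h2 := congrArg (fun p => Polynomial.coeff p r) h1
    simp only [Polynomial.eval₂_eq_sum_range, Polynomial.finsetSum_coeff, Polynomial.coeff_zero,
      ← Polynomial.C_pow, Polynomial.coeff_mul_C] at h2
    show Polynomial.eval₂ (aeval f : MvPolynomial (Fin 3) K →ₐ[K] _).toRingHom u P' = 0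
    simp only [P', Polynomial.eval₂_finset_sum, Polynomial.eval₂_monomial]
    rw [← h2]
    refine Finset.sum_congr rfl fun s _ => ?_
    congr 1
    exact (coeff_aeval_X_mul_C f _ _).symm

/-- A non-zero form does not vanish at a point with algebraically independent affine coordinates. -/
theorem aeval_ne_zero_of_algebraicIndependent [Infinite K] {F : Type*} [Field F] [Algebra K F]
    {s t : F} (h : AlgebraicIndependent K ![s, t]) {c : MvPolynomial (Fin 3) K} (hc : c ≠ 0)
    {r : ℕ} (hr : c.IsHomogeneous r) : aeval ![1, s, t] c ≠ 0 := by
  intro h0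
  have h1 : aeval ![s, t] (aeval ![1, X 0, X 1] c : MvPolynomial (Fin 2) K) = 0 := by
    rw [← h0, ← AlgHom.comp_apply]
    congr 1
    ext i
    fin_cases i <;> simp
  have h2 := (algebraicIndependent_iff.mp h) _ h1
  -- The factor `X 0` restricts the check to points with non-zero first coordinate, where
  -- dehomogenization applies.
  have h3 : X 0 * c = 0 := by
    refine MvPolynomial.funext fun τ => ?_
    rw [map_mul, eval_X, map_zero]
    by_cases hτ : τ 0 = 0
    · rw [hτ, zero_mul]
    · have h4 := congrArg (eval ![τ 1 / τ 0, τ 2 / τ 0]) h2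
      have h5 : ((eval ![τ 1 / τ 0, τ 2 / τ 0]).comp
          (aeval ![1, X 0, X 1] : MvPolynomial (Fin 3) K →ₐ[K] MvPolynomial (Fin 2) K).toRingHom) =
          eval fun i => (τ 0)⁻¹ * τ i := by
        apply MvPolynomial.ringHom_ext
        · intro c
          simp
        · intro i
          fin_cases i <;> simp [hτ, div_eq_inv_mul]
      have h6 : eval (fun i => (τ 0)⁻¹ * τ i) c = 0 := by
        rw [← h5, ← map_zero (eval ![τ 1 / τ 0, τ 2 / τ 0]), ← h2]
        rfl
      rw [← coe_aeval_eq_eval, RingHom.coe_coe, aeval_mul_of_isHomogeneous hr] at h6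
      rw [← coe_aeval_eq_eval, RingHom.coe_coe,
        (mul_eq_zero.mp h6).resolve_left (pow_ne_zero _ (inv_ne_zero hτ)), mul_zero]
  exact hc ((mul_eq_zero.mp h3).resolve_left (X_ne_zero 0))

end AlgebraicRelation

/-! ### Fibre cones and reductions -/

section FiberCone

variable {F R ι : Type*} [Field F] [CommRing R] [Algebra F R]

theorem homogeneousComponent_X_mul {F ι : Type*} [CommSemiring F] (i : ι) (H : MvPolynomial ι F)
    (r : ℕ) : homogeneousComponent (r + 1) (X i * H) = X i * homogeneousComponent r H := by
  classical
  ext d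
  rw [coeff_homogeneousComponent, coeff_X_mul', coeff_X_mul', coeff_homogeneousComponent]
  by_cases hi : i ∈ d.support
  · rw [if_pos hi, if_pos hi]
    have h1 : d = (d - Finsupp.single i 1) + Finsupp.single i 1 := by
      ext k
      by_cases hk : i = k
      · subst hk
        have : d i ≠ 0 := Finsupp.mem_support_iff.mp hi
        simp
        omega
      · simp [Finsupp.single_apply, hk]
    have h2 : d.degree = (d - Finsupp.single i 1).degree + 1 := by
      conv_lhs => rw [h1]
      simp [Finsupp.degree_single]
    simp [h2]
  · simp [hi]

theorem homogeneousComponent_zero_X_mul {F ι : Type*} [CommSemiring F] (i : ι)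
    (H : MvPolynomial ι F) : homogeneousComponent 0 (X i * H) = 0 := by
  classical
  rw [homogeneousComponent_zero, coeff_X_mul', if_neg (by simp), map_zero]

/-- The ideals in which the forms of a given degree are tested in `fiberConeIdeal`. -/
def fiberConeFiltration (I J m : Ideal R) : ℕ → Ideal R
  | 0 => m
  | r + 1 => J * I ^ r ⊔ m * I ^ (r + 1)

/-- The polynomials all of whose homogeneous components vanish in the fibre cone of
`I = (Q i)` modulo `J`. -/
def fiberConeIdeal (Q : ι → R) (J m : Ideal R) : Ideal (MvPolynomial ι F) where
  carrier := {H | ∀ r, aeval Q (homogeneousComponent r H) ∈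
    fiberConeFiltration (Ideal.span (Set.range Q)) J m r}
  add_mem' := fun ha hb r => by
    rw [map_add, map_add]
    exact add_mem (ha r) (hb r)
  zero_mem' := fun r => by
    rw [map_zero, map_zero]
    exact zero_mem _
  smul_mem' := by
    intro g H hH
    rw [smul_eq_mul]
    induction g using MvPolynomial.induction_on generalizing H with
    | C c =>
      intro r
      rw [homogeneousComponent_C_mul, map_mul]
      exact Ideal.mul_mem_left _ _ (hH r)
    | add f g hf hg =>
      intro r
      rw [add_mul, map_add, map_add]
      exact add_mem (hf hH r) (hg hH r)
    | mul_X g i hg =>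
      rw [mul_assoc]
      refine hg ?_
      have hi : Q i ∈ Ideal.span (Set.range Q) := Ideal.subset_span ⟨i, rfl⟩
      rintro (_ | r)
      · rw [homogeneousComponent_zero_X_mul, map_zero]
        exact zero_mem _
      · rw [homogeneousComponent_X_mul, map_mul, aeval_X]
        have h1 := hH r
        rcases r with _ | r
        · refine Ideal.mem_sup_right ?_
          rw [mul_comm (Q i)]
          refine Ideal.mul_mem_mul h1 ?_
          rwa [show 0 + 1 = 1 from rfl, pow_one]
        · have h2 := Ideal.mul_mem_mul hi h1
          rw [fiberConeFiltration, Ideal.mul_sup, mul_left_comm, ← pow_succ', mul_left_comm,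
            ← pow_succ'] at h2
          exact h2

theorem mem_fiberConeIdeal_of_isHomogeneous {Q : ι → R} {J m : Ideal R} {H : MvPolynomial ι F}
    {r : ℕ} (hH : H.IsHomogeneous r)
    (h : aeval Q H ∈ fiberConeFiltration (Ideal.span (Set.range Q)) J m r) :
    H ∈ fiberConeIdeal (F := F) Q J m := by
  intro s
  rw [homogeneousComponent_of_mem hH]
  split_ifs with hs
  · rwa [hs]
  · rw [map_zero]
    exact zero_mem _

theorem span_pow_le_of_isHomogeneous (F : Type*) [Field F] [Algebra F R] {Q : ι → R} {N : Ideal R}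
    {r : ℕ} (h : ∀ H : MvPolynomial ι F, H.IsHomogeneous r → aeval Q H ∈ N) :
    Ideal.span (Set.range Q) ^ r ≤ N := by
  have h1 : ∀ r, Ideal.span (Set.range Q) ^ r ≤
      Ideal.span {y | ∃ H : MvPolynomial ι F, H.IsHomogeneous r ∧ aeval Q H = y} := by
    intro r
    induction r with
    | zero =>
      rw [pow_zero, Ideal.one_eq_top, top_le_iff, Ideal.eq_top_iff_one]
      exact Ideal.subset_span ⟨1, isHomogeneous_one _ _, map_one _⟩
    | succ r ih =>
      rw [pow_succ']
      refine (Ideal.mul_mono_right ih).trans ?_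
      rw [Ideal.span_mul_span', Ideal.span_le]
      rintro _ ⟨_, ⟨i, rfl⟩, _, ⟨H, hH, rfl⟩, rfl⟩
      refine Ideal.subset_span ⟨X i * H, ?_, by simp⟩
      rw [add_comm]
      exact (isHomogeneous_X F i).mul hH
  refine (h1 r).trans (Ideal.span_le.mpr ?_)
  rintro _ ⟨H, hH, rfl⟩
  exact h H hH

/-- If the fibre cone modulo `J` has no non-zero point, the Nullstellensatz puts powers of all
variables into its ideal, hence all forms of some large degree. Thus a power of the ideal is
contained in `J` times the previous power plus the maximal ideal times itself, and Nakayama's lemma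
removes the last term. -/
theorem pow_le_mul_pow_of_zeros [IsAlgClosed F] [Fintype ι] [IsLocalRing R] [IsNoetherianRing R]
    {Q : ι → R} {J : Ideal R}
    (h : ∀ b : ι → F, (∀ H ∈ fiberConeIdeal (F := F) Q J (IsLocalRing.maximalIdeal R),
      eval b H = 0) → b = 0) :
    ∃ r, Ideal.span (Set.range Q) ^ (r + 1) ≤ J * Ideal.span (Set.range Q) ^ r := by
  classical
  set m := IsLocalRing.maximalIdeal R
  set T := fiberConeIdeal (F := F) Q J m with hT
  have h1 : ∀ i, ∃ N, (X i ^ N : MvPolynomial ι F) ∈ T := by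
    intro i
    obtain ⟨N, hN⟩ := exists_X_pow_mem_span (f := fun H : T => H.1)
      (fun b hb => h b fun H hH => hb ⟨H, hH⟩) i
    refine ⟨N, ?_⟩
    have hr : Set.range (fun H : T => H.1) = (T : Set (MvPolynomial ι F)) := Subtype.range_coe
    rwa [hr, Ideal.span_eq] at hN
  choose N hN using h1
  -- In a monomial of degree `M + 1` some exponent reaches its bound `N i`.
  set M := ∑ i, N i with hM
  have h2 : ∀ H : MvPolynomial ι F, H.IsHomogeneous (M + 1) → H ∈ T := by
    intro H hH
    rw [H.as_sum]
    refine sum_mem fun d hd => ?_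
    have hd1 : ∑ i, d i = M + 1 := by
      rw [← Finsupp.degree_eq_sum]
      by_contra hne
      exact mem_support_iff.mp hd (hH.coeff_eq_zero hne)
    obtain ⟨i, hi⟩ : ∃ i, N i ≤ d i := by
      by_contra! hcon
      have := Finset.sum_le_sum fun i (_ : i ∈ Finset.univ) => (hcon i).le
      omega
    have h3 : (X i ^ N i : MvPolynomial ι F) ∣ monomial d (coeff d H) := by
      rw [X_pow_eq_monomial, monomial_dvd_monomial]
      exact ⟨Or.inr (by simpa using hi), one_dvd _⟩
    exact Ideal.mem_of_dvd _ h3 (hN i)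
  have h3 : Ideal.span (Set.range Q) ^ (M + 1) ≤ J * Ideal.span (Set.range Q) ^ M ⊔
      m * Ideal.span (Set.range Q) ^ (M + 1) := by
    refine span_pow_le_of_isHomogeneous F fun H hH => ?_
    have h4 := h2 H hH (M + 1)
    rwa [homogeneousComponent_of_mem hH, if_pos rfl] at h4
  refine ⟨M, Submodule.le_of_le_smul_of_le_jacobson_bot (IsNoetherian.noetherian _)
    (IsLocalRing.maximalIdeal_le_jacobson ⊥) ?_⟩
  simpa only [smul_eq_mul] using h3

theorem pow_add_le_of_pow_succ_le {I J : Ideal R} {r : ℕ} (h : I ^ (r + 1) ≤ J * I ^ r) (d : ℕ) :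
    I ^ (d + r) ≤ J ^ d := by
  have h1 : ∀ d, I ^ (d + r) ≤ J ^ d * I ^ r := by
    intro d
    induction d with
    | zero => simp
    | succ d ih =>
      rw [show d + 1 + r = d + r + 1 by ring, pow_succ' I]
      refine (Ideal.mul_mono_right ih).trans ?_
      rw [mul_left_comm, ← pow_succ', pow_succ J, mul_assoc]
      exact Ideal.mul_mono_right h
  exact (h1 d).trans Ideal.mul_le_left

end FiberCone

/-! ### Two generic members generate a reduction -/

section Reduction

variable {K F : Type*} [Field K] [IsAlgClosed K] [Field F] [IsAlgClosed F] [Algebra K F]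
  {ι : Type*} [Fintype ι] {x : Fin 2 × ι → F}

/-- Locally at a point, two generic members of a linear system generate a reduction of the ideal of
the linear system. -/
theorem exists_pow_le_pow_linearSectionIdeal (hx : AlgebraicIndependent K x)
    (q : ι → MvPolynomial (Fin 2) K) (a : Fin 2 → K) :
    ∃ r, ∀ d, ((Ideal.span (Set.range fun i => map (algebraMap K F) (q i))).map
      (algebraMap (MvPolynomial (Fin 2) F)
        (Localization.AtPrime (pointIdeal fun i => algebraMap K F (a i))))) ^ (d + r) ≤
      ((linearSectionIdeal x q).map (algebraMap (MvPolynomial (Fin 2) F)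
        (Localization.AtPrime (pointIdeal fun i => algebraMap K F (a i))))) ^ d := by
  set a' : Fin 2 → F := fun i => algebraMap K F (a i) with ha'
  set R := Localization.AtPrime (pointIdeal a') with hR
  let ψ : MvPolynomial (Fin 2) K →+* R :=
    (algebraMap (MvPolynomial (Fin 2) F) R).comp (map (algebraMap K F))
  let Q : ι → R := fun i => ψ (q i)
  set J := (linearSectionIdeal x q).map (algebraMap (MvPolynomial (Fin 2) F) R)
  have hI : (Ideal.span (Set.range fun i => map (algebraMap K F) (q i))).map
      (algebraMap (MvPolynomial (Fin 2) F) R) = Ideal.span (Set.range Q) := by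
    rw [Ideal.map_span, ← Set.range_comp]
    rfl
  rw [hI]
  have hψ : ∀ c : MvPolynomial ι K, aeval Q (map (algebraMap K F) c) = ψ (aeval q c) := by
    intro c
    have h1 : (aeval Q : MvPolynomial ι F →ₐ[F] R).toRingHom.comp (map (algebraMap K F)) =
        ψ.comp (aeval q : MvPolynomial ι K →ₐ[K] _).toRingHom := by
      apply MvPolynomial.ringHom_ext
      · intro c
        simp only [ψ, AlgHom.toRingHom_eq_coe, RingHom.comp_apply, RingHom.coe_coe, map_C,
          MvPolynomial.algebraMap_eq, algHom_C]
        exact IsScalarTower.algebraMap_apply F (MvPolynomial (Fin 2) F) R _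
      · intro i
        simp [Q]
    exact congrFun (congrArg DFunLike.coe h1) c
  set m := IsLocalRing.maximalIdeal R with hm
  have hmul : ∀ r, m * Ideal.span (Set.range Q) ^ r ≤
      fiberConeFiltration (Ideal.span (Set.range Q)) J m r := by
    rintro (_ | r)
    · exact Ideal.mul_le_left
    · exact le_sup_right
  suffices h : ∃ r, Ideal.span (Set.range Q) ^ (r + 1) ≤ J * Ideal.span (Set.range Q) ^ r by
    obtain ⟨r, hr⟩ := h
    exact ⟨r, pow_add_le_of_pow_succ_le hr⟩
  refine pow_le_mul_pow_of_zeros (F := F) fun b hb => ?_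
  by_contra hb0
  obtain ⟨j, hj⟩ := Function.ne_iff.mp hb0
  have hj' : b j ≠ 0 := hj
  -- The two generic linear forms evaluate into `J` and hence vanish in the fibre cone modulo `J`,
  -- so the point `b` lies on two generic hyperplanes.
  have h1 : ∀ k, ∑ i, x (k, i) * b i = 0 := by
    intro k
    have h2 := hb (∑ i, C (x (k, i)) * X i) (mem_fiberConeIdeal_of_isHomogeneous (r := 1)
      (IsHomogeneous.sum _ _ _ fun i _ => by
        simpa using (isHomogeneous_C ι (x (k, i))).mul (isHomogeneous_X F i)) ?_)
    · simpa using h2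
    · refine Ideal.mem_sup_left ?_
      rw [pow_zero, mul_one]
      have h3 : aeval Q (∑ i, C (x (k, i)) * X i) =
          algebraMap (MvPolynomial (Fin 2) F) R (linearSection x q k) := by
        rw [linearSection, map_sum, map_sum]
        refine Finset.sum_congr rfl fun i _ => ?_
        rw [map_mul, map_mul, aeval_X, algHom_C]
        rw [IsScalarTower.algebraMap_apply F (MvPolynomial (Fin 2) F) R]
        rfl
      rw [h3]
      exact Ideal.mem_map_of_mem _ (Ideal.subset_span ⟨k, rfl⟩)
  obtain ⟨i, k, hik⟩ := exists_algebraicIndependent_pair hx (fun i => b i / b j) (div_self hj')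
    fun k => by simp only [mul_div_assoc', ← Finset.sum_div, h1, zero_div]
  -- A non-zero polynomial over `K` that lies in the maximal ideal at the point. The resulting
  -- relation among three generators has coefficients in `K`, so it cannot vanish at `b`, two of
  -- whose ratios are algebraically independent.
  have hu : (X 0 - C (a 0) : MvPolynomial (Fin 2) K) ≠ 0 := by
    intro h
    have h2 := congrArg (eval fun _ => a 0 + 1) h
    simp at h2
  let y : Fin 3 → ι := ![j, i, k]
  obtain ⟨r, c, hc, hcr, e, he, hce⟩ := exists_isHomogeneous_aeval_eq_mul (fun l => q (y l)) hu
  refine aeval_ne_zero_of_algebraicIndependent hik hc hcr ?_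
  have h4 := hb (map (algebraMap K F) (rename y c))
    (mem_fiberConeIdeal_of_isHomogeneous (r := r) ((hcr.rename_isHomogeneous (f := y)).map _) ?_)
  · rw [eval_map, ← aeval_def, aeval_rename] at h4
    have h5 : b ∘ y = fun l => b j * ![1, b i / b j, b k / b j] l := by
      funext l
      fin_cases l
      · simp [y]
      · simp [y, mul_div_cancel₀ _ hj']
      · simp [y, mul_div_cancel₀ _ hj']
    rw [h5, aeval_mul_of_isHomogeneous hcr] at h4
    exact (mul_eq_zero.mp h4).resolve_left (pow_ne_zero _ hj')
  · refine hmul r ?_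
    rw [hψ, aeval_rename]
    have h6 : aeval (q ∘ y) c = (X 0 - C (a 0)) * e := hce
    rw [h6, map_mul]
    refine Ideal.mul_mem_mul ?_ ?_
    · rw [hm]
      refine (IsLocalization.AtPrime.to_map_mem_maximal_iff R (pointIdeal a') _).mpr ?_
      show eval a' _ = 0
      simp [ha']
    · have h7 := Ideal.mem_map_of_mem ψ he
      rw [Ideal.map_pow, Ideal.map_span, ← Set.range_comp] at h7
      refine Ideal.pow_right_mono (Ideal.span_mono ?_) r h7
      rintro _ ⟨l, rfl⟩
      exact ⟨y l, rfl⟩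

end Reduction

/-! ### Hilbert–Samuel multiplicities of linear systems -/

section HilbertSamuel

theorem algebraMap_localization_pointIdeal_injective {F : Type*} [Field F] (a : Fin 2 → F) :
    Function.Injective (algebraMap (MvPolynomial (Fin 2) F)
      (Localization.AtPrime (pointIdeal a))) :=
  IsLocalization.injective _ (pointIdeal a).primeCompl_le_nonZeroDivisors

/-- With denominators cleared, this is divisibility by a coprime factor in the polynomial ring. -/
theorem dvd_of_dvd_mul_localization {F : Type*} [Field F] {f g : MvPolynomial (Fin 2) F}
    (hfg : IsRelPrime f g) (a : Fin 2 → F) (y : Localization.AtPrime (pointIdeal a))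
    (h : algebraMap (MvPolynomial (Fin 2) F) (Localization.AtPrime (pointIdeal a)) f ∣
      algebraMap _ (Localization.AtPrime (pointIdeal a)) g * y) :
    algebraMap (MvPolynomial (Fin 2) F) (Localization.AtPrime (pointIdeal a)) f ∣ y := by
  obtain ⟨z, hz⟩ := h
  obtain ⟨⟨y₀, s⟩, hy⟩ := IsLocalization.surj (pointIdeal a).primeCompl y
  obtain ⟨⟨z₀, t⟩, hz'⟩ := IsLocalization.surj (pointIdeal a).primeCompl z
  simp only at hy hz'
  have h1 : g * (t * y₀) = f * (z₀ * s) := by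
    apply algebraMap_localization_pointIdeal_injective a
    rw [map_mul, map_mul, map_mul, map_mul, ← hy, ← hz']
    linear_combination (algebraMap (MvPolynomial (Fin 2) F) (Localization.AtPrime (pointIdeal a)) t *
      algebraMap (MvPolynomial (Fin 2) F) (Localization.AtPrime (pointIdeal a)) s) * hz
  obtain ⟨w, hw⟩ := hfg.dvd_of_dvd_mul_left (Dvd.intro _ h1.symm)
  have hs := IsLocalization.map_units (Localization.AtPrime (pointIdeal a)) s
  have ht := IsLocalization.map_units (Localization.AtPrime (pointIdeal a)) t
  rw [← hs.dvd_mul_right, hy, ← ht.dvd_mul_left, ← map_mul, hw, map_mul]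
  exact Dvd.intro _ rfl

theorem exists_eval_ne_zero_of_finite {F : Type*} [Field F] {V : Set (Fin 2 → F)} (hV : V.Finite)
    (a : Fin 2 → F) : ∃ s : MvPolynomial (Fin 2) F, eval a s ≠ 0 ∧
      ∀ τ ∈ V, eval τ s = 0 ∨ τ = a := by
  classical
  have h1 : ∀ τ : Fin 2 → F, ∃ s : MvPolynomial (Fin 2) F, eval a s ≠ 0 ∧
      (eval τ s = 0 ∨ τ = a) := by
    intro τ
    by_cases h : τ = a
    · exact ⟨1, by simp, Or.inr h⟩
    · obtain ⟨i, hi⟩ := Function.ne_iff.mp h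
      refine ⟨X i - C (τ i), ?_, Or.inl (by simp)⟩
      rw [map_sub, eval_X, eval_C]
      exact sub_ne_zero.mpr (Ne.symm hi)
  choose s hs hs' using h1
  refine ⟨∏ τ ∈ hV.toFinset, s τ, ?_, fun τ hτ => (hs' τ).imp_left fun h => ?_⟩
  · rw [map_prod]
    exact Finset.prod_ne_zero_iff.mpr fun τ _ => hs τ
  · rw [map_prod]
    exact Finset.prod_eq_zero (hV.mem_toFinset.mpr hτ) h

variable {K F : Type*} [Field K] [IsAlgClosed K] [Field F] [IsAlgClosed F] [Algebra K F]

/-- A polynomial over `K` isolates the point `a` in the finite zero locus and, since no new zeros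
appear over `F`, still isolates it there. Both local lengths are then lengths of localizations away
from this polynomial, which are invariant under base change. -/
theorem finrank_localization_quotient_map {I : Ideal (MvPolynomial (Fin 2) K)}
    (hI : Module.Finite K (MvPolynomial (Fin 2) K ⧸ I)) (a : Fin 2 → K) :
    Module.finrank K (Localization.AtPrime (pointIdeal a) ⧸
      I.map (algebraMap (MvPolynomial (Fin 2) K) (Localization.AtPrime (pointIdeal a)))) =
    Module.finrank F (Localization.AtPrime (pointIdeal fun i => algebraMap K F (a i)) ⧸
      (I.map (map (algebraMap K F))).map (algebraMap (MvPolynomial (Fin 2) F)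
        (Localization.AtPrime (pointIdeal fun i => algebraMap K F (a i))))) := by
  obtain ⟨s, has, hs⟩ := exists_eval_ne_zero_of_finite
    (IsAffineSystem.finite_zeroLocus hI) a
  rw [← finrank_away_eq_finrank_localization hI has hs,
    ← (finrank_away_quotient_map (L := F) I s).1]
  refine finrank_away_eq_finrank_localization ((finite_quotient_map_iff I).mpr hI) ?_ ?_
  · rw [eval_map_algebraMap_comp]
    simpa using has
  · intro τ hτ
    have h1 : ∀ f ∈ I, aeval τ f = 0 := fun f hf => by
      have := hτ _ (Ideal.mem_map_of_mem (map (algebraMap K F)) hf)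
      rwa [aeval_map_algebraMap] at this
    obtain ⟨b, rfl⟩ := IsAffineSystem.exists_eq_algebraMap hI h1
    have h2 : b ∈ zeroLocus K I := fun f hf => by
      have := h1 f hf
      rw [aeval_algebraMap_comp, map_eq_zero] at this
      exact this
    rw [eval_map_algebraMap_comp, map_eq_zero]
    exact (hs b h2).imp_right fun h => by rw [h]

variable {ι : Type*} [Fintype ι] {x : Fin 2 × ι → F} {q : ι → MvPolynomial (Fin 2) K} {n : ℕ}

/-- The intersection multiplicity of two generic members of a linear system at a base point is the
Hilbert–Samuel multiplicity of the ideal of the linear system. -/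
theorem IsAffineSystem.isHilbertSamuelMult (hq : IsAffineSystem q n)
    (hx : AlgebraicIndependent K x) (a : Fin 2 → K) :
    IsHilbertSamuelMult K ((Ideal.span (Set.range q)).map
      (algebraMap (MvPolynomial (Fin 2) K) (Localization.AtPrime (pointIdeal a))))
      (Module.finrank F (Localization.AtPrime (pointIdeal fun i => algebraMap K F (a i)) ⧸
        (linearSectionIdeal x q).map (algebraMap (MvPolynomial (Fin 2) F)
          (Localization.AtPrime (pointIdeal fun i => algebraMap K F (a i)))))) := by
  set R := Localization.AtPrime (pointIdeal fun i => algebraMap K F (a i)) with hR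
  set J := (linearSectionIdeal x q).map (algebraMap (MvPolynomial (Fin 2) F) R) with hJ
  set I := ((Ideal.span (Set.range q)).map (map (algebraMap K F))).map
    (algebraMap (MvPolynomial (Fin 2) F) R) with hI
  have hfin := fun d => hq.finite_quotient_span hx d
  have hrank : ∀ d, Module.finrank K (Localization.AtPrime (pointIdeal a) ⧸
      ((Ideal.span (Set.range q)).map (algebraMap (MvPolynomial (Fin 2) K)
        (Localization.AtPrime (pointIdeal a)))) ^ d) = Module.finrank F (R ⧸ I ^ d) := by
    intro d
    rw [hI, ← Ideal.map_pow, ← Ideal.map_pow, ← Ideal.map_pow]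
    exact finrank_localization_quotient_map (hfin d) a
  have hIfin : ∀ d, Module.Finite F (R ⧸ I ^ d) := by
    intro d
    rw [hI, ← Ideal.map_pow, ← Ideal.map_pow]
    exact finite_localization_quotient_map ((finite_quotient_map_iff _).mpr (hfin d)) _
  have hJfin : Module.Finite F (R ⧸ J) :=
    finite_localization_quotient_map (hq.finrank_quotient_linearSectionIdeal hx).1 _
  have hJ' : J = Ideal.span {algebraMap (MvPolynomial (Fin 2) F) R (linearSection x q 0),
      algebraMap (MvPolynomial (Fin 2) F) R (linearSection x q 1)} := by
    rw [hJ, linearSectionIdeal_eq, Ideal.map_span, Set.image_pair]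
  have hw : algebraMap (MvPolynomial (Fin 2) F) R (linearSection x q 0) ≠ 0 := by
    rw [Ne, map_eq_zero_iff _ (algebraMap_localization_pointIdeal_injective _)]
    intro h
    exact hq.homogeneousComponent_linearSection_ne_zero hx 0 (by rw [h, map_zero])
  have hpow : ∀ d, Module.Finite F (R ⧸ J ^ d) ∧
      2 * Module.finrank F (R ⧸ J ^ d) = d * (d + 1) * Module.finrank F (R ⧸ J) := by
    rw [hJ'] at hJfin ⊢
    exact finrank_quotient_span_pair_pow (fun y hy => (mul_eq_zero.mp hy).resolve_left hw)
      (dvd_of_dvd_mul_localization (hq.isRelPrime hx) _) hJfin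
  have hmono : ∀ {𝔞 𝔟 : Ideal R}, 𝔞 ≤ 𝔟 → Module.Finite F (R ⧸ 𝔞) →
      Module.finrank F (R ⧸ 𝔟) ≤ Module.finrank F (R ⧸ 𝔞) := by
    intro 𝔞 𝔟 h h𝔞
    exact LinearMap.finrank_le_finrank_of_surjective
      (f := (Ideal.Quotient.factorₐ F h).toLinearMap) (Ideal.Quotient.factor_surjective h)
  have hJI : J ≤ I := by
    refine Ideal.map_mono (Ideal.span_le.mpr ?_)
    rintro _ ⟨k, rfl⟩
    exact IsAffineSystem.linearSection_mem k
  obtain ⟨r, hr⟩ := exists_pow_le_pow_linearSectionIdeal hx q a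
  -- The reduction property, which together with `J ≤ I` squeezes the colengths of the powers of `I`
  -- between those of powers of `J`.
  have hr' : ∀ d, I ^ (d + r) ≤ J ^ d := by
    intro d
    rw [hI, Ideal.map_span, ← Set.range_comp]
    exact hr d
  refine ⟨fun d => ?_, ?_⟩
  · rw [← Ideal.map_pow]
    exact finite_localization_quotient_map (hfin _) a
  · refine tendsto_of_quadratic_bounds (r := r) (h := fun d => Module.finrank K
      (Localization.AtPrime (pointIdeal a) ⧸ ((Ideal.span (Set.range q)).map
        (algebraMap (MvPolynomial (Fin 2) K) (Localization.AtPrime (pointIdeal a)))) ^ d)) ?_ ?_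
    · intro d
      rw [hrank, ← (hpow d).2]
      exact Nat.mul_le_mul_left 2 (hmono (Ideal.pow_right_mono hJI d) (hpow d).1)
    · intro d
      rw [hrank, ← (hpow d).2]
      exact Nat.mul_le_mul_left 2 (hmono (hr' d) (hIfin _))

end HilbertSamuel

/-! ### Specialization of a function field at a point -/

section Specialization

variable {K : Type*} [Field K]

theorem aeval_apply_eq_eval {τ : Type*} (b : τ → K) (f : MvPolynomial τ K) :
    aeval b f = eval b f :=
  congrFun (congrArg DFunLike.coe (coe_aeval_eq_eval b)) f

theorem exists_algHom_range {A B E : Type*} [CommRing A] [CommRing B] [CommRing E] [Algebra K A]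
    [Algebra K B] [Algebra K E] (g : A →ₐ[K] E) (e : A →ₐ[K] B) (h : ∀ z, g z = 0 → e z = 0) :
    ∃ v : g.range →ₐ[K] B, ∀ z, v ⟨g z, z, rfl⟩ = e z := by
  let φ := Ideal.quotientKerAlgEquivOfSurjective g.rangeRestrict_surjective
  have h' : ∀ z ∈ RingHom.ker g.rangeRestrict, e z = 0 := fun z hz =>
    h z (congrArg Subtype.val (RingHom.mem_ker.mp hz))
  refine ⟨(Ideal.Quotient.liftₐ (RingHom.ker g.rangeRestrict) e h').comp φ.symm.toAlgHom,
    fun z => ?_⟩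
  have h1 : φ.symm ⟨g z, z, rfl⟩ = Ideal.Quotient.mk _ z := by
    rw [AlgEquiv.symm_apply_eq]
    rfl
  show Ideal.Quotient.liftₐ (RingHom.ker g.rangeRestrict) e h' (φ.symm ⟨g z, z, rfl⟩) = e z
  rw [h1]
  rfl

/-- A point `b` of the spectrum of a subalgebra of a field gives a local subring of the field, with
the values at `b`. -/
theorem exists_specialization {τ E : Type*} [Field E] [Algebra K E] (g : MvPolynomial τ K →ₐ[K] E)
    (b : τ → K) (hb : ∀ r, g r = 0 → eval b r = 0) :
    ∃ (V : Subalgebra K E) (v : V →ₐ[K] K),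
      (∀ z r s, eval b s ≠ 0 → z * g s = g r → ∃ h : z ∈ V, v ⟨z, h⟩ * eval b s = eval b r) ∧
      ∀ z ∈ V, ∃ r s, eval b s ≠ 0 ∧ z * g s = g r := by
  haveI : (RingHom.ker (eval b)).IsPrime := RingHom.ker_isPrime _
  set P := RingHom.ker (eval b)
  have hg : ∀ s : P.primeCompl, IsUnit (g s) := fun s =>
    isUnit_iff_ne_zero.mpr fun h0 => s.2 (hb _ h0)
  have he : ∀ s : P.primeCompl, IsUnit (aeval b s.1 : K) := fun s =>
    isUnit_iff_ne_zero.mpr fun h0 => s.2 (by rwa [aeval_apply_eq_eval] at h0)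
  let g' : Localization.AtPrime P →ₐ[K] E := IsLocalization.liftAlgHom (f := g) (M := P.primeCompl) hg
  let e' : Localization.AtPrime P →ₐ[K] K :=
    IsLocalization.liftAlgHom (f := aeval b) (M := P.primeCompl) he
  have hg' : ∀ r, g' (algebraMap _ _ r) = g r := fun r => IsLocalization.lift_eq _ r
  have he' : ∀ r, e' (algebraMap _ _ r) = eval b r := fun r =>
    (IsLocalization.lift_eq _ r).trans (aeval_apply_eq_eval b r)
  obtain ⟨v, hv⟩ := exists_algHom_range g' e' fun z hz => by
    obtain ⟨⟨r, s⟩, hrs⟩ := IsLocalization.surj P.primeCompl z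
    have h1 := congrArg g' hrs
    rw [map_mul, hz, zero_mul, hg'] at h1
    have h2 := congrArg e' hrs
    rw [map_mul, he', he', hb _ h1.symm] at h2
    exact (mul_eq_zero.mp h2).resolve_right s.2
  refine ⟨g'.range, v, fun z r s hs hz => ?_, ?_⟩
  · have h1 : z = g' (IsLocalization.mk' _ r (⟨s, hs⟩ : P.primeCompl)) := by
      have hs0 : g s ≠ 0 := fun h0 => hs (hb _ h0)
      apply mul_right_cancel₀ hs0
      rw [hz, ← hg' s, ← map_mul, IsLocalization.mk'_spec' _ r (⟨s, hs⟩ : P.primeCompl) |>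
        (fun h => (mul_comm _ _).trans h), hg']
    subst h1
    refine ⟨⟨_, rfl⟩, ?_⟩
    rw [hv, ← he' s, ← map_mul, IsLocalization.mk'_spec' _ r (⟨s, hs⟩ : P.primeCompl) |>
        (fun h => (mul_comm _ _).trans h), he']
  · rintro _ ⟨z, rfl⟩
    obtain ⟨⟨r, s⟩, hrs⟩ := IsLocalization.surj P.primeCompl z
    refine ⟨r, s, s.2, ?_⟩
    rw [← hg', ← hg', ← hrs]
    exact (map_mul g' _ _).symm

end Specialization

/-! ### Counting the points of a general fibre -/

section FiberCount

theorem exists_aeval_eq_of_mem_adjoin {k E : Type*} [Field k] [Field E] [Algebra k E] {d z : E}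
    (hd : IsAlgebraic k d) (hz : z ∈ IntermediateField.adjoin k {d}) :
    ∃ P : Polynomial k, Polynomial.aeval d P = z := by
  rw [← IntermediateField.mem_toSubalgebra,
    IntermediateField.adjoin_simple_toSubalgebra_of_isAlgebraic hd,
    Algebra.adjoin_singleton_eq_range_aeval] at hz
  exact hz

variable {K : Type*} [Field K]

/-- The data describing `E` as generated by `θ` over `k` have coefficients in the local subring `V`
and specialize along `v`. A root `ρ` of the specialized minimal polynomial gives the fibre point
with coordinates `ξ i` evaluated at `ρ`, and a fibre point gives back the value of `θ` there. The
identity `hUW` makes the specialized polynomial separable, so it has as many roots as its degree;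
`hP₀` and `hP₁` keep `q₀` and `den` from vanishing at the points obtained. -/
theorem encard_fiber_of_specialization [IsAlgClosed K] {σ τ k E : Type*} [Field k] [Field E]
    [Algebra K k] [Algebra K E] [Algebra k E] [IsScalarTower K k E]
    [Algebra (MvPolynomial σ K) E] [IsScalarTower K (MvPolynomial σ K) E]
    (hinj : Function.Injective (algebraMap (MvPolynomial σ K) E))
    {f : τ → k} {q : τ → MvPolynomial σ K} {q₀ num den : MvPolynomial σ K}
    (hq₀ : q₀ ≠ 0) (hden : den ≠ 0)
    (hf : ∀ i, algebraMap k E (f i) * algebraMap (MvPolynomial σ K) E q₀ = algebraMap (MvPolynomial σ K) E (q i))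
    {y : τ → K} (V : Subalgebra K k) (v : V →ₐ[K] K)
    (hV : ∀ (z : k) (r s : MvPolynomial τ K), eval y s ≠ 0 → z * aeval f s = aeval f r →
      ∃ h : z ∈ V, v ⟨z, h⟩ * eval y s = eval y r)
    (hV' : ∀ z ∈ V, ∃ r s : MvPolynomial τ K, eval y s ≠ 0 ∧ z * aeval f s = aeval f r)
    {θ : E} (hθ : θ * algebraMap (MvPolynomial σ K) E den = algebraMap (MvPolynomial σ K) E num)
    (μ U W P₀ P₁ : Polynomial V) (ξ : σ → Polynomial V)
    (hμ : μ.map (algebraMap V k) = minpoly k θ) (hθint : IsIntegral k θ)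
    (hUW : U * μ + W * Polynomial.derivative μ = 1)
    (hP₀ : Polynomial.aeval (algebraMap (MvPolynomial σ K) E q₀) P₀ * algebraMap (MvPolynomial σ K) E q₀ = 1)
    (hP₁ : Polynomial.aeval (algebraMap (MvPolynomial σ K) E den) P₁ * algebraMap (MvPolynomial σ K) E den = 1)
    (hξ : ∀ i, Polynomial.aeval θ (ξ i) = algebraMap (MvPolynomial σ K) E (X i)) :
    {a : σ → K | eval a q₀ ≠ 0 ∧ ∀ i, eval a (q i) = y i * eval a q₀}.encard =
      (minpoly k θ).natDegree := by
  have hVinj : Function.Injective (algebraMap V k) := Subtype.val_injective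
  have hμm : μ.Monic := Polynomial.monic_of_injective hVinj (by rw [hμ]; exact minpoly.monic hθint)
  have hμθ : Polynomial.aeval θ μ = 0 := by
    rw [← Polynomial.aeval_map_algebraMap k, hμ, minpoly.aeval]
  have hyf : ∀ i, ∃ h : f i ∈ V, v ⟨f i, h⟩ = y i := by
    intro i
    obtain ⟨h, hv⟩ := hV (f i) (X i) 1 (by simp) (by simp)
    exact ⟨h, by simpa using hv⟩
  -- the roots of the specialized minimal polynomial
  have hsep : (μ.map (v : V →+* K)).Separable := by
    refine ⟨U.map (v : V →+* K), W.map (v : V →+* K), ?_⟩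
    rw [Polynomial.derivative_map, ← Polynomial.map_mul, ← Polynomial.map_mul,
      ← Polynomial.map_add, hUW, Polynomial.map_one]
  set T := (μ.map (v : V →+* K)).rootSet K with hT
  have hTcard : T.encard = (minpoly k θ).natDegree := by
    have h1 := Polynomial.card_rootSet_eq_natDegree (K := K) hsep (IsAlgClosed.splits _)
    rw [← hμ, hμm.natDegree_map (algebraMap V k), ← hμm.natDegree_map (v : V →+* K), ← h1,
      Set.encard_eq_coe_toFinset_card, Set.toFinset_card]
  have hmemT : ∀ ρ, ρ ∈ T ↔ Polynomial.eval₂ (v : V →+* K) ρ μ = 0 := by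
    intro ρ
    rw [hT, Polynomial.mem_rootSet_of_ne (hμm.map _).ne_zero, ← Polynomial.eval_map]
    simp
  let pt : K → σ → K := fun ρ i => Polynomial.eval₂ (v : V →+* K) ρ (ξ i)
  -- the universal root
  let B := AdjoinRoot μ
  have hμθ' : Polynomial.eval₂ (algebraMap V E) θ μ = 0 := hμθ
  let toE : B →+* E := AdjoinRoot.lift (algebraMap V E) θ hμθ'
  have hEof : ∀ z, toE (AdjoinRoot.of μ z) = algebraMap V E z := fun z => AdjoinRoot.lift_of hμθ'
  have hEroot : toE (AdjoinRoot.root μ) = θ := AdjoinRoot.lift_root hμθ'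
  have hEmk : ∀ p, toE (AdjoinRoot.mk μ p) = Polynomial.aeval θ p := fun p =>
    AdjoinRoot.lift_mk hμθ' p
  have htoE : Function.Injective toE := by
    rw [injective_iff_map_eq_zero]
    intro z hz
    obtain ⟨p, rfl⟩ := AdjoinRoot.mk_surjective z
    have h1 : Polynomial.aeval θ (p.map (algebraMap V k)) = 0 := by
      rw [Polynomial.aeval_map_algebraMap]
      rwa [hEmk] at hz
    have h2 := minpoly.dvd k θ h1
    rw [← hμ, Polynomial.map_dvd_map _ hVinj hμm] at h2
    exact AdjoinRoot.mk_eq_zero.mpr h2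
  let G : MvPolynomial σ K →+* B := eval₂Hom ((AdjoinRoot.of μ).comp (algebraMap K V))
    fun i => AdjoinRoot.mk μ (ξ i)
  have hGE : ∀ g, toE (G g) = algebraMap (MvPolynomial σ K) E g := by
    intro g
    have h1 : toE.comp G = algebraMap (MvPolynomial σ K) E := by
      apply MvPolynomial.ringHom_ext
      · intro c
        simp only [G, RingHom.comp_apply, coe_eval₂Hom, eval₂_C, hEof]
        rw [← MvPolynomial.algebraMap_eq, ← IsScalarTower.algebraMap_apply,
          ← IsScalarTower.algebraMap_apply]
      · intro i
        simp only [G, RingHom.comp_apply, coe_eval₂Hom, eval₂_X, hEmk]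
        exact hξ i
    exact congrFun (congrArg DFunLike.coe h1) g
  have hroot : AdjoinRoot.root μ * G den = G num := by
    apply htoE
    rw [map_mul, hGE, hGE, ← hθ, hEroot]
  have hinvB : ∀ (d : MvPolynomial σ K) (P : Polynomial V),
      Polynomial.aeval (algebraMap (MvPolynomial σ K) E d) P * algebraMap _ E d = 1 →
      Polynomial.eval₂ (AdjoinRoot.of μ) (G d) P * G d = 1 := by
    intro d P h
    apply htoE
    rw [map_mul, Polynomial.hom_eval₂, hGE, map_one, ← h]
    congr 2
    exact RingHom.ext hEof
  have hfB : ∀ i (h : f i ∈ V), AdjoinRoot.of μ ⟨f i, h⟩ * G q₀ = G (q i) := by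
    intro i h
    apply htoE
    rw [map_mul, hGE, hGE, ← hf]
    rw [hEof]
    rfl
  have hcomp : ∀ ρ ∈ T, ∃ φ : B →+* K, φ (AdjoinRoot.root μ) = ρ ∧
      (∀ z, φ (AdjoinRoot.of μ z) = v z) ∧ ∀ g, φ (G g) = eval (pt ρ) g := by
    intro ρ hρ
    rw [hmemT] at hρ
    refine ⟨AdjoinRoot.lift (v : V →+* K) ρ hρ, AdjoinRoot.lift_root _, fun z =>
      AdjoinRoot.lift_of _, fun g => ?_⟩
    have h1 : (AdjoinRoot.lift (v : V →+* K) ρ hρ).comp G = eval (pt ρ) := by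
      apply MvPolynomial.ringHom_ext
      · intro c
        simp [G]
      · intro i
        simp [G, pt]
    exact congrFun (congrArg DFunLike.coe h1) g
  have hne : ∀ ρ ∈ T, ∀ (d : MvPolynomial σ K) (P : Polynomial V),
      Polynomial.aeval (algebraMap (MvPolynomial σ K) E d) P * algebraMap _ E d = 1 →
      eval (pt ρ) d ≠ 0 := by
    intro ρ hρ d P h h0
    obtain ⟨φ, -, -, hφ⟩ := hcomp ρ hρ
    have h1 := congrArg φ (hinvB d P h)
    rw [map_mul, hφ, h0, mul_zero, map_one] at h1
    exact zero_ne_one h1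
  have hρeq : ∀ ρ ∈ T, ρ * eval (pt ρ) den = eval (pt ρ) num := by
    intro ρ hρ
    obtain ⟨φ, h1, -, hφ⟩ := hcomp ρ hρ
    rw [← hφ, ← hφ, ← hroot, map_mul, h1]
  have hptinj : Set.InjOn pt T := by
    intro ρ hρ ρ' hρ' h
    have h1 := hρeq ρ' hρ'
    rw [← h, ← hρeq ρ hρ] at h1
    exact (mul_right_cancel₀ (hne ρ hρ den P₁ hP₁) h1).symm
  rw [← hTcard, ← hptinj.encard_image]
  congr 1
  ext a
  constructor
  · rintro ⟨ha₀, ha⟩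
    -- specialization at a point of the fibre
    obtain ⟨Va, va, hVa, hVa'⟩ := exists_specialization
      (IsScalarTower.toAlgHom K (MvPolynomial σ K) E) a
      fun r hr => by rw [(map_eq_zero_iff _ hinj).mp hr, map_zero]
    have hgmem : ∀ g, ∃ h : algebraMap (MvPolynomial σ K) E g ∈ Va, va ⟨_, h⟩ = eval a g := by
      intro g
      obtain ⟨h, hv⟩ := hVa (algebraMap _ E g) g 1 (by simp) (by simp)
      exact ⟨h, by simpa using hv⟩
    have hinvmem : ∀ z (h : z ∈ Va), va ⟨z, h⟩ ≠ 0 → z⁻¹ ∈ Va := by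
      intro z h hz
      obtain ⟨r, s, hs, hrs⟩ := hVa' z h
      obtain ⟨hz', h2⟩ := hVa z r s hs hrs
      have hz0 : z ≠ 0 := by
        rintro rfl
        exact hz (map_zero va)
      refine (hVa z⁻¹ s r ?_ ?_).1
      · rw [← h2]
        exact mul_ne_zero hz hs
      · rw [← hrs, inv_mul_cancel_left₀ hz0]
    have hfmem : ∀ i, ∃ h : algebraMap k E (f i) ∈ Va, va ⟨_, h⟩ = y i := by
      intro i
      obtain ⟨h, hv⟩ := hVa (algebraMap k E (f i)) (q i) q₀ ha₀ (hf i)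
      refine ⟨h, ?_⟩
      rw [ha i] at hv
      exact mul_right_cancel₀ ha₀ hv
    choose hfm hfv using hfmem
    have hCmem : ∀ r, ∃ h : algebraMap k E (aeval f r) ∈ Va, va ⟨_, h⟩ = eval y r := by
      intro r
      let f' : τ → Va := fun i => ⟨algebraMap k E (f i), hfm i⟩
      have h1 : (aeval f' r : Va).1 = algebraMap k E (aeval f r) := by
        have : Va.val.comp (aeval f') = (IsScalarTower.toAlgHom K k E).comp (aeval f) := by
          ext i; simp [f']
        exact congrFun (congrArg DFunLike.coe this) r
      refine ⟨h1 ▸ (aeval f' r : Va).2, ?_⟩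
      have h2 : va.comp (aeval f') = aeval y := by
        ext i; simp [f', hfv]
      rw [← aeval_apply_eq_eval, ← h2]
      exact congrArg va (Subtype.ext h1.symm)
    -- The local ring of the fibre point contains the one of its image, with compatible values.
    have hVmem : ∀ z : V, ∃ h : algebraMap k E z ∈ Va, va ⟨_, h⟩ = v z := by
      rintro ⟨z, hz⟩
      obtain ⟨r, s, hs, hrs⟩ := hV' z hz
      obtain ⟨hz', hv⟩ := hV z r s hs hrs
      obtain ⟨hsm, hsv⟩ := hCmem s
      obtain ⟨hrm, hrv⟩ := hCmem r
      have hs0 : algebraMap k E (aeval f s) ≠ 0 := by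
        intro h0
        apply hs
        rw [← hsv, ← map_zero va]
        exact congrArg va (Subtype.ext h0)
      have h1 : algebraMap k E z = algebraMap k E (aeval f r) * (algebraMap k E (aeval f s))⁻¹ := by
        rw [eq_mul_inv_iff_mul_eq₀ hs0, ← map_mul, hrs]
      have h2 : algebraMap k E z ∈ Va := by
        rw [h1]
        exact Va.mul_mem hrm (hinvmem _ hsm (by rwa [hsv]))
      refine ⟨h2, mul_right_cancel₀ hs ?_⟩
      rw [hv, ← hsv, ← hrv, ← map_mul]
      refine congrArg va (Subtype.ext ?_)
      show algebraMap k E z * algebraMap k E (aeval f s) = algebraMap k E (aeval f r)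
      rw [← map_mul, hrs]
    let κ : V →+* Va := ((algebraMap k E).comp (algebraMap V k)).codRestrict Va
      fun z => (hVmem z).1
    have hκ : (va : Va →+* K).comp κ = (v : V →+* K) := RingHom.ext fun z => (hVmem z).2
    have hκE : ∀ (P : Polynomial V) (z : Va),
        (Polynomial.eval₂ κ z P).1 = Polynomial.aeval z.1 P := by
      intro P z
      rw [Polynomial.aeval_def]
      exact Polynomial.hom_eval₂ P κ (Va.val : Va →+* E) z
    have hκK : ∀ (P : Polynomial V) (z : Va),
        va (Polynomial.eval₂ κ z P) = Polynomial.eval₂ (v : V →+* K) (va z) P := by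
      intro P z
      rw [← hκ]
      exact Polynomial.hom_eval₂ P κ (va : Va →+* K) z
    obtain ⟨hdm, hdv⟩ := hgmem den
    obtain ⟨hnm, hnv⟩ := hgmem num
    -- `P₁` writes the inverse of `den` as a polynomial in `den` over `V`, so `θ` is regular at the
    -- fibre point.
    let θa : Va := ⟨_, hnm⟩ * Polynomial.eval₂ κ ⟨_, hdm⟩ P₁
    have hθa : θa.1 = θ := by
      show algebraMap (MvPolynomial σ K) E num * (Polynomial.eval₂ κ ⟨_, hdm⟩ P₁).1 = θ
      rw [hκE, ← hθ, mul_assoc, mul_comm (algebraMap (MvPolynomial σ K) E den), hP₁, mul_one]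
    refine ⟨va θa, ?_, ?_⟩
    · rw [hmemT, ← hκK, ← map_zero va]
      refine congrArg va (Subtype.ext ?_)
      rw [hκE, hθa, hμθ]
      rfl
    · funext i
      show Polynomial.eval₂ (v : V →+* K) (va θa) (ξ i) = a i
      obtain ⟨hXm, hXv⟩ := hgmem (X i)
      rw [← hκK, ← eval_X (f := a) i, ← hXv]
      refine congrArg va (Subtype.ext ?_)
      rw [hκE, hθa, hξ]
  · rintro ⟨ρ, hρ, rfl⟩
    refine ⟨hne ρ hρ q₀ P₀ hP₀, fun i => ?_⟩
    obtain ⟨φ, -, h2, hφ⟩ := hcomp ρ hρ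
    obtain ⟨h, hy⟩ := hyf i
    rw [← hφ, ← hφ, ← hfB i h, map_mul, h2, hy]

/-- Over a non-empty open subset of the closure of the image, the fibres of a generically finite
map have as many points as the degree of the extension of function fields. -/
theorem exists_encard_fiber_eq_finrank [IsAlgClosed K] [CharZero K] {σ τ k E : Type*} [Fintype σ]
    [Field k] [Field E] [Algebra K k] [Algebra K E] [Algebra k E] [IsScalarTower K k E]
    [Algebra (MvPolynomial σ K) E] [IsScalarTower K (MvPolynomial σ K) E]
    [IsFractionRing (MvPolynomial σ K) E] [Module.Finite k E]
    {f : τ → k} {q : τ → MvPolynomial σ K} {q₀ : MvPolynomial σ K} (hq₀ : q₀ ≠ 0)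
    (hf : ∀ i, algebraMap k E (f i) * algebraMap (MvPolynomial σ K) E q₀ = algebraMap (MvPolynomial σ K) E (q i))
    (hfrac : ∀ z : k, ∃ r s : MvPolynomial τ K, aeval f s ≠ 0 ∧ z * aeval f s = aeval f r) :
    ∃ H : MvPolynomial τ K, aeval f H ≠ 0 ∧ ∀ y : τ → K,
      (∀ r, aeval f r = 0 → eval y r = 0) → eval y H ≠ 0 →
      {a : σ → K | eval a q₀ ≠ 0 ∧ ∀ i, eval a (q i) = y i * eval a q₀}.encard =
        Module.finrank k E := by
  have hinj := IsFractionRing.injective (MvPolynomial σ K) E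
  haveI : CharZero k := charZero_of_injective_algebraMap (algebraMap K k).injective
  obtain ⟨θ, hθ⟩ := Field.exists_primitive_element k E
  have halg : ∀ z : E, IsAlgebraic k z := Algebra.IsAlgebraic.isAlgebraic
  have hθpoly : ∀ z : E, ∃ P : Polynomial k, Polynomial.aeval θ P = z := fun z =>
    exists_aeval_eq_of_mem_adjoin (halg θ) (by rw [hθ]; trivial)
  have hinv : ∀ d : E, d ≠ 0 → ∃ P : Polynomial k, Polynomial.aeval d P * d = 1 := fun d hd => by
    obtain ⟨P, hP⟩ := exists_aeval_eq_of_mem_adjoin (halg d)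
      (inv_mem (IntermediateField.mem_adjoin_simple_self k d))
    exact ⟨P, by rw [hP, inv_mul_cancel₀ hd]⟩
  obtain ⟨num, den, hden, hnd⟩ := IsFractionRing.div_surjective (A := MvPolynomial σ K) θ
  have hden0 : den ≠ 0 := nonZeroDivisors.ne_zero hden
  have hden' : algebraMap (MvPolynomial σ K) E den ≠ 0 := by
    rwa [Ne, map_eq_zero_iff _ hinj]
  have hθ' : θ * algebraMap (MvPolynomial σ K) E den = algebraMap (MvPolynomial σ K) E num := by
    rw [← hnd, div_mul_cancel₀ _ hden']
  choose ξ hξ using fun i => hθpoly (algebraMap (MvPolynomial σ K) E (X i))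
  obtain ⟨P₀, hP₀⟩ := hinv (algebraMap (MvPolynomial σ K) E q₀) (by rwa [Ne, map_eq_zero_iff _ hinj])
  obtain ⟨P₁, hP₁⟩ := hinv (algebraMap (MvPolynomial σ K) E den) hden'
  have hsep : (minpoly k θ).Separable := Algebra.IsSeparable.isSeparable k θ
  obtain ⟨U, W, hUW⟩ := hsep
  choose r s hs hrs using hfrac
  -- A common denominator of the coefficients of `p`. Where these denominators do not vanish, all
  -- the polynomials used to describe the fibre have coefficients in the local ring of `y`.
  let D : Polynomial k → MvPolynomial τ K := fun p => ∏ m ∈ p.support, s (p.coeff m)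
  have hD : ∀ p, aeval f (D p) ≠ 0 := fun p => by
    rw [map_prod]
    exact Finset.prod_ne_zero_iff.mpr fun m _ => hs _
  refine ⟨D (minpoly k θ) * D U * D W * D P₀ * D P₁ * ∏ i, D (ξ i), ?_, fun y hy hH => ?_⟩
  · simp only [map_mul, map_prod]
    have := Finset.prod_ne_zero_iff.mpr fun i (_ : i ∈ Finset.univ) => hD (ξ i)
    simp only [ne_eq, mul_eq_zero, hD, this, or_self, not_false_eq_true]
  · simp only [map_mul, map_prod, ne_eq, mul_eq_zero, not_or] at hH
    obtain ⟨⟨⟨⟨⟨hμ, hU⟩, hW⟩, h0⟩, h1⟩, hξ1⟩ := hH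
    rw [Finset.prod_eq_zero_iff] at hξ1
    push Not at hξ1
    obtain ⟨V, v, hV, hV'⟩ := exists_specialization (aeval f) y hy
    have hlift : ∀ p : Polynomial k, eval y (D p) ≠ 0 →
        ∃ p' : Polynomial V, p'.map (algebraMap V k) = p := by
      intro p hp
      rw [map_prod, Finset.prod_ne_zero_iff] at hp
      rw [← Polynomial.mem_lifts, Polynomial.lifts_iff_coeff_lifts]
      intro m
      by_cases hm : m ∈ p.support
      · obtain ⟨h, -⟩ := hV _ _ _ (hp m hm) (hrs (p.coeff m))
        exact ⟨⟨_, h⟩, rfl⟩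
      · rw [Polynomial.notMem_support_iff.mp hm]
        exact ⟨0, map_zero _⟩
    obtain ⟨μ', hμ'⟩ := hlift _ hμ
    obtain ⟨U', rfl⟩ := hlift _ hU
    obtain ⟨W', rfl⟩ := hlift _ hW
    obtain ⟨P₀', rfl⟩ := hlift _ h0
    obtain ⟨P₁', rfl⟩ := hlift _ h1
    choose ξ' hξ' using fun i => hlift (ξ i) (hξ1 i (Finset.mem_univ i))
    rw [encard_fiber_of_specialization hinj hq₀ hden0 hf V v hV hV' hθ' μ' U' W' P₀' P₁' ξ' hμ'
      (halg θ).isIntegral]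
    · rw [(Field.primitive_element_iff_minpoly_natDegree_eq k θ).mp hθ]
    · apply Polynomial.map_injective (algebraMap V k) Subtype.val_injective
      rw [Polynomial.map_add, Polynomial.map_mul, Polynomial.map_mul, ← Polynomial.derivative_map,
        hμ', hUW, Polynomial.map_one]
    · simpa using hP₀
    · simpa using hP₁
    · intro i
      rw [← hξ, ← hξ', Polynomial.aeval_map_algebraMap]

end FiberCount

/-! ### Local rings of the projective plane in linear charts -/

section PlaneChart

variable {L : Type*} [Field L]

/-- The action of a matrix on vectors with entries in an algebra. -/
def matAct {R : Type*} [CommRing R] [Algebra L R] (M : Matrix (Fin 3) (Fin 3) L) (t : Fin 3 → R) :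
    Fin 3 → R := fun i => ∑ j, algebraMap L R (M i j) * t j

theorem matAct_matAct {R : Type*} [CommRing R] [Algebra L R] {M N : Matrix (Fin 3) (Fin 3) L}
    (h : M * N = 1) (t : Fin 3 → R) : matAct M (matAct N t) = t := by
  funext i
  simp only [matAct, Finset.mul_sum]
  rw [Finset.sum_comm]
  have h1 : ∀ j, ∑ k, algebraMap L R (M i k) * (algebraMap L R (N k j) * t j) =
      algebraMap L R ((M * N) i j) * t j := by
    intro j
    rw [Matrix.mul_apply, map_sum, Finset.sum_mul]
    exact Finset.sum_congr rfl fun k _ => by rw [map_mul, mul_assoc]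
  simp only [h1, h, Matrix.one_apply]
  simp

theorem matAct_mul {R : Type*} [CommRing R] [Algebra L R] (M : Matrix (Fin 3) (Fin 3) L) (r : R)
    (t : Fin 3 → R) (i : Fin 3) : matAct M (fun j => r * t j) i = r * matAct M t i := by
  simp only [matAct, Finset.mul_sum]
  exact Finset.sum_congr rfl fun k _ => by ring

theorem map_matAct {R S : Type*} [CommRing R] [Algebra L R] [CommRing S] [Algebra L S]
    (φ : R →ₐ[L] S) (M : Matrix (Fin 3) (Fin 3) L) (t : Fin 3 → R) (i : Fin 3) :
    φ (matAct M t i) = matAct M (fun j => φ (t j)) i := by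
  simp only [matAct, map_sum, map_mul, AlgHom.commutes]

/-- The affine chart of the plane inverse to the coordinates given by the inverse of `N`. -/
def chartMap (N : Matrix (Fin 3) (Fin 3) L) : Fin 3 → MvPolynomial (Fin 2) L :=
  matAct N ![X 0, X 1, 1]

theorem map_chartMap {R : Type*} [CommRing R] [Algebra L R] (φ : MvPolynomial (Fin 2) L →ₐ[L] R)
    (N : Matrix (Fin 3) (Fin 3) L) (i : Fin 3) :
    φ (chartMap N i) = matAct N ![φ (X 0), φ (X 1), 1] i := by
  rw [chartMap, map_matAct]
  congr 1
  funext j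
  fin_cases j <;> simp

theorem eval_chartMap (a : Fin 2 → L) (N : Matrix (Fin 3) (Fin 3) L) (i : Fin 3) :
    eval a (chartMap N i) = matAct N ![a 0, a 1, 1] i := by
  have h := map_chartMap (aeval a : MvPolynomial (Fin 2) L →ₐ[L] L) N i
  simpa [coe_aeval_eq_eval] using h

/-- Evaluation of germs at a point. -/
theorem exists_localization_pointIdeal_algHom (a : Fin 2 → L) :
    ∃ ρ : Localization.AtPrime (pointIdeal a) →ₐ[L] L,
      (∀ g, ρ (algebraMap (MvPolynomial (Fin 2) L) _ g) = eval a g) ∧ ∀ x, ρ x ≠ 0 → IsUnit x := by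
  have hu : ∀ y : (pointIdeal a).primeCompl,
      IsUnit ((aeval a : MvPolynomial (Fin 2) L →ₐ[L] L) (y : MvPolynomial (Fin 2) L)) := by
    intro y
    rw [isUnit_iff_ne_zero]
    exact fun h => y.2 (show eval a (y : MvPolynomial (Fin 2) L) = 0 by
      simpa [coe_aeval_eq_eval] using h)
  set ρ : Localization.AtPrime (pointIdeal a) →ₐ[L] L :=
    IsLocalization.liftAlgHom (M := (pointIdeal a).primeCompl) (f := aeval a) hu with hρ
  have hρg : ∀ g, ρ (algebraMap (MvPolynomial (Fin 2) L) _ g) = eval a g := by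
    intro g
    rw [hρ, IsLocalization.liftAlgHom_apply, IsLocalization.lift_eq]
    simp [coe_aeval_eq_eval]
  refine ⟨ρ, hρg, fun x hx => ?_⟩
  by_contra hxu
  have hmax : (RingHom.ker ρ).IsMaximal := RingHom.ker_isMaximal_of_surjective ρ
    fun c => ⟨algebraMap L _ c, by rw [AlgHom.commutes]; rfl⟩
  have := IsLocalRing.eq_maximalIdeal hmax
  have hx' : x ∈ IsLocalRing.maximalIdeal (Localization.AtPrime (pointIdeal a)) := hxu
  rw [← this, RingHom.mem_ker] at hx'
  exact hx hx'

/-- The comparison of the local rings of the plane in two charts. -/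
theorem exists_chart_algHom {M N N' : Matrix (Fin 3) (Fin 3) L} (hMN : M * N = 1)
    (hNM : N * M = 1) {v : Fin 3 → L} {a a' : Fin 2 → L} {s s' : L} (hs : s ≠ 0) (hs' : s' ≠ 0)
    (ha : ∀ i, s * v i = eval a (chartMap N i)) (ha' : ∀ i, s' * v i = eval a' (chartMap N' i)) :
    ∃ (φ : Localization.AtPrime (pointIdeal a) →ₐ[L] Localization.AtPrime (pointIdeal a'))
      (w : Localization.AtPrime (pointIdeal a')), IsUnit w ∧
      ∀ i, φ (algebraMap (MvPolynomial (Fin 2) L) _ (chartMap N i)) =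
        w * algebraMap (MvPolynomial (Fin 2) L) _ (chartMap N' i) := by
  obtain ⟨ρ, hρ, hρu⟩ := exists_localization_pointIdeal_algHom a'
  have hMv : ∀ j, s * matAct M v j = ![a 0, a 1, 1] j := by
    intro j
    rw [← matAct_mul, show (fun i => s * v i) = matAct N ![a 0, a 1, 1] from
      funext fun i => by rw [ha, eval_chartMap], matAct_matAct hMN]
  set c' : Fin 3 → Localization.AtPrime (pointIdeal a') :=
    fun i => algebraMap (MvPolynomial (Fin 2) L) _ (chartMap N' i) with hc'
  have hρM : ∀ j, ρ (matAct M c' j) = s' * matAct M v j := by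
    intro j
    rw [map_matAct, ← matAct_mul]
    congr 1
    funext i
    rw [hc', hρ, ha']
  -- The linear form that equals `1` in the first chart does not vanish at `v`, so it is a unit in
  -- the local ring of the other chart; `w` is its inverse.
  have hM2 : s * matAct M v 2 = 1 := hMv 2
  have hM2' : matAct M v 2 ≠ 0 := right_ne_zero_of_mul_eq_one hM2
  obtain ⟨d, hd⟩ := hρu (matAct M c' 2) (by rw [hρM]; exact mul_ne_zero hs' hM2')
  set w : Localization.AtPrime (pointIdeal a') := ↑d⁻¹ with hw
  have hwd : w * matAct M c' 2 = 1 := by rw [← hd, hw, Units.inv_mul]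
  have hρw : ρ w * s' = s := by
    have h := congrArg ρ hwd
    rw [map_mul, hρM, map_one, ← hM2, ← mul_assoc] at h
    exact mul_right_cancel₀ hM2' h
  set φ₀ : MvPolynomial (Fin 2) L →ₐ[L] Localization.AtPrime (pointIdeal a') :=
    aeval fun k => w * matAct M c' (Fin.castSucc k) with hφ₀
  have hρφ : ∀ g, ρ (φ₀ g) = eval a g := by
    intro g
    have : ρ.comp φ₀ = aeval a := by
      refine MvPolynomial.algHom_ext fun k => ?_
      rw [AlgHom.comp_apply, hφ₀, aeval_X, aeval_X, map_mul, hρM, ← mul_assoc, hρw, hMv]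
      fin_cases k <;> rfl
    have h := DFunLike.congr_fun this g
    simpa [coe_aeval_eq_eval] using h
  have hu : ∀ y : (pointIdeal a).primeCompl, IsUnit (φ₀ (y : MvPolynomial (Fin 2) L)) :=
    fun y => hρu _ (by rw [hρφ]; exact y.2)
  refine ⟨IsLocalization.liftAlgHom (M := (pointIdeal a).primeCompl) (f := φ₀) hu, w,
    Units.isUnit _, fun i => ?_⟩
  rw [IsLocalization.liftAlgHom_apply, IsLocalization.lift_eq]
  change φ₀ (chartMap N i) = _
  rw [map_chartMap, show (![φ₀ (X 0), φ₀ (X 1), 1] : Fin 3 → _) = fun j => w * matAct M c' j from ?_,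
    matAct_mul, matAct_matAct hNM]
  funext j
  fin_cases j
  · simp [hφ₀]
  · simp [hφ₀]
  · simpa using hwd.symm

/-- The composite of the two comparison maps multiplies the homogeneous coordinates by a common
factor, which must be `1` because the last coordinate is `1` in the chart. A form of degree `n`
changes by the `n`-th power of a unit. -/
theorem exists_chart_algEquiv {M N M' N' : Matrix (Fin 3) (Fin 3) L} (hMN : M * N = 1)
    (hNM : N * M = 1) (hMN' : M' * N' = 1) (hNM' : N' * M' = 1)
    {v : Fin 3 → L} {a a' : Fin 2 → L} {s s' : L} (hs : s ≠ 0) (hs' : s' ≠ 0)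
    (ha : ∀ i, s * v i = eval a (chartMap N i)) (ha' : ∀ i, s' * v i = eval a' (chartMap N' i)) :
    ∃ e : Localization.AtPrime (pointIdeal a) ≃ₐ[L] Localization.AtPrime (pointIdeal a'),
      ∀ (f : MvPolynomial (Fin 3) L) (n : ℕ), f.IsHomogeneous n →
      Associated (e (algebraMap (MvPolynomial (Fin 2) L) _ (aeval (chartMap N) f)))
        (algebraMap (MvPolynomial (Fin 2) L) _ (aeval (chartMap N') f)) := by
  have key : ∀ {M N N' : Matrix (Fin 3) (Fin 3) L} {a a' : Fin 2 → L}
      (φ : Localization.AtPrime (pointIdeal a) →ₐ[L] Localization.AtPrime (pointIdeal a'))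
      (ψ : Localization.AtPrime (pointIdeal a') →ₐ[L] Localization.AtPrime (pointIdeal a))
      (w w') (_ : M * N = 1), 
      (∀ i, φ (algebraMap (MvPolynomial (Fin 2) L) _ (chartMap N i)) =
        w * algebraMap (MvPolynomial (Fin 2) L) _ (chartMap N' i)) →
      (∀ i, ψ (algebraMap (MvPolynomial (Fin 2) L) _ (chartMap N' i)) =
        w' * algebraMap (MvPolynomial (Fin 2) L) _ (chartMap N i)) →
      ψ.comp φ = AlgHom.id L _ := by
    intro M N N' a a' φ ψ w w' hMN hφ hψ
    set X' : Fin 3 → Localization.AtPrime (pointIdeal a) :=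
      ![algebraMap (MvPolynomial (Fin 2) L) _ (X 0), algebraMap (MvPolynomial (Fin 2) L) _ (X 1), 1]
      with hX'
    have hc : ∀ i, algebraMap (MvPolynomial (Fin 2) L) (Localization.AtPrime (pointIdeal a))
        (chartMap N i) = matAct N X' i := fun i =>
      map_chartMap (IsScalarTower.toAlgHom L (MvPolynomial (Fin 2) L) _) N i
    have h1 : ∀ i, matAct N (fun j => ψ (φ (X' j))) i = ψ w * w' * matAct N X' i := by
      intro i
      have h := map_matAct (ψ.comp φ) N X' i
      rw [← hc, AlgHom.comp_apply, hφ, map_mul, hψ, ← mul_assoc, hc] at h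
      exact h.symm
    have h2 : ∀ j, ψ (φ (X' j)) = ψ w * w' * X' j := by
      intro j
      have h := congrFun (matAct_matAct hMN (fun j => ψ (φ (X' j)))) j
      rw [← h, show matAct N (fun j => ψ (φ (X' j))) = fun i => ψ w * w' * matAct N X' i from
        funext h1, matAct_mul, matAct_matAct hMN]
    have h3 : ψ w * w' = 1 := by
      have := h2 2
      simpa [hX'] using this.symm
    refine IsLocalization.algHom_ext (pointIdeal a).primeCompl ?_
    refine MvPolynomial.algHom_ext fun k => ?_
    have := h2 (Fin.castSucc k)
    rw [h3, one_mul] at this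
    fin_cases k <;> exact this
  obtain ⟨φ, w, hw, hφ⟩ := exists_chart_algHom hMN hNM hs hs' ha ha'
  obtain ⟨ψ, w', hw', hψ⟩ := exists_chart_algHom hMN' hNM' hs' hs ha' ha
  refine ⟨AlgEquiv.ofAlgHom φ ψ (key ψ φ w' w hMN' hψ hφ) (key φ ψ w w' hMN hφ hψ),
    fun f n hf => ?_⟩
  have h4 : φ (algebraMap (MvPolynomial (Fin 2) L) _ (aeval (chartMap N) f)) =
      w ^ n * algebraMap (MvPolynomial (Fin 2) L) _ (aeval (chartMap N') f) := by
    rw [← aeval_algebraMap_apply, ← aeval_algebraMap_apply, ← aeval_mul_of_isHomogeneous hf,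
      ← AlgHom.comp_apply, comp_aeval]
    exact congrArg (fun x => aeval x f) (funext hφ)
  change Associated (φ _) _
  rw [h4]
  exact associated_unit_mul_left _ _ (hw.pow n)

theorem exists_chartMap_eq_insertNth (i₀ : Fin 3) :
    ∃ M N : Matrix (Fin 3) (Fin 3) L, M * N = 1 ∧ N * M = 1 ∧
      chartMap N = i₀.insertNth (1 : MvPolynomial (Fin 2) L) X := by
  have key : ∀ (M N : Matrix (Fin 3) (Fin 3) L), M * N = 1 →
      chartMap N = i₀.insertNth (1 : MvPolynomial (Fin 2) L) X →
      ∃ M N : Matrix (Fin 3) (Fin 3) L, M * N = 1 ∧ N * M = 1 ∧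
      chartMap N = i₀.insertNth (1 : MvPolynomial (Fin 2) L) X :=
    fun M N h h' => ⟨M, N, h, mul_eq_one_comm.mp h, h'⟩
  fin_cases i₀
  · refine key !![0, 1, 0; 0, 0, 1; 1, 0, 0] !![0, 0, 1; 1, 0, 0; 0, 1, 0] ?_ ?_
    · ext i j; fin_cases i <;> fin_cases j <;> simp [Matrix.mul_apply, Fin.sum_univ_succ]
    · funext j; fin_cases j <;> simp [chartMap, matAct, Fin.sum_univ_succ] <;> rfl
  · refine key !![1, 0, 0; 0, 0, 1; 0, 1, 0] !![1, 0, 0; 0, 0, 1; 0, 1, 0] ?_ ?_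
    · ext i j; fin_cases i <;> fin_cases j <;> simp [Matrix.mul_apply, Fin.sum_univ_succ]
    · funext j; fin_cases j <;> simp [chartMap, matAct, Fin.sum_univ_succ] <;> rfl
  · refine key !![1, 0, 0; 0, 1, 0; 0, 0, 1] !![1, 0, 0; 0, 1, 0; 0, 0, 1] ?_ ?_
    · ext i j; fin_cases i <;> fin_cases j <;> simp [Matrix.mul_apply, Fin.sum_univ_succ]
    · funext j; fin_cases j <;> simp [chartMap, matAct, Fin.sum_univ_succ] <;> rfl

/-- The chart of the plane on the complement of the line `α t₀ + β t₁ + t₂ = 0`. -/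
def lineChart (α β : L) : Fin 3 → MvPolynomial (Fin 2) L :=
  ![X 0, X 1, 1 - C α * X 0 - C β * X 1]

/-- The affine coordinates in the chart `lineChart`. -/
def lineCoord (α β : L) (v : Fin 3 → L) : Fin 2 → L :=
  ![v 0 / (α * v 0 + β * v 1 + v 2), v 1 / (α * v 0 + β * v 1 + v 2)]

theorem exists_lineChart_matrix (α β : L) :
    ∃ M N : Matrix (Fin 3) (Fin 3) L, M * N = 1 ∧ N * M = 1 ∧ chartMap N = lineChart α β := by
  have h : !![1, 0, 0; 0, 1, 0; α, β, 1] * !![1, 0, 0; 0, 1, 0; -α, -β, 1] =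
      (1 : Matrix (Fin 3) (Fin 3) L) := by
    ext i j; fin_cases i <;> fin_cases j <;> simp [Matrix.mul_apply, Fin.sum_univ_succ]
  refine ⟨_, _, h, mul_eq_one_comm.mp h, ?_⟩
  funext j
  fin_cases j
  · simp [chartMap, matAct, Fin.sum_univ_succ, lineChart]
  · simp [chartMap, matAct, Fin.sum_univ_succ, lineChart]
  · simp [chartMap, matAct, Fin.sum_univ_succ, lineChart, algebraMap_eq]
    ring

theorem eval_lineChart_lineCoord {α β : L} {v : Fin 3 → L} (hv : α * v 0 + β * v 1 + v 2 ≠ 0)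
    (i : Fin 3) : eval (lineCoord α β v) (lineChart α β i) =
      (α * v 0 + β * v 1 + v 2)⁻¹ * v i := by
  fin_cases i
  · simp [lineChart, lineCoord, div_eq_inv_mul]
  · simp [lineChart, lineCoord, div_eq_inv_mul]
  · simp [lineChart, lineCoord]
    field_simp
    ring

theorem exists_planeLocalRing_algEquiv (A : ℙ L (Fin 3 → L)) {v : Fin 3 → L} {r : L}
    (hA : ∀ i, A.rep i = r * v i) {α β : L} (hv : α * v 0 + β * v 1 + v 2 ≠ 0) :
    ∃ e : PlaneLocalRing A ≃ₐ[L] Localization.AtPrime (pointIdeal (lineCoord α β v)),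
      ∀ (f : MvPolynomial (Fin 3) L) (n : ℕ), f.IsHomogeneous n →
      Associated (e (localEquation A f))
        (algebraMap (MvPolynomial (Fin 2) L) _ (aeval (lineChart α β) f)) := by
  obtain ⟨M, N, hMN, hNM, hN⟩ := exists_chartMap_eq_insertNth (L := L) (chartIndex A)
  obtain ⟨M', N', hMN', hNM', hN'⟩ := exists_lineChart_matrix α β
  have hne := rep_chartIndex_ne_zero A
  have hr : r ≠ 0 := fun h => hne (by rw [hA, h, zero_mul])
  obtain ⟨e, he⟩ := exists_chart_algEquiv (v := v) (a := affineCoord A) (a' := lineCoord α β v)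
    (s := r / A.rep (chartIndex A)) (s' := (α * v 0 + β * v 1 + v 2)⁻¹)
    hMN hNM hMN' hNM' (div_ne_zero hr hne) (inv_ne_zero hv) (fun i => by
      rw [hN, div_mul_eq_mul_div, ← hA]
      induction i using Fin.succAboveCases (chartIndex A) with
      | x => simp [hne]
      | p i => simp [affineCoord]) (fun i => by rw [hN', eval_lineChart_lineCoord hv])
  rw [hN, hN'] at he
  exact ⟨e, he⟩

end PlaneChart

/-! ### Multiplicities at base points in an affine chart -/

section Transport

theorem Ideal.map_span_range_of_associated {R S ι F : Type*} [CommRing R] [CommRing S]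
    [FunLike F R S] [RingHomClass F R S] (e : F) (f : ι → R) (g : ι → S)
    (h : ∀ i, Associated (e (f i)) (g i)) :
    (Ideal.span (Set.range f)).map e = Ideal.span (Set.range g) := by
  rw [Ideal.map_span]
  apply le_antisymm <;> rw [Ideal.span_le]
  · rintro _ ⟨_, ⟨i, rfl⟩, rfl⟩
    exact Ideal.mem_of_dvd _ (h i).symm.dvd (Ideal.subset_span ⟨i, rfl⟩)
  · rintro _ ⟨i, rfl⟩
    exact Ideal.mem_of_dvd _ (h i).dvd (Ideal.subset_span ⟨f i, ⟨i, rfl⟩, rfl⟩)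

theorem IsHilbertSamuelMult.of_algEquiv {L R S : Type*} [Field L] [CommRing R] [Algebra L R]
    [CommRing S] [Algebra L S] (e : R ≃ₐ[L] S) {I : Ideal R} {m : ℕ}
    (h : IsHilbertSamuelMult L (I.map e) m) : IsHilbertSamuelMult L I m := by
  have hd : ∀ d : ℕ, Nonempty ((R ⧸ I ^ (d + 1)) ≃ₐ[L] S ⧸ (I.map e) ^ (d + 1)) := fun d =>
    ⟨Ideal.quotientEquivAlg _ _ e (Ideal.map_pow e I _).symm⟩
  refine ⟨fun d => ?_, ?_⟩
  · have := h.1 d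
    exact Module.Finite.equiv (hd d).some.symm.toLinearEquiv
  · simp only [fun d => (hd d).some.toLinearEquiv.finrank_eq]
    exact h.2

variable {K : Type*} [Field K] {p : Fin 4 → MvPolynomial (Fin 3) K} {n : ℕ}

theorem isHomogeneous_genericCurve (hp : ∀ i, (p i).IsHomogeneous n) (k : Fin 2) :
    (genericCurve p k).IsHomogeneous n := by
  refine IsHomogeneous.sum _ _ _ fun i _ => ?_
  simpa using (isHomogeneous_C (Fin 3) (genericCoeff K k i)).mul ((hp i).map _)

theorem aeval_lineChart_map {F : Type*} [Field F] [Algebra K F] (α β : K)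
    (f : MvPolynomial (Fin 3) K) :
    aeval (lineChart (algebraMap K F α) (algebraMap K F β)) (map (algebraMap K F) f) =
      map (algebraMap K F) (aeval (lineChart α β) f) := by
  rw [aeval_map_algebraMap]
  have h : (mapAlgHom (Algebra.ofId K F)).comp (aeval (lineChart α β)) =
      (aeval (lineChart (algebraMap K F α) (algebraMap K F β)) :
        MvPolynomial (Fin 3) K →ₐ[K] MvPolynomial (Fin 2) F) := by
    refine MvPolynomial.algHom_ext fun i => ?_
    rw [AlgHom.comp_apply, aeval_X, aeval_X]
    fin_cases i <;> simp [lineChart, mapAlgHom_apply] <;> rfl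
  exact (DFunLike.congr_fun h f).symm

theorem aeval_lineChart_genericCurve (α β : K) (k : Fin 2) :
    aeval (lineChart (algebraMap K (GenericField K) α) (algebraMap K (GenericField K) β))
      (genericCurve p k) = linearSection (fun z => genericCoeff K z.1 z.2)
        (fun i => aeval (lineChart α β) (p i)) k := by
  rw [genericCurve, linearSection, map_sum]
  refine Finset.sum_congr rfl fun i _ => ?_
  rw [map_mul, aeval_lineChart_map, ← algebraMap_eq, AlgHom.commutes, algebraMap_eq]

theorem exists_mk_rep_eq {L : Type*} [Field L] {m : ℕ} (v : Fin m → L) (hv : v ≠ 0) :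
    ∃ r : L, r ≠ 0 ∧ ∀ i, (Projectivization.mk L v hv).rep i = r * v i := by
  obtain ⟨r, hr⟩ := Projectivization.exists_smul_eq_mk_rep L v hv
  exact ⟨r, r.ne_zero, fun i => (congrFun hr i).symm⟩

theorem exists_extendPoint_rep (A : ℙ K (Fin 3 → K)) :
    ∃ r : GenericField K, ∀ i, (extendPoint A).rep i = r * algebraMap K _ (A.rep i) := by
  obtain ⟨r, -, hr⟩ := exists_mk_rep_eq _ (algebraMap_rep_ne_zero A)
  exact ⟨r, hr⟩

theorem exists_quotient_span_algEquiv {L ι : Type*} [Field L] (A : ℙ L (Fin 3 → L))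
    {v : Fin 3 → L} {r : L} (hA : ∀ i, A.rep i = r * v i) {α β : L}
    (hv : α * v 0 + β * v 1 + v 2 ≠ 0) {a : Fin 2 → L} (ha : lineCoord α β v = a)
    (f : ι → MvPolynomial (Fin 3) L) (hf : ∀ i, (f i).IsHomogeneous n) :
    Nonempty ((PlaneLocalRing A ⧸ Ideal.span (Set.range fun i => localEquation A (f i))) ≃ₐ[L]
      Localization.AtPrime (pointIdeal a) ⧸
        (Ideal.span (Set.range fun i => aeval (lineChart α β) (f i))).map
          (algebraMap (MvPolynomial (Fin 2) L) (Localization.AtPrime (pointIdeal a)))) := by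
  subst ha
  obtain ⟨e, he⟩ := exists_planeLocalRing_algEquiv A hA hv
  have h : (Ideal.span (Set.range fun i => localEquation A (f i))).map e =
      (Ideal.span (Set.range fun i => aeval (lineChart α β) (f i))).map
        (algebraMap (MvPolynomial (Fin 2) L)
          (Localization.AtPrime (pointIdeal (lineCoord α β v)))) := by
    rw [Ideal.map_span_range_of_associated e _ _ fun i => he (f i) n (hf i), Ideal.map_span,
      ← Set.range_comp]
    rfl
  exact ⟨Ideal.quotientEquivAlg _ _ e h.symm⟩

/-- The intersection ring at a base point, in an affine chart. -/
theorem exists_intersectionRing_algEquiv (hp : ∀ i, (p i).IsHomogeneous n) (A : ℙ K (Fin 3 → K))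
    {α β : K} (hA : α * A.rep 0 + β * A.rep 1 + A.rep 2 ≠ 0) :
    Nonempty (IntersectionRing (extendPoint A) (genericCurve p 0) (genericCurve p 1)
      ≃ₐ[GenericField K] Localization.AtPrime (pointIdeal fun i =>
        algebraMap K (GenericField K) (lineCoord α β A.rep i)) ⧸
        (linearSectionIdeal (fun z => genericCoeff K z.1 z.2)
          (fun i => aeval (lineChart α β) (p i))).map
          (algebraMap (MvPolynomial (Fin 2) (GenericField K)) (Localization.AtPrime (pointIdeal
            fun i => algebraMap K (GenericField K) (lineCoord α β A.rep i))))) := by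
  obtain ⟨r, hr⟩ := exists_extendPoint_rep A
  have hc : lineCoord (algebraMap K (GenericField K) α) (algebraMap K _ β)
      (fun i => algebraMap K _ (A.rep i)) =
      fun i => algebraMap K (GenericField K) (lineCoord α β A.rep i) := by
    funext i
    fin_cases i <;> simp [lineCoord]
  have h := exists_quotient_span_algEquiv (extendPoint A) hr
    (α := algebraMap K _ α) (β := algebraMap K _ β) (by
      rw [← map_mul, ← map_mul, ← map_add, ← map_add]
      exact (map_ne_zero _).mpr hA) hc (genericCurve p) (isHomogeneous_genericCurve hp)
  have h1 : ({localEquation (extendPoint A) (genericCurve p 0),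
      localEquation (extendPoint A) (genericCurve p 1)} : Set (PlaneLocalRing (extendPoint A))) =
      Set.range fun k => localEquation (extendPoint A) (genericCurve p k) := by
    ext f
    simp [eq_comm]
  rw [show (fun k => aeval (lineChart (algebraMap K (GenericField K) α)
    (algebraMap K (GenericField K) β)) (genericCurve p k)) =
    linearSection (fun z => genericCoeff K z.1 z.2) (fun i => aeval (lineChart α β) (p i)) from
    funext (aeval_lineChart_genericCurve α β)] at h
  obtain ⟨e⟩ := h
  exact ⟨(Ideal.quotientEquivAlgOfEq _ (congrArg Ideal.span h1)).trans e⟩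

/-- The Hilbert–Samuel multiplicity at a base point, in an affine chart. -/
theorem isHilbertSamuelMult_localBaseIdeal (hp : ∀ i, (p i).IsHomogeneous n) (A : ℙ K (Fin 3 → K))
    {α β : K} (hA : α * A.rep 0 + β * A.rep 1 + A.rep 2 ≠ 0) {m : ℕ}
    (h : IsHilbertSamuelMult K ((Ideal.span (Set.range fun i => aeval (lineChart α β) (p i))).map
      (algebraMap (MvPolynomial (Fin 2) K)
        (Localization.AtPrime (pointIdeal (lineCoord α β A.rep))))) m) :
    IsHilbertSamuelMult K (localBaseIdeal p A) m := by
  obtain ⟨e, he⟩ := exists_planeLocalRing_algEquiv A (v := A.rep) (r := 1)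
    (fun i => (one_mul _).symm) hA
  refine IsHilbertSamuelMult.of_algEquiv e ?_
  convert h using 1
  rw [localBaseIdeal, Ideal.map_span_range_of_associated e _ _ fun i => he (p i) n (hp i),
    Ideal.map_span, ← Set.range_comp]
  rfl

end Transport

/-! ### Elimination of a variable -/

section Elimination

/-- By Gauss's lemma `f` stays irreducible and does not divide `g` over the fraction field. Clearing
denominators in a Bézout identity there gives the constant. A constant polynomial `f` serves itself.
-/
theorem Polynomial.exists_C_mem_span_pair {A : Type*} [CommRing A] [IsDomain A]
    [UniqueFactorizationMonoid A] {f g : Polynomial A} (hf : Irreducible f) (hfg : ¬ f ∣ g) :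
    ∃ r : A, r ≠ 0 ∧ Polynomial.C r ∈ Ideal.span {f, g} := by
  by_cases hdeg : f.natDegree = 0
  · have hC := Polynomial.eq_C_of_natDegree_eq_zero hdeg
    exact ⟨f.coeff 0, fun h => hf.ne_zero (by rw [hC, h, Polynomial.C_0]),
      hC ▸ Ideal.subset_span (by simp)⟩
  · obtain ⟨_⟩ : Nonempty (NormalizedGCDMonoid A) := inferInstance
    let E := FractionRing A
    have hprim : f.IsPrimitive := hf.isPrimitive hdeg
    have hirr := (hprim.irreducible_iff_irreducible_map_fraction_map (K := E)).mp hf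
    have hnd : ¬ f.map (algebraMap A E) ∣ g.map (algebraMap A E) := fun h =>
      hfg (hprim.dvd_of_fraction_map_dvd_fraction_map h)
    obtain ⟨a, b, hab⟩ := (hirr.coprime_iff_not_dvd).mpr hnd
    obtain ⟨⟨s, hs⟩, hsa⟩ := IsLocalization.integerNormalization_map_to_map (nonZeroDivisors A) a
    obtain ⟨⟨t, ht⟩, htb⟩ := IsLocalization.integerNormalization_map_to_map (nonZeroDivisors A) b
    refine ⟨s * t, mul_ne_zero (nonZeroDivisors.ne_zero hs) (nonZeroDivisors.ne_zero ht), ?_⟩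
    rw [Ideal.mem_span_pair]
    refine ⟨Polynomial.C t * IsLocalization.integerNormalization (nonZeroDivisors A) a,
      Polynomial.C s * IsLocalization.integerNormalization (nonZeroDivisors A) b, ?_⟩
    apply Polynomial.map_injective _ (IsFractionRing.injective A E)
    simp only [Polynomial.map_add, Polynomial.map_mul, Polynomial.map_C, hsa, htb, map_mul]
    rw [Algebra.smul_def, Algebra.smul_def, Polynomial.algebraMap_apply,
      Polynomial.algebraMap_apply]
    linear_combination (Polynomial.C (algebraMap A E s) * Polynomial.C (algebraMap A E t)) * hab

variable {K σ : Type*} [Field K]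

/-- Elimination of a variable. -/
theorem MvPolynomial.exists_rename_mem_span_pair [Finite σ] [DecidableEq σ]
    {f g : MvPolynomial σ K} (hf : Irreducible f) (hfg : ¬ f ∣ g) (k : σ) :
    ∃ R : MvPolynomial {l // l ≠ k} K, R ≠ 0 ∧ rename Subtype.val R ∈ Ideal.span {f, g} := by
  let e : MvPolynomial σ K ≃ₐ[K] Polynomial (MvPolynomial {l // l ≠ k} K) :=
    (renameEquiv K (Equiv.optionSubtypeNe k).symm).trans (optionEquivLeft K _)
  obtain ⟨r, hr, hmem⟩ := Polynomial.exists_C_mem_span_pair (f := e f) (g := e g)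
    ((MulEquiv.irreducible_iff e).mpr hf) (fun h => hfg ((map_dvd_iff e).mp h))
  refine ⟨r, hr, ?_⟩
  have he : ∀ R, e (rename Subtype.val R) = Polynomial.C R := by
    intro R
    induction R using MvPolynomial.induction_on with
    | C c => simp [e]
    | add p q hp hq => simp only [map_add, hp, hq]
    | mul_X p j hp =>
      simp only [map_mul, hp, rename_X]
      congr 1
      simp [e, j.2]
  rw [Ideal.mem_span_pair] at hmem ⊢
  obtain ⟨a, b, hab⟩ := hmem
  refine ⟨e.symm a, e.symm b, e.injective ?_⟩
  simp [hab, he]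

/-- Induction over the prime factors of one non-zero `p l`: each prime fails to divide some
generator, so it has an eliminant with that generator, and the product of the eliminants lies in the
ideal. -/
theorem MvPolynomial.exists_rename_mem_span_range [Finite σ] [DecidableEq σ] {ι : Type*}
    {p : ι → MvPolynomial σ K} (hp : ∀ f, Irreducible f → ∃ l, ¬ f ∣ p l) (k : σ) :
    ∃ R : MvPolynomial {l // l ≠ k} K, R ≠ 0 ∧ rename Subtype.val R ∈ Ideal.span (Set.range p) := by
  have key : ∀ g : MvPolynomial σ K, g ≠ 0 → ∃ R : MvPolynomial {l // l ≠ k} K, R ≠ 0 ∧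
      rename Subtype.val R ∈ Ideal.span {g} ⊔ Ideal.span (Set.range p) := by
    intro g
    induction g using UniqueFactorizationMonoid.induction_on_prime with
    | h₁ => exact fun h => absurd rfl h
    | h₂ g hg =>
      intro _
      refine ⟨1, one_ne_zero, ?_⟩
      rw [Ideal.span_singleton_eq_top.mpr hg, top_sup_eq]
      trivial
    | h₃ g f hg hf ih =>
      intro _
      obtain ⟨R, hR, hRmem⟩ := ih hg
      obtain ⟨l, hl⟩ := hp f hf.irreducible
      obtain ⟨R', hR', hRmem'⟩ := exists_rename_mem_span_pair hf.irreducible hl k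
      refine ⟨R' * R, mul_ne_zero hR' hR, ?_⟩
      obtain ⟨a, b, hab⟩ := Ideal.mem_span_pair.mp hRmem'
      obtain ⟨y, hy, z, hz, hyz⟩ := Submodule.mem_sup.mp hRmem
      obtain ⟨c, rfl⟩ := Ideal.mem_span_singleton'.mp hy
      rw [map_mul, ← hab, ← hyz]
      have : (a * f + b * p l) * (c * g + z) = (a * c) * (f * g) +
          (p l * (b * (c * g)) + (a * f + b * p l) * z) := by ring
      rw [this]
      refine Submodule.add_mem_sup (Ideal.mul_mem_left _ _ (Ideal.mem_span_singleton_self _)) ?_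
      exact Ideal.add_mem _ (Ideal.mul_mem_right _ _ (Ideal.subset_span ⟨l, rfl⟩))
        (Ideal.mul_mem_left _ _ hz)
  by_cases h0 : ∀ l, p l = 0
  · obtain ⟨l, hl⟩ := hp (X k) (X_prime (i := k)).irreducible
    exact absurd (h0 l ▸ dvd_zero _) hl
  · push Not at h0
    obtain ⟨l, hl⟩ := h0
    obtain ⟨R, hR, h⟩ := key (p l) hl
    refine ⟨R, hR, ?_⟩
    rwa [sup_eq_right.mpr] at h
    rw [Ideal.span_singleton_le_iff_mem]
    exact Ideal.subset_span ⟨l, rfl⟩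

end Elimination

/-! ### Finiteness of the base points and choice of a line at infinity -/

section BasePoints

theorem totalDegree_prod_pow_le_and_homogeneousComponent {σ ι R : Type*} [CommSemiring R]
    {c : ι → MvPolynomial σ R} (hc : ∀ i, (c i).totalDegree ≤ 1) (d : ι → ℕ) (s : Finset ι) :
    (∏ i ∈ s, c i ^ d i).totalDegree ≤ ∑ i ∈ s, d i ∧
      homogeneousComponent (∑ i ∈ s, d i) (∏ i ∈ s, c i ^ d i) =
        ∏ i ∈ s, homogeneousComponent 1 (c i) ^ d i := by
  classical
  induction s using Finset.induction_on with
  | empty =>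
    simp only [Finset.prod_empty, Finset.sum_empty, totalDegree_one, le_refl, true_and]
    rw [homogeneousComponent_zero, coeff_zero_one, map_one]
  | insert a s ha ih =>
    have h := totalDegree_pow_le_and_homogeneousComponent_pow (hc a) (d a)
    rw [one_mul] at h
    rw [Finset.prod_insert ha, Finset.sum_insert ha, Finset.prod_insert ha]
    exact ⟨(totalDegree_mul _ _).trans (add_le_add h.1 ih.1), by
      rw [homogeneousComponent_mul_of_totalDegree_le h.1 ih.1, h.2, ih.2]⟩

theorem totalDegree_aeval_le_and_homogeneousComponent {σ ι R : Type*} [CommSemiring R] [Fintype ι]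
    {c : ι → MvPolynomial σ R} (hc : ∀ i, (c i).totalDegree ≤ 1) {f : MvPolynomial ι R} {n : ℕ}
    (hf : f.IsHomogeneous n) :
    (aeval c f).totalDegree ≤ n ∧
      homogeneousComponent n (aeval c f) = aeval (fun i => homogeneousComponent 1 (c i)) f := by
  have hn : ∀ d ∈ f.support, ∑ i, d i = n := by
    intro d hd
    rw [← Finsupp.degree_eq_sum]
    by_contra h
    exact mem_support_iff.mp hd (hf.coeff_eq_zero h)
  rw [aeval_def, aeval_def, eval₂_eq', eval₂_eq']
  simp only [algebraMap_eq]
  refine ⟨totalDegree_finsetSum_le fun d hd => ?_, ?_⟩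
  · have h := totalDegree_prod_pow_le_and_homogeneousComponent hc d Finset.univ
    rw [hn d hd] at h
    exact (totalDegree_mul _ _).trans (by simpa using h.1)
  · rw [map_sum]
    refine Finset.sum_congr rfl fun d hd => ?_
    have h := totalDegree_prod_pow_le_and_homogeneousComponent hc d Finset.univ
    rw [hn d hd] at h
    rw [homogeneousComponent_C_mul, h.2]

variable {K : Type*} [Field K]

theorem totalDegree_lineChart_le (α β : K) (i : Fin 3) : (lineChart α β i).totalDegree ≤ 1 := by
  have h : ∀ (γ : K) (j : Fin 2), (C γ * X j : MvPolynomial (Fin 2) K).totalDegree ≤ 1 :=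
    fun γ j => (totalDegree_mul _ _).trans (by simp)
  fin_cases i
  · simp [lineChart]
  · simp [lineChart]
  · refine (totalDegree_sub _ _).trans (max_le ((totalDegree_sub _ _).trans (max_le ?_ (h _ _)))
      (h _ _))
    simp

theorem homogeneousComponent_one_lineChart (α β : K) (τ : Fin 2 → K) (i : Fin 3) :
    eval τ (homogeneousComponent 1 (lineChart α β i)) =
      ![τ 0, τ 1, -(α * τ 0 + β * τ 1)] i := by
  have hX : ∀ j : Fin 2, homogeneousComponent 1 (X j : MvPolynomial (Fin 2) K) = X j := fun j =>
    homogeneousComponent_of_mem (isHomogeneous_X K j) |>.trans (if_pos rfl)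
  have h1 : homogeneousComponent 1 (1 : MvPolynomial (Fin 2) K) = 0 :=
    homogeneousComponent_of_mem (isHomogeneous_one (Fin 2) K) |>.trans (if_neg (by norm_num))
  fin_cases i
  · simp [lineChart, hX]
  · simp [lineChart, hX]
  · simp [lineChart, hX, h1, homogeneousComponent_C_mul]
    ring

variable {p : Fin 4 → MvPolynomial (Fin 3) K} {n : ℕ}

theorem eval_eq_zero_of_mem_span_of_mem_basePoints (hp : ∀ i, (p i).IsHomogeneous n)
    {A : ℙ K (Fin 3 → K)} (hA : A ∈ basePoints p) (c : K) {f : MvPolynomial (Fin 3) K}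
    (hf : f ∈ Ideal.span (Set.range p)) : eval (fun i => c * A.rep i) f = 0 := by
  have : Ideal.span (Set.range p) ≤ RingHom.ker (eval fun i => c * A.rep i) := by
    rw [Ideal.span_le]
    rintro _ ⟨i, rfl⟩
    rw [SetLike.mem_coe, RingHom.mem_ker, ← coe_aeval_eq_eval, RingHom.coe_coe,
      aeval_mul_of_isHomogeneous (hp i), ← RingHom.coe_coe, coe_aeval_eq_eval, hA i, mul_zero]
  exact this hf

/-- Eliminating the third coordinate gives a non-zero polynomial in two coordinates that vanishes at
every scaling of every base point. Fixing the coordinate `i` at a suitable value leaves a non-zero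
polynomial in the ratio. -/
theorem exists_ne_zero_eval_ratio_eq_zero [Infinite K] (hp : ∀ i, (p i).IsHomogeneous n)
    (hirr : ∀ f, Irreducible f → ∃ l, ¬ f ∣ p l) {i j : Fin 3} (hij : i ≠ j) :
    ∃ P : Polynomial K, P ≠ 0 ∧
      ∀ A ∈ basePoints p, A.rep i ≠ 0 → P.eval (A.rep j / A.rep i) = 0 := by
  obtain ⟨k, hki, hkj, hk⟩ : ∃ k : Fin 3, i ≠ k ∧ k ≠ j ∧ ∀ l, l ≠ k → l = i ∨ l = j := by
    revert i j; decide
  obtain ⟨R, hR, hRmem⟩ := exists_rename_mem_span_range hirr k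
  -- `R` need not be homogeneous, so the value `c` of the coordinate `i` is taken from a point where
  -- neither `R` nor that coordinate vanishes.
  obtain ⟨u, hu⟩ : ∃ u, eval u (R * X ⟨i, hki⟩) ≠ 0 := by
    by_contra! h
    exact mul_ne_zero hR (X_ne_zero _) (MvPolynomial.funext fun u => by rw [h u, map_zero])
  rw [map_mul, eval_X] at hu
  have hc := right_ne_zero_of_mul hu
  set c := u ⟨i, hki⟩ with hcdef
  have hP : ∀ x, (aeval (fun l : {l // l ≠ k} => if l.1 = j then Polynomial.C c * Polynomial.X
      else Polynomial.C c) R).eval x =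
      eval (fun l : {l // l ≠ k} => if l.1 = j then c * x else c) R := by
    intro x
    rw [← Polynomial.coe_evalRingHom, ← coe_aeval_eq_eval, RingHom.coe_coe,
      show (Polynomial.evalRingHom x : Polynomial K →+* K) = (Polynomial.aeval x : _ →ₐ[K] K) from
        Polynomial.ringHom_ext (by simp) (by simp), RingHom.coe_coe, ← AlgHom.comp_apply,
      comp_aeval]
    congr 2
    funext l
    split_ifs <;> simp
  refine ⟨aeval (fun l : {l // l ≠ k} => if l.1 = j then Polynomial.C c * Polynomial.X
      else Polynomial.C c) R, fun h0 => left_ne_zero_of_mul hu ?_, fun A hA hAi => ?_⟩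
  · have h := hP (if hj : j ≠ k then u ⟨j, hj⟩ / c else 0)
    rw [h0, Polynomial.eval_zero, dif_pos hkj.symm] at h
    rw [h]
    congr 2
    funext l
    split_ifs with hl
    · subst hl
      field_simp
    · obtain hl' | hl' := hk l.1 l.2
      · exact congrArg u (Subtype.ext hl')
      · exact absurd hl' hl
  · rw [hP]
    have h := eval_eq_zero_of_mem_span_of_mem_basePoints hp hA (c / A.rep i) hRmem
    rw [eval_rename] at h
    rw [← h]
    congr 2
    funext l
    simp only [Function.comp]
    split_ifs with hl
    · rw [hl]; ring
    · obtain hl' | hl' := hk l.1 l.2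
      · rw [hl']; field_simp
      · exact absurd hl' hl

theorem Projectivization.eq_of_rep_eq_mul {L : Type*} [Field L] {m : ℕ} {A B : ℙ L (Fin m → L)}
    {c : L} (h : ∀ i, A.rep i = c * B.rep i) : A = B := by
  rw [← A.mk_rep, ← B.mk_rep, Projectivization.mk_eq_mk_iff']
  exact ⟨c, funext fun i => (h i).symm⟩

/-- A parametrization without common factor has finitely many base points. -/
theorem basePoints_finite [Infinite K] (hp : ∀ i, (p i).IsHomogeneous n)
    (hirr : ∀ f, Irreducible f → ∃ l, ¬ f ∣ p l) : (basePoints p).Finite := by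
  have h : basePoints p = ⋃ i, {A ∈ basePoints p | A.rep i ≠ 0} := by
    ext A
    simp only [Set.mem_iUnion, Set.mem_setOf_eq, exists_and_left]
    exact ⟨fun hA => ⟨hA, Function.ne_iff.mp A.rep_nonzero⟩, And.left⟩
  rw [h]
  refine Set.finite_iUnion fun i => ?_
  have hfin : ∀ j, ∃ T : Set K, T.Finite ∧
      ∀ A ∈ basePoints p, A.rep i ≠ 0 → A.rep j / A.rep i ∈ T := by
    intro j
    obtain rfl | hij := eq_or_ne i j
    · exact ⟨{1}, Set.finite_singleton 1, fun A _ hAi => div_self hAi⟩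
    · obtain ⟨P, hP, h⟩ := exists_ne_zero_eval_ratio_eq_zero hp hirr hij
      exact ⟨_, Polynomial.finite_setOf_isRoot hP, h⟩
  choose T hT hmem using hfin
  refine Set.Finite.of_injOn (f := fun A j => A.rep j / A.rep i) (t := Set.univ.pi T) ?_ ?_
    (Set.Finite.pi' hT |>.subset fun x hx j => hx j trivial)
  · exact fun A hA j _ => hmem j A hA.1 hA.2
  · intro A hA B hB hAB
    refine Projectivization.eq_of_rep_eq_mul (c := A.rep i / B.rep i) fun j => ?_
    have := congrFun hAB j
    have h1 := hA.2
    have h2 := hB.2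
    field_simp at this ⊢
    linear_combination this

theorem exists_line_avoiding [Infinite K] {B : Set (ℙ K (Fin 3 → K))} (hB : B.Finite) :
    ∃ α β : K, ∀ A ∈ B, α * A.rep 0 + β * A.rep 1 + A.rep 2 ≠ 0 := by
  set Q : MvPolynomial (Fin 2) K := ∏ A ∈ hB.toFinset,
    (C (A.rep 0) * X 0 + C (A.rep 1) * X 1 + C (A.rep 2)) with hQ
  have hQ0 : Q ≠ 0 := by
    rw [hQ, Finset.prod_ne_zero_iff]
    intro A _ h
    have h0 : A.rep 2 = 0 := by simpa using congrArg (eval ![0, 0]) h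
    have h1 : A.rep 0 = 0 := by simpa [h0] using congrArg (eval ![1, 0]) h
    have h2 : A.rep 1 = 0 := by simpa [h0] using congrArg (eval ![0, 1]) h
    refine A.rep_nonzero (funext fun i => ?_)
    fin_cases i
    exacts [h1, h2, h0]
  obtain ⟨u, hu⟩ : ∃ u, eval u Q ≠ 0 := by
    by_contra! h
    exact hQ0 (MvPolynomial.funext fun u => by rw [h u, map_zero])
  refine ⟨u 0, u 1, fun A hA h0 => hu ?_⟩
  rw [hQ, map_prod]
  refine Finset.prod_eq_zero (hB.mem_toFinset.mpr hA) ?_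
  simpa [mul_comm] using h0

/-- The leading form of a component is its restriction to the removed line, so a common non-trivial
zero at infinity would be a base point on that line. -/
theorem isAffineSystem_aeval_lineChart (hp : ∀ i, (p i).IsHomogeneous n) {α β : K}
    (hαβ : ∀ A ∈ basePoints p, α * A.rep 0 + β * A.rep 1 + A.rep 2 ≠ 0) :
    IsAffineSystem (fun i => aeval (lineChart α β) (p i)) n where
  totalDegree_le i :=
    (totalDegree_aeval_le_and_homogeneousComponent (totalDegree_lineChart_le α β) (hp i)).1
  eq_zero τ hτ := by
    by_contra hτ0
    set v : Fin 3 → K := ![τ 0, τ 1, -(α * τ 0 + β * τ 1)] with hv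
    have hv0 : v ≠ 0 := by
      intro h
      apply hτ0
      funext i
      fin_cases i
      exacts [congrFun h 0, congrFun h 1]
    obtain ⟨r, hr, hrep⟩ := exists_mk_rep_eq v hv0
    refine hαβ (Projectivization.mk K v hv0) (fun i => ?_) ?_
    · have h := hτ i
      rw [(totalDegree_aeval_le_and_homogeneousComponent (totalDegree_lineChart_le α β) (hp i)).2,
        ← coe_aeval_eq_eval, RingHom.coe_coe, ← AlgHom.comp_apply, comp_aeval] at h
      rw [funext hrep, ← coe_aeval_eq_eval, RingHom.coe_coe, aeval_mul_of_isHomogeneous (hp i),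
        show v = fun i => (aeval τ : MvPolynomial (Fin 2) K →ₐ[K] K)
          (homogeneousComponent 1 (lineChart α β i)) from ?_, h, mul_zero]
      funext i
      exact (homogeneousComponent_one_lineChart α β τ i).symm.trans (by
        rw [← coe_aeval_eq_eval]; rfl)
    · rw [hrep, hrep, hrep]
      simp [hv]
      ring

end BasePoints

/-! ### Vanishing ideals of projective sets -/

section ProjectiveIdeals

variable {K : Type*} [Field K] {m : ℕ}

theorem eval_mul_of_isHomogeneous {σ : Type*} [Fintype σ] {f : MvPolynomial σ K} {N : ℕ}
    (hf : f.IsHomogeneous N) (c : K) (v : σ → K) :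
    eval (fun i => c * v i) f = c ^ N * eval v f := by
  simpa [coe_aeval_eq_eval] using aeval_mul_of_isHomogeneous (A := K) hf c v

theorem eval_aeval {σ τ : Type*} (t : τ → K) (q : σ → MvPolynomial τ K) (f : MvPolynomial σ K) :
    eval t (aeval q f) = eval (fun i => eval t (q i)) f := by
  have h := DFunLike.congr_fun (comp_aeval (φ := (aeval t : MvPolynomial τ K →ₐ[K] K)) q) f
  simpa [coe_aeval_eq_eval] using h

theorem mem_projVanishingIdeal_iff {T : Set (ℙ K (Fin m → K))} {f : MvPolynomial (Fin m) K} :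
    f ∈ projVanishingIdeal T ↔
      ∀ (v : Fin m → K) (hv : v ≠ 0), Projectivization.mk K v hv ∈ T → eval v f = 0 := by
  rw [projVanishingIdeal, mem_vanishingIdeal_iff]
  simp [coe_aeval_eq_eval]

theorem eval_rep_eq_zero_of_mem {T : Set (ℙ K (Fin m → K))} {f : MvPolynomial (Fin m) K}
    (hf : f ∈ projVanishingIdeal T) {q : ℙ K (Fin m → K)} (hq : q ∈ T) : eval q.rep f = 0 :=
  mem_projVanishingIdeal_iff.mp hf q.rep q.rep_nonzero (by rwa [q.mk_rep])

theorem mem_projVanishingIdeal_iff_of_isHomogeneous {T : Set (ℙ K (Fin m → K))}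
    {f : MvPolynomial (Fin m) K} {N : ℕ} (hf : f.IsHomogeneous N) :
    f ∈ projVanishingIdeal T ↔ ∀ q ∈ T, eval q.rep f = 0 := by
  refine ⟨fun h q hq => eval_rep_eq_zero_of_mem h hq, fun h => mem_projVanishingIdeal_iff.mpr ?_⟩
  intro v hv hvT
  obtain ⟨r, hr, hrep⟩ := exists_mk_rep_eq v hv
  have := h _ hvT
  rw [funext hrep, eval_mul_of_isHomogeneous hf] at this
  exact (mul_eq_zero.mp this).resolve_left (pow_ne_zero _ hr)

/-- On the line through a vector `v`, the values at `c * v` form a polynomial in `c` whose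
coefficients are the values of the components. It vanishes for all `c ≠ 0`, hence identically. -/
theorem homogeneousComponent_mem_projVanishingIdeal [Infinite K] {T : Set (ℙ K (Fin m → K))}
    {f : MvPolynomial (Fin m) K} (hf : f ∈ projVanishingIdeal T) (N : ℕ) :
    homogeneousComponent N f ∈ projVanishingIdeal T := by
  rw [mem_projVanishingIdeal_iff] at hf ⊢
  intro v hv hvT
  set P : Polynomial K := ∑ i ∈ Finset.range (f.totalDegree + 1),
    Polynomial.C (eval v (homogeneousComponent i f)) * Polynomial.X ^ i with hP
  have hev : ∀ c, P.eval c = eval (fun i => c * v i) f := by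
    intro c
    conv_rhs => rw [← sum_homogeneousComponent f]
    rw [hP, Polynomial.eval_finsetSum, map_sum]
    refine Finset.sum_congr rfl fun i _ => ?_
    rw [eval_mul_of_isHomogeneous (homogeneousComponent_isHomogeneous i f)]
    rw [Polynomial.eval_mul, Polynomial.eval_C, Polynomial.eval_pow, Polynomial.eval_X, mul_comm]
  have hP0 : P * Polynomial.X = 0 := by
    refine Polynomial.funext fun c => ?_
    rw [Polynomial.eval_mul, Polynomial.eval_X, Polynomial.eval_zero, hev]
    obtain rfl | hc := eq_or_ne c 0
    · rw [mul_zero]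
    · have hcv : (fun i => c * v i) ≠ 0 := fun h => hv (funext fun i =>
        (mul_eq_zero.mp (congrFun h i)).resolve_left hc)
      rw [hf _ hcv, zero_mul]
      convert hvT using 1
      rw [Projectivization.mk_eq_mk_iff']
      exact ⟨c, rfl⟩
  have hP1 : P = 0 := (mul_eq_zero.mp hP0).resolve_right Polynomial.X_ne_zero
  by_cases hN : N < f.totalDegree + 1
  · have h := congrArg (fun Q => Polynomial.coeff Q N) hP1
    simpa [hP, Polynomial.finset_sum_coeff, Polynomial.coeff_C_mul, Polynomial.coeff_X_pow, hN]
      using h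
  · rw [homogeneousComponent_eq_zero _ _ (by omega), map_zero]

theorem mem_projVanishingIdeal_iff_homogeneousComponent [Infinite K] {T : Set (ℙ K (Fin m → K))}
    {f : MvPolynomial (Fin m) K} :
    f ∈ projVanishingIdeal T ↔ ∀ N, homogeneousComponent N f ∈ projVanishingIdeal T := by
  refine ⟨homogeneousComponent_mem_projVanishingIdeal, fun h => ?_⟩
  rw [← sum_homogeneousComponent f]
  exact Ideal.sum_mem _ fun N _ => h N

theorem subset_projClosure (T : Set (ℙ K (Fin m → K))) : T ⊆ projClosure T :=
  fun _ hq _ hf => eval_rep_eq_zero_of_mem hf hq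

theorem projVanishingIdeal_projClosure [Infinite K] (T : Set (ℙ K (Fin m → K))) :
    projVanishingIdeal (projClosure T) = projVanishingIdeal T := by
  ext f
  refine ⟨fun h => ?_, fun h => mem_projVanishingIdeal_iff_homogeneousComponent.mpr fun N => ?_⟩
  · rw [mem_projVanishingIdeal_iff] at h ⊢
    exact fun v hv hvT => h v hv (subset_projClosure T hvT)
  · rw [mem_projVanishingIdeal_iff_of_isHomogeneous (homogeneousComponent_isHomogeneous N f)]
    exact fun q hq => hq _ (homogeneousComponent_mem_projVanishingIdeal h N)

theorem isProjClosed_setOf_eval_rep_eq_zero {f : MvPolynomial (Fin m) K} {N : ℕ}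
    (hf : f.IsHomogeneous N) : IsProjClosed {q : ℙ K (Fin m → K) | eval q.rep f = 0} := by
  refine Set.Subset.antisymm (fun q hq => ?_) (subset_projClosure _)
  exact hq f ((mem_projVanishingIdeal_iff_of_isHomogeneous hf).mpr fun _ h => h)

variable {p : Fin 4 → MvPolynomial (Fin 3) K} {n : ℕ}

theorem mem_projVanishingIdeal_paramImage_iff [Infinite K] (hp : ∀ i, (p i).IsHomogeneous n)
    {j : Fin 4} (hj : p j ≠ 0) {H : MvPolynomial (Fin 4) K} {N : ℕ} (hH : H.IsHomogeneous N) :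
    H ∈ projVanishingIdeal (paramImage p) ↔ aeval p H = 0 := by
  rw [paramImage, projVanishingIdeal_projClosure]
  constructor
  · intro h
    -- The factor `p j * X 0` discards the vectors that are zero or represent base points, where the
    -- map gives no information.
    have key : aeval p H * (p j * X 0) = 0 := by
      refine MvPolynomial.funext fun t => ?_
      rw [map_mul, map_mul, eval_X, map_zero]
      by_cases ht : eval t (p j) * t 0 = 0
      · rw [ht, mul_zero]
      · have ht0 : t ≠ 0 := fun h0 => ht (by simp [h0])
        obtain ⟨r, hr, hrep⟩ := exists_mk_rep_eq t ht0
        have hne : (fun i => eval (Projectivization.mk K t ht0).rep (p i)) ≠ 0 := by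
          intro h0
          have := congrFun h0 j
          simp only [funext hrep, eval_mul_of_isHomogeneous (hp j), Pi.zero_apply] at this
          exact (mul_eq_zero.mp this).elim (pow_ne_zero _ hr) (left_ne_zero_of_mul ht)
        have h1 := mem_projVanishingIdeal_iff.mp h _ hne ⟨Projectivization.mk K t ht0, hne, rfl⟩
        rw [← eval_aeval, funext hrep, eval_mul_of_isHomogeneous (hH.aeval p hp)] at h1
        rw [(mul_eq_zero.mp h1).resolve_left (pow_ne_zero _ hr), zero_mul]
    exact (mul_eq_zero.mp key).resolve_right (mul_ne_zero hj (X_ne_zero 0))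
  · intro h
    rw [mem_projVanishingIdeal_iff]
    rintro v hv ⟨A, hA, hAv⟩
    obtain ⟨c, hc⟩ := (Projectivization.mk_eq_mk_iff' K _ _ hv hA).mp hAv.symm
    rw [← hc]
    change eval (fun i => c * eval A.rep (p i)) H = 0
    rw [eval_mul_of_isHomogeneous hH, ← eval_aeval, h, map_zero, mul_zero]

end ProjectiveIdeals

/-! ### Prime ideals of codimension one -/

section Principal

variable {K : Type*} [Field K]

/-- The generators contain a transcendence basis, which has `d` elements and so leaves out one of
the `d + 1` indices. -/
theorem exists_algebraicIndependent_of_trdeg_eq {B : Type*} [CommRing B] [IsDomain B] [Algebra K B]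
    {d : ℕ} {x : Fin (d + 1) → B} (hx : Algebra.adjoin K (Set.range x) = ⊤)
    (hB : Algebra.trdeg K B = d) :
    ∃ k, AlgebraicIndependent K fun l : {l : Fin (d + 1) // l ≠ k} => x l := by
  have : Algebra.IsAlgebraic (Algebra.adjoin K (Set.range x)) B := by
    rw [hx]
    exact ⟨fun b => isAlgebraic_algebraMap (⟨b, trivial⟩ : (⊤ : Subalgebra K B))⟩
  obtain ⟨t, ht, htb⟩ := exists_isTranscendenceBasis_subset (R := K) (Set.range x)
  have hcard : Cardinal.mk t = d := by rw [htb.cardinalMk_eq_trdeg, hB]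
  choose g hg using fun y : t => ht y.2
  have hginj : Function.Injective g := fun y z h => Subtype.ext (by rw [← hg y, ← hg z, h])
  have : Finite t := Finite.of_injective g hginj
  have := Fintype.ofFinite t
  rw [Cardinal.mk_fintype, Nat.cast_inj] at hcard
  obtain ⟨k, hk⟩ : ∃ k, k ∉ Set.range g := by
    by_contra! h
    have := Fintype.card_le_of_surjective g h
    rw [Fintype.card_fin] at this
    omega
  have hbij : Function.Bijective (fun y : t => (⟨g y, fun h => hk ⟨y, h⟩⟩ : {l // l ≠ k})) := by
    rw [Fintype.bijective_iff_injective_and_card]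
    refine ⟨fun y z h => hginj (congrArg Subtype.val h), ?_⟩
    rw [hcard, Fintype.card_subtype_compl, Fintype.card_fin]
    simp
  refine ⟨k, (algebraicIndependent_equiv' (Equiv.ofBijective _ hbij) ?_).mp htb.1⟩
  funext y
  exact hg y

/-- A prime ideal of codimension one in a polynomial ring is principal. -/
theorem exists_irreducible_span_singleton_eq {d : ℕ} {I : Ideal (MvPolynomial (Fin (d + 1)) K)}
    [I.IsPrime] (hI : Algebra.trdeg K (MvPolynomial (Fin (d + 1)) K ⧸ I) = d) :
    ∃ G, Irreducible G ∧ I = Ideal.span {G} := by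
  have hbot : I ≠ ⊥ := by
    rintro rfl
    rw [(AlgEquiv.quotientBot K (MvPolynomial (Fin (d + 1)) K)).trdeg_eq,
      MvPolynomial.trdeg_of_isDomain] at hI
    simp at hI
    norm_cast at hI
    omega
  obtain ⟨G, hGI, hG⟩ := Ideal.IsPrime.exists_mem_prime_of_ne_bot ‹_› hbot
  refine ⟨G, hG.irreducible, le_antisymm (fun H hH => ?_)
    ((Ideal.span_singleton_le_iff_mem I).mpr hGI)⟩
  rw [Ideal.mem_span_singleton]
  -- If `G` did not divide `H`, elimination would give a relation in `I` among any chosen `d` of the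
  -- variables, against the algebraic independence of some `d` of them modulo `I`.
  by_contra hGH
  obtain ⟨k, hk⟩ := exists_algebraicIndependent_of_trdeg_eq
    (x := fun l => Ideal.Quotient.mkₐ K I (X l)) (by
      rw [show (fun l => Ideal.Quotient.mkₐ K I (X l)) = Ideal.Quotient.mkₐ K I ∘ X from rfl,
        Set.range_comp, ← AlgHom.map_adjoin, adjoin_range_X, Algebra.map_top]
      exact (AlgHom.range_eq_top _).mpr (Ideal.Quotient.mkₐ_surjective K I)) hI
  obtain ⟨R, hR, hRmem⟩ := exists_rename_mem_span_pair hG.irreducible hGH k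
  apply hR
  rw [AlgebraicIndependent] at hk
  apply hk
  rw [map_zero]
  have h1 : Ideal.Quotient.mkₐ K I (rename Subtype.val R) = 0 := by
    rw [Ideal.Quotient.mkₐ_eq_mk, Ideal.Quotient.eq_zero_iff_mem]
    refine (Ideal.span_le.mpr ?_ : Ideal.span {G, H} ≤ I) hRmem
    rintro _ (rfl | rfl)
    exacts [hGI, hH]
  rw [← h1, ← AlgHom.comp_apply]
  refine DFunLike.congr_fun (MvPolynomial.algHom_ext fun l => ?_) R
  simp

end Principal

/-! ### Existence and degree of the implicit equation -/

section ImplicitEquation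

variable {K : Type*} [Field K]

theorem homogeneousComponent_totalDegree_ne_zero {σ : Type*} {f : MvPolynomial σ K} (hf : f ≠ 0) :
    homogeneousComponent f.totalDegree f ≠ 0 := by
  intro h
  obtain h0 | h0 := Nat.eq_zero_or_eq_succ_pred f.totalDegree
  · rw [h0, homogeneousComponent_zero, map_eq_zero] at h
    rw [totalDegree_eq_zero_iff_eq_C] at h0
    exact hf (by rw [h0, h, map_zero])
  · rw [h0] at h
    have := totalDegree_le_of_homogeneousComponent_eq_zero h0.le h
    omega

/-- The cofactor has degree zero, so the polynomial is a constant multiple of its own leading form.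
-/
theorem isHomogeneous_of_dvd_homogeneousComponent {σ : Type*} {f : MvPolynomial σ K}
    (h : f ∣ homogeneousComponent f.totalDegree f) : f.IsHomogeneous f.totalDegree := by
  obtain rfl | hf := eq_or_ne f 0
  · exact isHomogeneous_zero _ _ _
  obtain ⟨g, hg⟩ := h
  have hne := homogeneousComponent_totalDegree_ne_zero hf
  have hg0 : g ≠ 0 := fun h0 => hne (by rw [hg, h0, mul_zero])
  have hdeg := (homogeneousComponent_isHomogeneous f.totalDegree f).totalDegree hne
  rw [hg, totalDegree_mul_of_isDomain hf hg0, Nat.add_eq_left, totalDegree_eq_zero_iff_eq_C] at hdeg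
  have hc : g.coeff 0 ≠ 0 := fun h0 => hg0 (by rw [hdeg, h0, map_zero])
  have hfC : f = C (g.coeff 0)⁻¹ * homogeneousComponent f.totalDegree f := by
    rw [hg, hdeg, coeff_zero_C, mul_comm f, ← mul_assoc, ← map_mul, inv_mul_cancel₀ hc, map_one,
      one_mul]
  have := (isHomogeneous_C σ (g.coeff 0)⁻¹).mul (homogeneousComponent_isHomogeneous f.totalDegree f)
  rw [← hfC, zero_add] at this
  exact this

theorem IsProjSurface.exists_irreducible_isImplicitEquation [Infinite K]
    {S : Set (ℙ K (Fin 4 → K))} (hS : IsProjSurface S) :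
    ∃ G, Irreducible G ∧ IsImplicitEquation S G := by
  obtain ⟨-, hprime, htr⟩ := hS
  obtain ⟨G, hG, hI⟩ := exists_irreducible_span_singleton_eq htr
  refine ⟨G, hG, isHomogeneous_of_dvd_homogeneousComponent ?_, hI⟩
  rw [← Ideal.mem_span_singleton, ← hI]
  refine homogeneousComponent_mem_projVanishingIdeal ?_ _
  rw [hI]
  exact Ideal.mem_span_singleton_self G

theorem IsImplicitEquation.surfaceDegree_eq {S : Set (ℙ K (Fin 4 → K))}
    {G : MvPolynomial (Fin 4) K} (hG : IsImplicitEquation S G) (hG0 : G ≠ 0) :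
    surfaceDegree S = G.totalDegree := by
  obtain ⟨G', hG', h⟩ := Nat.sInf_mem (s := {d | ∃ G, IsImplicitEquation S G ∧ G.totalDegree = d})
    ⟨_, G, hG, rfl⟩
  rw [surfaceDegree, ← h]
  have hassoc : Associated G' G := by
    rw [← Ideal.span_singleton_eq_span_singleton, ← hG'.2, hG.2]
  obtain ⟨u, rfl⟩ := hassoc
  have hG'0 : G' ≠ 0 := left_ne_zero_of_mul hG0
  rw [totalDegree_mul_of_isDomain hG'0 u.ne_zero]
  have := totalDegree_mul_of_isDomain u.ne_zero u⁻¹.ne_zero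
  rw [Units.mul_inv, totalDegree_one] at this
  omega

/-- Four polynomials in two variables generate an algebra of transcendence degree at most two, while
that of the coordinate ring of `S` is three. As the `r i` share a positive degree, the components of
a relation are again relations. Applied to the leading forms of the components, this separates the
image of the line at infinity from `S`. -/
theorem exists_isHomogeneous_aeval_eq_zero_notMem {S : Set (ℙ K (Fin 4 → K))}
    (hS : IsProjSurface S) {n : ℕ} (hn : 0 < n) {r : Fin 4 → MvPolynomial (Fin 2) K}
    (hr : ∀ i, (r i).IsHomogeneous n) :
    ∃ (N : ℕ) (Λ : MvPolynomial (Fin 4) K), Λ.IsHomogeneous N ∧ aeval r Λ = 0 ∧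
      Λ ∉ projVanishingIdeal S := by
  obtain ⟨-, hprime, htr⟩ := hS
  obtain ⟨Λ, hΛ, hΛS⟩ : ∃ Λ, aeval r Λ = 0 ∧ Λ ∉ projVanishingIdeal S := by
    by_contra! hcon
    have hle : RingHom.ker (aeval r : MvPolynomial (Fin 4) K →ₐ[K] MvPolynomial (Fin 2) K) ≤
      projVanishingIdeal S := hcon
    have h1 := trdeg_le_of_surjective (Ideal.Quotient.factorₐ K hle)
      (Ideal.Quotient.factor_surjective hle)
    have h2 := trdeg_le_of_injective (Ideal.kerLiftAlg (aeval (R := K) r))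
      (Ideal.kerLiftAlg_injective _)
    rw [htr] at h1
    have h3 := h1.trans h2
    rw [MvPolynomial.trdeg_of_isDomain] at h3
    simp at h3
    norm_cast at h3
  obtain ⟨N, hN⟩ : ∃ N, homogeneousComponent N Λ ∉ projVanishingIdeal S := by
    by_contra! hcon
    exact hΛS (sum_homogeneousComponent Λ ▸ Ideal.sum_mem _ fun N _ => hcon N)
  refine ⟨N, _, homogeneousComponent_isHomogeneous N Λ, ?_, hN⟩
  have h := congrArg (homogeneousComponent (n * N)) hΛ
  rw [map_zero, ← sum_homogeneousComponent Λ, map_sum, map_sum] at h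
  have hcomp : ∀ M, homogeneousComponent (n * N) (aeval r (homogeneousComponent M Λ)) =
      if M = N then aeval r (homogeneousComponent M Λ) else 0 := by
    intro M
    rw [homogeneousComponent_of_mem ((homogeneousComponent_isHomogeneous M Λ).aeval r hr)]
    simp [hn.ne', eq_comm]
  simp only [hcomp, Finset.sum_ite_eq', Finset.mem_range] at h
  by_cases hlt : N < Λ.totalDegree + 1
  · simpa [hlt] using h
  · rw [homogeneousComponent_eq_zero _ _ (by omega), map_zero]

end ImplicitEquation

/-! ### Points, base points and fibres in the affine chart -/

section LineChart

variable {K : Type*} [Field K] {α β : K}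

theorem lineChart_form (α β : K) (a : Fin 2 → K) :
    α * eval a (lineChart α β 0) + β * eval a (lineChart α β 1) + eval a (lineChart α β 2) = 1 := by
  simp [lineChart]

theorem lineCoord_mul_lineChart {r : K} (hr : r ≠ 0) (a : Fin 2 → K) :
    lineCoord α β (fun i => r * eval a (lineChart α β i)) = a := by
  have h : α * (r * eval a (lineChart α β 0)) + β * (r * eval a (lineChart α β 1)) +
      r * eval a (lineChart α β 2) = r := by
    linear_combination r * lineChart_form α β a
  funext k
  fin_cases k <;> simp only [lineCoord, h] <;> simp [lineChart, hr]

theorem injOn_lineCoord : Set.InjOn (fun A : ℙ K (Fin 3 → K) => lineCoord α β A.rep)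
    {A | α * A.rep 0 + β * A.rep 1 + A.rep 2 ≠ 0} := by
  intro A hA B hB h
  refine Projectivization.eq_of_rep_eq_mul (c := (α * A.rep 0 + β * A.rep 1 + A.rep 2) *
    (α * B.rep 0 + β * B.rep 1 + B.rep 2)⁻¹) fun i => ?_
  rw [mul_assoc, ← eval_lineChart_lineCoord hB, ← show lineCoord α β A.rep = lineCoord α β B.rep
    from h, eval_lineChart_lineCoord hA, mul_inv_cancel_left₀ hA]

theorem exists_rep_eq_mul_lineChart (α β : K) (a : Fin 2 → K) :
    ∃ (A : ℙ K (Fin 3 → K)) (r : K), r ≠ 0 ∧ (∀ i, A.rep i = r * eval a (lineChart α β i)) ∧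
      lineCoord α β A.rep = a ∧ α * A.rep 0 + β * A.rep 1 + A.rep 2 ≠ 0 := by
  have hne : (fun i => eval a (lineChart α β i)) ≠ 0 := by
    intro h
    have h1 := lineChart_form α β a
    have h2 : ∀ i, eval a (lineChart α β i) = 0 := fun i => congrFun h i
    rw [h2, h2, h2] at h1
    simp at h1
  obtain ⟨r, hr, hrep⟩ := exists_mk_rep_eq _ hne
  refine ⟨_, r, hr, hrep, by rw [funext hrep, lineCoord_mul_lineChart hr], ?_⟩
  rw [hrep, hrep, hrep]
  convert hr using 1
  linear_combination r * lineChart_form α β a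

theorem eval_aeval_lineChart_lineCoord {f : MvPolynomial (Fin 3) K} {n : ℕ}
    (hf : f.IsHomogeneous n) {v : Fin 3 → K} (hv : α * v 0 + β * v 1 + v 2 ≠ 0) :
    eval (lineCoord α β v) (aeval (lineChart α β) f) =
      (α * v 0 + β * v 1 + v 2)⁻¹ ^ n * eval v f := by
  rw [eval_aeval, funext (eval_lineChart_lineCoord hv), eval_mul_of_isHomogeneous hf]

theorem eq_zero_of_aeval_lineChart_eq_zero [Infinite K] {f : MvPolynomial (Fin 3) K} {n : ℕ}
    (hf : f.IsHomogeneous n) (h : aeval (lineChart α β) f = 0) : f = 0 := by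
  have key : f * (C α * X 0 + C β * X 1 + X 2) = 0 := by
    refine MvPolynomial.funext fun v => ?_
    simp only [map_mul, map_add, eval_C, eval_X, map_zero]
    by_cases hv : α * v 0 + β * v 1 + v 2 = 0
    · rw [hv, mul_zero]
    · have h1 := eval_aeval_lineChart_lineCoord hf hv
      rw [h, map_zero] at h1
      rw [(mul_eq_zero.mp h1.symm).resolve_left (pow_ne_zero _ (inv_ne_zero hv)), zero_mul]
  refine (mul_eq_zero.mp key).resolve_right fun h0 => ?_
  have := congrArg (eval ![0, 0, 1]) h0
  simp at this

variable {p : Fin 4 → MvPolynomial (Fin 3) K} {n : ℕ}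

theorem bijOn_lineCoord_basePoints (hp : ∀ i, (p i).IsHomogeneous n)
    (hαβ : ∀ A ∈ basePoints p, α * A.rep 0 + β * A.rep 1 + A.rep 2 ≠ 0) :
    Set.BijOn (fun A : ℙ K (Fin 3 → K) => lineCoord α β A.rep) (basePoints p)
      {a | ∀ i, eval a (aeval (lineChart α β) (p i)) = 0} := by
  refine ⟨fun A hA i => ?_, injOn_lineCoord.mono hαβ, fun a ha => ?_⟩
  · rw [eval_aeval_lineChart_lineCoord (hp i) (hαβ A hA), hA i, mul_zero]
  · obtain ⟨A, r, hr, hrep, hA, -⟩ := exists_rep_eq_mul_lineChart α β a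
    refine ⟨A, fun i => ?_, hA⟩
    have := ha i
    rw [eval_aeval] at this
    rw [funext hrep, eval_mul_of_isHomogeneous (hp i), this, mul_zero]

theorem mem_paramFiber_iff {y : ℙ K (Fin 4 → K)} {A : ℙ K (Fin 3 → K)} :
    A ∈ paramFiber p y ↔ ∃ c : K, c ≠ 0 ∧ ∀ i, eval A.rep (p i) = c * y.rep i := by
  constructor
  · rintro ⟨h, hy⟩
    rw [← y.mk_rep, Projectivization.mk_eq_mk_iff'] at hy
    obtain ⟨c, hc⟩ := hy
    refine ⟨c, ?_, fun i => (congrFun hc i).symm⟩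
    rintro rfl
    exact h (by rw [← hc, zero_smul])
  · rintro ⟨c, hc, h⟩
    have hne : (fun i => eval A.rep (p i)) ≠ 0 := by
      intro h0
      apply y.rep_nonzero
      funext i
      have := congrFun h0 i
      simp only [h] at this
      exact (mul_eq_zero.mp this).resolve_left hc
    refine ⟨hne, ?_⟩
    conv_rhs => rw [← y.mk_rep]
    rw [Projectivization.mk_eq_mk_iff']
    exact ⟨c, funext fun i => (h i).symm⟩

theorem encard_paramFiber_eq (hp : ∀ i, (p i).IsHomogeneous n) {y : ℙ K (Fin 4 → K)} {j : Fin 4}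
    (hj : y.rep j ≠ 0)
    (hy : ∀ A ∈ paramFiber p y, α * A.rep 0 + β * A.rep 1 + A.rep 2 ≠ 0) :
    (paramFiber p y).encard = {a | eval a (aeval (lineChart α β) (p j)) ≠ 0 ∧
      ∀ i, eval a (aeval (lineChart α β) (p i)) =
        y.rep i / y.rep j * eval a (aeval (lineChart α β) (p j))}.encard := by
  rw [← (injOn_lineCoord.mono hy).encard_image]
  congr 1
  ext a
  constructor
  · rintro ⟨A, hA, rfl⟩
    have hℓ := hy A hA
    obtain ⟨c, hc, h⟩ := mem_paramFiber_iff.mp hA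
    simp only [Set.mem_setOf_eq, eval_aeval_lineChart_lineCoord (hp _) hℓ, h]
    refine ⟨mul_ne_zero (pow_ne_zero _ (inv_ne_zero hℓ)) (mul_ne_zero hc hj), fun i => ?_⟩
    field_simp
  · rintro ⟨ha, h⟩
    obtain ⟨A, r, hr, hrep, hA, -⟩ := exists_rep_eq_mul_lineChart α β a
    refine ⟨A, mem_paramFiber_iff.mpr ⟨r ^ n * (eval a (aeval (lineChart α β) (p j)) / y.rep j),
      mul_ne_zero (pow_ne_zero _ hr) (div_ne_zero ha hj), fun i => ?_⟩, hA⟩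
    rw [funext hrep, eval_mul_of_isHomogeneous (hp i), ← eval_aeval, h]
    ring

end LineChart

/-! ### The cardinality of the generic fibre -/

section GenericFiber

variable {K : Type*} [Field K]

theorem ratioField_exists_aeval {σ : Type*} (q : Fin 4 → MvPolynomial σ K) (j : Fin 4) :
    ∃ b : Fin 4 → ratioField q j, (∀ H : MvPolynomial (Fin 4) K, algebraMap (ratioField q j) (FractionRing (MvPolynomial σ K))
      (aeval b H) = aeval (ratioFun q j) H) ∧
      ∀ z, ∃ r s : MvPolynomial (Fin 4) K, aeval b s ≠ 0 ∧ z * aeval b s = aeval b r := by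
  let b : Fin 4 → ratioField q j :=
    fun i => ⟨ratioFun q j i, IntermediateField.subset_adjoin _ _ ⟨i, rfl⟩⟩
  have hb : ∀ H : MvPolynomial (Fin 4) K, algebraMap (ratioField q j) (FractionRing (MvPolynomial σ K)) (aeval b H) =
      aeval (ratioFun q j) H := by
    intro H
    have : (ratioField q j).val.comp (aeval b) = aeval (ratioFun q j) := by ext i; simp [b]
    exact congrFun (congrArg DFunLike.coe this) H
  refine ⟨b, hb, ?_⟩
  rintro ⟨z, hz⟩
  obtain ⟨r, s, hrs⟩ := (IntermediateField.mem_adjoin_range_iff K (ratioFun q j) z).mp hz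
  by_cases hs : aeval (ratioFun q j) s = 0
  · refine ⟨0, 1, by simp, ?_⟩
    rw [hs, div_zero] at hrs
    subst hrs
    rw [map_one, map_zero, mul_one]
    rfl
  · refine ⟨r, s, fun h0 => hs ?_, ?_⟩
    · rw [← hb, h0, map_zero]
    · apply (algebraMap (ratioField q j) (FractionRing (MvPolynomial σ K))).injective
      rw [map_mul, hb, hb]
      change z * _ = _
      rw [hrs, div_mul_cancel₀ _ hs]

theorem aeval_ratioFun_eq_zero_iff {σ : Type*} {q : Fin 4 → MvPolynomial σ K} {j : Fin 4}
    (hj : q j ≠ 0) {H : MvPolynomial (Fin 4) K} {N : ℕ} (hH : H.IsHomogeneous N) :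
    aeval (ratioFun q j) H = 0 ↔ aeval q H = 0 := by
  have hinj := IsFractionRing.injective (MvPolynomial σ K) (FractionRing (MvPolynomial σ K))
  rw [← map_eq_zero_iff _ hinj, aeval_algebraMap_eq_mul_aeval_ratioFun hj hH, mul_eq_zero]
  exact (or_iff_right (pow_ne_zero _ ((map_ne_zero_iff _ hinj).mpr hj))).symm

/-- The open condition from the affine fibre count is made homogeneous, with an extra factor `X j`
that allows `y` to be scaled so that its `j`-th coordinate is `1`. -/
theorem exists_isHomogeneous_encard_eq_finrank [IsAlgClosed K] [CharZero K]
    {q : Fin 4 → MvPolynomial (Fin 2) K} {j : Fin 4} (hj : q j ≠ 0)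
    [Module.Finite (ratioField q j) (FractionRing (MvPolynomial (Fin 2) K))] :
    ∃ (N : ℕ) (Φ : MvPolynomial (Fin 4) K), Φ.IsHomogeneous N ∧ aeval q Φ ≠ 0 ∧
      ∀ y : Fin 4 → K, (∀ M H, H.IsHomogeneous M → aeval q H = 0 → eval y H = 0) →
      eval y Φ ≠ 0 → y j ≠ 0 ∧
      {a | eval a (q j) ≠ 0 ∧ ∀ i, eval a (q i) = y i / y j * eval a (q j)}.encard =
        Module.finrank (ratioField q j) (FractionRing (MvPolynomial (Fin 2) K)) := by
  obtain ⟨b, hb, hfrac⟩ := ratioField_exists_aeval q j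
  have hinj := IsFractionRing.injective (MvPolynomial (Fin 2) K)
    (FractionRing (MvPolynomial (Fin 2) K))
  have hb0 : ∀ H : MvPolynomial (Fin 4) K, aeval b H = 0 ↔ aeval (ratioFun q j) H = 0 := fun H => by
    rw [← hb, map_eq_zero (algebraMap (ratioField q j) _)]
  have hbi : ∀ i, algebraMap _ (FractionRing (MvPolynomial (Fin 2) K)) (b i) = ratioFun q j i :=
    fun i => by simpa only [aeval_X] using hb (X i)
  obtain ⟨H, hH, hHy⟩ := exists_encard_fiber_eq_finrank (f := b) (q := q) hj (fun i => by
    rw [hbi, ratioFun, div_mul_cancel₀ _ ((map_ne_zero_iff _ hinj).mpr hj)]) hfrac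
  have hΦ := (isHomogeneous_X K j).mul (homogenizeAt_isHomogeneous j H.totalDegree H)
  refine ⟨_, _, hΦ, ?_, fun y hy hyΦ => ?_⟩
  · rw [ne_eq, ← aeval_ratioFun_eq_zero_iff hj hΦ, map_mul, aeval_X, ratioFun_self hj, one_mul,
      aeval_homogenizeAt le_rfl (ratioFun_self hj), ← hb0]
    exact hH
  · rw [map_mul, eval_X] at hyΦ
    have hyj := left_ne_zero_of_mul hyΦ
    have hone : (fun i => (y j)⁻¹ * y i) j = 1 := inv_mul_cancel₀ hyj
    have hhom : ∀ R : MvPolynomial (Fin 4) K, eval (fun i => (y j)⁻¹ * y i) R =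
        (y j)⁻¹ ^ R.totalDegree * eval y (homogenizeAt j R.totalDegree R) := by
      intro R
      rw [← eval_mul_of_isHomogeneous (homogenizeAt_isHomogeneous j _ R)]
      simpa [coe_aeval_eq_eval] using (aeval_homogenizeAt (A := K) (le_refl R.totalDegree) hone).symm
    refine ⟨hyj, ?_⟩
    have h := hHy (fun i => (y j)⁻¹ * y i) (fun R hR => ?_) ?_
    · simpa only [div_eq_inv_mul] using h
    · rw [hhom, hy _ _ (homogenizeAt_isHomogeneous j _ R), mul_zero]
      rwa [← aeval_ratioFun_eq_zero_iff hj (homogenizeAt_isHomogeneous j _ R),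
        aeval_homogenizeAt le_rfl (ratioFun_self hj), ← hb0]
    · rw [hhom]
      exact mul_ne_zero (pow_ne_zero _ (inv_ne_zero hyj)) (right_ne_zero_of_mul hyΦ)

variable {p : Fin 4 → MvPolynomial (Fin 3) K} {n : ℕ}

/-- As the vanishing ideal is prime, two non-empty open subsets meet, and both counts hold at a
common point. -/
theorem IsGenericFiberCard.unique (hS : (projVanishingIdeal (paramImage p)).IsPrime) {c c' : ℕ}
    (hc : IsGenericFiberCard p c) (hc' : IsGenericFiberCard p c') : c = c' := by
  have key : ∀ {Z : Set (ℙ K (Fin 4 → K))}, IsProjClosed Z → ¬ paramImage p ⊆ Z →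
      ∃ f ∈ projVanishingIdeal Z, f ∉ projVanishingIdeal (paramImage p) := by
    intro Z hZ hpZ
    obtain ⟨q, hq, hqZ⟩ := Set.not_subset.mp hpZ
    rw [← show projClosure Z = Z from hZ] at hqZ
    simp only [projClosure, Set.mem_setOf_eq, not_forall] at hqZ
    obtain ⟨f, hf, hfq⟩ := hqZ
    exact ⟨f, hf, fun h => hfq (eval_rep_eq_zero_of_mem h hq)⟩
  obtain ⟨Z, hZ, hpZ, h⟩ := hc
  obtain ⟨Z', hZ', hpZ', h'⟩ := hc'
  obtain ⟨f, hf, hfS⟩ := key hZ hpZ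
  obtain ⟨f', hf', hfS'⟩ := key hZ' hpZ'
  have hff : f * f' ∉ projVanishingIdeal (paramImage p) := fun h0 =>
    (hS.mem_or_mem h0).elim hfS hfS'
  simp only [mem_projVanishingIdeal_iff, not_forall] at hff
  obtain ⟨v, hv, hvS, hvf⟩ := hff
  rw [map_mul] at hvf
  have h1 := h _ ⟨hvS, fun h0 => left_ne_zero_of_mul hvf
    (mem_projVanishingIdeal_iff.mp hf v hv h0)⟩
  have h2 := h' _ ⟨hvS, fun h0 => right_ne_zero_of_mul hvf
    (mem_projVanishingIdeal_iff.mp hf' v hv h0)⟩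
  exact_mod_cast h1.symm.trans h2

/-- The open set is the locus where `Λ * Φ` is non-zero: `Φ` ensures that the affine part of the
fibre has the right number of points, and `Λ` excludes points whose fibre meets the removed line. -/
theorem isGenericFiberCard_finrank [IsAlgClosed K] [CharZero K] (hp : ∀ i, (p i).IsHomogeneous n)
    (hn : 0 < n) (hS : IsProjSurface (paramImage p)) (α β : K) {j : Fin 4} (hj : p j ≠ 0)
    [Module.Finite (ratioField (fun i => aeval (lineChart α β) (p i)) j)
      (FractionRing (MvPolynomial (Fin 2) K))] :
    IsGenericFiberCard p (Module.finrank (ratioField (fun i => aeval (lineChart α β) (p i)) j)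
      (FractionRing (MvPolynomial (Fin 2) K))) := by
  set q : Fin 4 → MvPolynomial (Fin 2) K := fun i => aeval (lineChart α β) (p i) with hq
  have hqj : q j ≠ 0 := fun h => hj (eq_zero_of_aeval_lineChart_eq_zero (hp j) h)
  have haev : ∀ H : MvPolynomial (Fin 4) K, aeval q H = aeval (lineChart α β) (aeval p H) := fun H =>
    (DFunLike.congr_fun (comp_aeval (φ := (aeval (lineChart α β) :
      MvPolynomial (Fin 3) K →ₐ[K] MvPolynomial (Fin 2) K)) p) H).symm
  have hmem : ∀ M H, H.IsHomogeneous M → (H ∈ projVanishingIdeal (paramImage p) ↔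
      aeval q H = 0) := by
    intro M H hH
    rw [mem_projVanishingIdeal_paramImage_iff hp hj hH, haev]
    exact ⟨fun h => by rw [h, map_zero],
      eq_zero_of_aeval_lineChart_eq_zero (hH.aeval p hp)⟩
  obtain ⟨N, Φ, hΦ, hΦq, hΦy⟩ := exists_isHomogeneous_encard_eq_finrank hqj
  obtain ⟨M, Λ, hΛ, hΛr, hΛS⟩ := exists_isHomogeneous_aeval_eq_zero_notMem hS hn
    (fun i => homogeneousComponent_isHomogeneous n (q i))
  have hΩ := hΛ.mul hΦ
  refine ⟨_, isProjClosed_setOf_eval_rep_eq_zero hΩ, fun hsub => ?_, fun y hy => ?_⟩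
  · have h := (mem_projVanishingIdeal_iff_of_isHomogeneous hΩ).mpr fun q hq => hsub hq
    exact (hS.2.1.mem_or_mem h).elim hΛS fun h => hΦq ((hmem N Φ hΦ).mp h)
  · have hyΩ : eval y.rep (Λ * Φ) ≠ 0 := hy.2
    rw [map_mul] at hyΩ
    obtain ⟨hyj, hcard⟩ := hΦy y.rep
      (fun M H hH h0 => eval_rep_eq_zero_of_mem ((hmem M H hH).mpr h0) hy.1)
      (right_ne_zero_of_mul hyΩ)
    rw [encard_paramFiber_eq hp hyj fun A hA h0 => ?_, hcard]
    apply left_ne_zero_of_mul hyΩ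
    obtain ⟨c, hc, hcA⟩ := mem_paramFiber_iff.mp hA
    -- On the removed line the first two coordinates determine the third, and the leading forms take
    -- the values of the components; the relation `Λ` among these forms then holds at `y`.
    have h1 : ∀ i, eval ![A.rep 0, A.rep 1] (homogeneousComponent n (q i)) = c * y.rep i := by
      intro i
      rw [hq, (totalDegree_aeval_le_and_homogeneousComponent (totalDegree_lineChart_le α β) (hp i)).2,
        eval_aeval, ← hcA]
      congr 2
      funext k
      rw [homogeneousComponent_one_lineChart]
      fin_cases k
      · rfl
      · rfl
      · change -(α * A.rep 0 + β * A.rep 1) = A.rep 2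
        linear_combination -h0
    have h2 := eval_aeval ![A.rep 0, A.rep 1] (fun i => homogeneousComponent n (q i)) Λ
    rw [hΛr, map_zero, funext h1, eval_mul_of_isHomogeneous hΛ] at h2
    exact (mul_eq_zero.mp h2.symm).resolve_left (pow_ne_zero _ hc)

end GenericFiber

/-! ### Assembly of the degree formula -/

/-- The degree formula for a rational surface parametrization `p = (p₁ : p₂ : p₃ : p₄)` of degree
`n`, together with its version in terms of Hilbert–Samuel multiplicities. The first four conjuncts
say that the quantities in the formula are well defined. -/
theorem mainTheorem1 {K : Type*} [Field K] [IsAlgClosed K] [CharZero K]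
    (n : ℕ) (p : Fin 4 → MvPolynomial (Fin 3) K)
    (hhom : ∀ i, (p i).IsHomogeneous n)
    (hgcd : ∀ d : MvPolynomial (Fin 3) K, (∀ i, d ∣ p i) → IsUnit d)
    (S : Set (ℙ K (Fin 4 → K))) (hS : IsProjSurface S) (hpS : paramImage p = S) :
    (basePoints p).Finite ∧
    (∀ A ∈ basePoints p, Module.Finite (GenericField K)
      (IntersectionRing (extendPoint A) (genericCurve p 0) (genericCurve p 1))) ∧
    (∃ G, IsImplicitEquation S G) ∧
    IsGenericFiberCard p (degMap p) ∧
    (baseLocusMult p : ℤ) = (n : ℤ) ^ 2 - (surfaceDegree S : ℤ) * (degMap p : ℤ) ∧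
    ∃ e : ℙ K (Fin 3 → K) → ℕ,
      (∀ A ∈ basePoints p, IsHilbertSamuelMult K (localBaseIdeal p A) (e A)) ∧
      (surfaceDegree S : ℤ) * (degMap p : ℤ) =
        (n : ℤ) ^ 2 - ((∑ᶠ A ∈ basePoints p, e A : ℕ) : ℤ) := by

  subst hpS
  have hirr : ∀ f : MvPolynomial (Fin 3) K, Irreducible f → ∃ l, ¬ f ∣ p l := by
    intro f hf
    by_contra! h
    exact hf.not_isUnit (hgcd f h)
  have hfin := basePoints_finite hhom hirr
  obtain ⟨α, β, hαβ⟩ := exists_line_avoiding hfin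
  set q : Fin 4 → MvPolynomial (Fin 2) K := fun i => aeval (lineChart α β) (p i) with hq
  have hsys : IsAffineSystem q n := isAffineSystem_aeval_lineChart hhom hαβ
  obtain ⟨j, hj⟩ : ∃ j, p j ≠ 0 := by
    by_contra! h
    exact not_isUnit_zero (hgcd 0 fun i => (h i).symm.dvd)
  have hqj : q j ≠ 0 := fun h => hj (eq_zero_of_aeval_lineChart_eq_zero (hhom j) h)
  obtain ⟨G, hG, hGS⟩ := hS.exists_irreducible_isImplicitEquation
  have hGq : ∀ N H, H.IsHomogeneous N → (aeval q H = 0 ↔ G ∣ H) := by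
    intro N H hH
    rw [← Ideal.mem_span_singleton, ← hGS.2, mem_projVanishingIdeal_paramImage_iff hhom hj hH,
      show aeval q H = aeval (lineChart α β) (aeval p H) from
        (DFunLike.congr_fun (comp_aeval (φ := (aeval (lineChart α β) :
          MvPolynomial (Fin 3) K →ₐ[K] MvPolynomial (Fin 2) K)) p) H).symm]
    exact ⟨eq_zero_of_aeval_lineChart_eq_zero (hH.aeval p hhom), fun h => by rw [h, map_zero]⟩
  obtain ⟨hfinrank, hsq⟩ := hsys.sq_eq_finsum_add hqj hGS.1 hG hGq
  have hx := algebraicIndependent_genericCoeff K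
  have hmult : ∀ A ∈ basePoints p, basePointMult p A = Module.finrank (GenericField K)
      (Localization.AtPrime (pointIdeal fun i =>
        algebraMap K (GenericField K) (lineCoord α β A.rep i)) ⧸
        (linearSectionIdeal (fun z => genericCoeff K z.1 z.2) q).map
          (algebraMap (MvPolynomial (Fin 2) (GenericField K)) (Localization.AtPrime (pointIdeal
            fun i => algebraMap K (GenericField K) (lineCoord α β A.rep i))))) := by
    intro A hA
    obtain ⟨e⟩ := exists_intersectionRing_algEquiv hhom A (hαβ A hA)
    exact e.toLinearEquiv.finrank_eq
  have hsum : baseLocusMult p = ∑ᶠ a ∈ {a : Fin 2 → K | ∀ i, eval a (q i) = 0},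
      Module.finrank (GenericField K) (Localization.AtPrime
        (pointIdeal fun i => algebraMap K (GenericField K) (a i)) ⧸
        (linearSectionIdeal (fun z => genericCoeff K z.1 z.2) q).map
          (algebraMap (MvPolynomial (Fin 2) (GenericField K)) (Localization.AtPrime
            (pointIdeal fun i => algebraMap K (GenericField K) (a i))))) :=
    finsum_mem_eq_of_bijOn _ (bijOn_lineCoord_basePoints hhom hαβ) hmult
  have hdeg : 0 < G.totalDegree := by
    by_contra! h
    rw [Nat.le_zero, totalDegree_eq_zero_iff_eq_C] at h
    exact hG.not_isUnit (h ▸ (isUnit_iff_ne_zero.mpr fun h0 => hG.ne_zero (by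
      rw [h, h0, map_zero])).map C)
  -- Both the degree of the surface and the degree of the field extension are positive, so `n ^ 2`
  -- is.
  have hn : 0 < n := by
    by_contra! h
    have hpos := Nat.mul_pos hdeg (Module.finrank_pos (R := ratioField q j)
      (M := FractionRing (MvPolynomial (Fin 2) K)))
    rw [Nat.le_zero.mp h] at hsq
    omega
  have hcard := isGenericFiberCard_finrank hhom hn hS α β hj
  -- The set of generic fibre cardinalities is non-empty, so the infimum belongs to it and is not a
  -- default value.
  have hmem : IsGenericFiberCard p (degMap p) :=
    Nat.sInf_mem (s := {c | IsGenericFiberCard p c}) ⟨_, hcard⟩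
  have hmain : baseLocusMult p + surfaceDegree (paramImage p) * degMap p = n ^ 2 := by
    rw [hsum, hGS.surfaceDegree_eq hG.ne_zero, hmem.unique hS.2.1 hcard, hsq]
  refine ⟨hfin, fun A hA => ?_, ⟨G, hGS⟩, hmem, ?_, basePointMult p, fun A hA => ?_, ?_⟩
  · obtain ⟨e⟩ := exists_intersectionRing_algEquiv hhom A (hαβ A hA)
    have := finite_localization_quotient_map (hsys.finrank_quotient_linearSectionIdeal hx).1
      (fun i => algebraMap K (GenericField K) (lineCoord α β A.rep i))
    exact Module.Finite.equiv e.symm.toLinearEquiv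
  · rw [eq_sub_iff_add_eq]
    exact_mod_cast hmain
  · rw [hmult A hA]
    exact isHilbertSamuelMult_localBaseIdeal hhom A (hαβ A hA)
      (hsys.isHilbertSamuelMult hx (lineCoord α β A.rep))
  · rw [eq_sub_iff_add_eq, add_comm]
    exact_mod_cast hmain

end
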